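/- **Setting.** Let $d,k',m\ge 1$ be integers. A random symmetric matrix $A\in\mathbb R^{d\times d}$ is a GOE matrix if its entries on and above the diagonal are independent, $A_{ii}\sim N(0,1)$ and $A_{ij}\sim N(0,\tfrac12)$ for $i<j$. Let $A_1,\dots,A_m$ be i.i.d. GOE matrices and let $s=(s_1,\dots,s_m)$ be a random corruption vector. Write $\langle A,X\rangle=\operatorname{tr}(A^\top X)$, $\|\cdot\|$ for the operator norm, $\|\cdot\|_F$ for the Frobenius norm, and $\operatorname{sign}(x)=-1$ for $x<0$, $\operatorname{sign}(x)=1$ for $x\ge 0$. For $\eta\ge 0$ and $\psi:\mathbb R^{d\times d}\to\mathbb R$, the pairs $\{(A_i,s_i)\}_{i=1}^m$ satisfy the $(k',\eta)$-RDPP (restricted direction preserving property) with scaling function $\psi$ if, for every nonzero symmetric $X\in\mathbb R^{d\times d}$ of rank at most $k'$, $$\Big\|D(X)-\psi(X)\frac{X}{\|X\|_F}\Big\|\le\eta,\qquad D(X)=\frac1m\sum_{i=1}^m\operatorname{sign}(\langle A_i,X\rangle-s_i)A_i .$$ * **AC model** with parameter $p\in[0,1]$: the index set of the nonzero entries of $s$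 is uniformly distributed over the subsets of $\{1,\dots,m\}$ of size $\lfloor pm\rfloor$ and is independent of $(A_i)_{i=1}^m$; the values of the nonzero entries are arbitrary and may depend on the $A_i$. * **RC model** with parameter $p\in(0,1)$: the $s_i$ are random variables, independent of each other and of $(A_i)_{i=1}^m$, and $\mathbb P(s_i\ne0)=p$ for each $i$. Let $\mathbb P_i$ denote the conditional law of $s_i$ given $s_i\neq 0$. **Proposition.** There are universal constants $C_0,c,c',C>0$ such that the following holds whenever $0<\delta\le1$ and $$m\ \ge\ C_0\,\frac{dk'\left(\log\frac1\delta\vee1\right)}{\delta^4}.$$ 1. Under the AC model with parameter $p$, with probability at least $1-e^{-(pm+d)}-e^{-c'm\delta^4}$, the $\big(k',\ \delta+3\sqrt{dp/m}+3p\big)$-RDPP holds with the constant scaling function $\psi(X)=\sqrt{2/\pi}$. 2. Under the RC model with parameter $p$, with probability at least $1-Ce^{-cm\delta^4}$, the $(k',\delta)$-RDPP holds with the scaling function $$\psi(X)=\frac1m\sum_{i=1}^m\sqrt{\frac2\pi}\left(1-p+p\,\mathbb E_{s_i\sim\mathbb P_i}\Big[\exp\Big(-\frac{s_i^2}{2\|X\|_F^2}\Big)\Big]\right).$$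 -/

import Mathlib

open MeasureTheory ProbabilityTheory

/-- The sign function of the subgradient, with the convention `sign 0 = 1`. -/
noncomputable def sgn (x : ℝ) : ℝ := if x < 0 then -1 else 1

/-- The trace inner product `⟨A, X⟩ = tr (Aᵀ X) = ∑ i j, A i j * X i j`. -/
def matInner {d : ℕ} (A X : Matrix (Fin d) (Fin d) ℝ) : ℝ := (A.transpose * X).trace

/-- The Frobenius norm of a real square matrix. -/
noncomputable def frobNorm {d : ℕ} (X : Matrix (Fin d) (Fin d) ℝ) : ℝ :=
  (Matrix.frobeniusNormedAddCommGroup :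
    NormedAddCommGroup (Matrix (Fin d) (Fin d) ℝ)).toNorm.norm X

/-- The operator (spectral) norm of a real square matrix: the norm of the associated continuous
linear endomorphism of Euclidean space. -/
noncomputable def opNorm {d : ℕ} (X : Matrix (Fin d) (Fin d) ℝ) : ℝ :=
  ‖Matrix.toEuclideanCLM (n := Fin d) (𝕜 := ℝ) X‖

theorem frobNorm_eq {d : ℕ} (X : Matrix (Fin d) (Fin d) ℝ) :
    frobNorm X = Real.sqrt (∑ i, ∑ j, X i j ^ 2) := by
  have h := Matrix.frobenius_norm_def X
  rw [Real.sqrt_eq_rpow]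
  simpa [frobNorm] using h

theorem matInner_eq {d : ℕ} (A X : Matrix (Fin d) (Fin d) ℝ) :
    matInner A X = ∑ i, ∑ j, A i j * X i j := by
  simp only [matInner, Matrix.trace, Matrix.diag, Matrix.mul_apply, Matrix.transpose_apply]
  exact Finset.sum_comm

/-- The subgradient `D(X) = (1/m) ∑ i, sign (⟨A i, X⟩ - s i) A i`. -/
noncomputable def subgrad {d m : ℕ} (A : Fin m → Matrix (Fin d) (Fin d) ℝ) (s : Fin m → ℝ)
    (X : Matrix (Fin d) (Fin d) ℝ) : Matrix (Fin d) (Fin d) ℝ :=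
  (1 / (m : ℝ)) • ∑ i, sgn (matInner (A i) X - s i) • A i

/-- The restricted direction preserving property of `(A i, s i)` with parameters `(k, δ)` and
scaling function `ψ`. The direction `X / ‖X‖_F` only makes sense for `X ≠ 0`. -/
def RDPP {d m : ℕ} (A : Fin m → Matrix (Fin d) (Fin d) ℝ) (s : Fin m → ℝ)
    (k : ℕ) (δ : ℝ) (ψ : Matrix (Fin d) (Fin d) ℝ → ℝ) : Prop :=
  ∀ X : Matrix (Fin d) (Fin d) ℝ, X.IsSymm → X ≠ 0 → X.rank ≤ k →
    opNorm (subgrad A s X - ψ X • ((frobNorm X)⁻¹ • X)) ≤ δ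

/-- The Borel (product) measurable structure on real square matrices: entrywise measurability. -/
instance matrixMeasurableSpace {d : ℕ} : MeasurableSpace (Matrix (Fin d) (Fin d) ℝ) :=
  inferInstanceAs (MeasurableSpace (Fin d → Fin d → ℝ))

/-- A random matrix from the Gaussian orthogonal ensemble: symmetric, with independent entries on
and above the diagonal, of law `N(0, 1)` on the diagonal and `N(0, 1/2)` above it. -/
structure IsGOE {Ω : Type*} [MeasurableSpace Ω] {d : ℕ}
    (A : Ω → Matrix (Fin d) (Fin d) ℝ) (μ : Measure Ω) : Prop where
  measurable : Measurable A
  symm : ∀ᵐ ω ∂μ, (A ω).IsSymm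
  indep : iIndepFun (fun (e : {e : Fin d × Fin d // e.1 ≤ e.2}) (ω : Ω) => A ω e.1.1 e.1.2) μ
  diag_law : ∀ i, μ.map (fun ω => A ω i i) = gaussianReal 0 1
  offDiag_law : ∀ i j, i < j → μ.map (fun ω => A ω i j) = gaussianReal 0 (1 / 2)

/-- The sensing matrices are independent and identically distributed GOE matrices. -/
structure IsGOESample {Ω : Type*} [MeasurableSpace Ω] {d m : ℕ}
    (A : Fin m → Ω → Matrix (Fin d) (Fin d) ℝ) (μ : Measure Ω) : Prop where
  goe : ∀ i, IsGOE (A i) μ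
  indep : iIndepFun A μ

/-- The set of corrupted indices, i.e. of the nonzero entries of `s`. -/
noncomputable def corrSupport {m : ℕ} (s : Fin m → ℝ) : Finset (Fin m) :=
  {i | s i ≠ 0}

/-- Arbitrary corruption: the random set of nonzero entries of `s` is uniform among the subsets of
size `⌊p m⌋` and independent of the sensing matrices. The values of the nonzero entries may depend
on everything, in particular on `A`; they need not even be measurable. -/
structure ACModel {Ω : Type*} [MeasurableSpace Ω] {d m : ℕ}
    (A : Fin m → Ω → Matrix (Fin d) (Fin d) ℝ) (s : Fin m → Ω → ℝ) (p : ℝ)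
    (μ : Measure Ω) : Prop where
  measurable : ∀ T : Finset (Fin m), MeasurableSet {ω | corrSupport (fun i => s i ω) = T}
  uniform : ∀ T : Finset (Fin m), T.card = ⌊p * m⌋₊ →
    μ {ω | corrSupport (fun i => s i ω) = T} = ((m.choose ⌊p * m⌋₊ : ℕ) : ENNReal)⁻¹
  indep : Indep (MeasurableSpace.comap (fun ω i => A i ω) inferInstance)
    (MeasurableSpace.comap (fun ω => corrSupport (fun i => s i ω)) ⊤) μ

/-- Random corruption: the `s i` are random variables, independent of each other and (jointly) of
the sensing matrices, and each is nonzero with probability `p`. -/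
structure RCModel {Ω : Type*} [MeasurableSpace Ω] {d m : ℕ}
    (A : Fin m → Ω → Matrix (Fin d) (Fin d) ℝ) (s : Fin m → Ω → ℝ) (p : ℝ)
    (μ : Measure Ω) : Prop where
  measurable : ∀ i, Measurable (s i)
  indep : iIndepFun s μ
  indep_sensing : IndepFun (fun ω i => A i ω) (fun ω i => s i ω) μ
  prob_ne_zero : ∀ i, μ {ω | s i ω ≠ 0} = ENNReal.ofReal p

/-- The scaling function of the random corruption model. The expectation is over the corruption
distribution of `s i`, i.e. its law conditioned on `s i ≠ 0`. -/
noncomputable def psiRC {Ω : Type*} [MeasurableSpace Ω] {d m : ℕ}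
    (s : Fin m → Ω → ℝ) (p : ℝ) (μ : Measure Ω) (X : Matrix (Fin d) (Fin d) ℝ) : ℝ :=
  (1 / (m : ℝ)) * ∑ i, Real.sqrt (2 / Real.pi) *
    (1 - p + p * ∫ ω, Real.exp (-(s i ω) ^ 2 / (2 * frobNorm X ^ 2)) ∂(μ[|{ω' | s i ω' ≠ 0}]))

/-- The property `P` holds with probability at least `q`: it holds on some measurable event of
probability at least `q` (so no measurability of `P` itself is presupposed). -/
def HoldsWithProb {Ω : Type*} [MeasurableSpace Ω] (μ : Measure Ω) (q : ℝ) (P : Ω → Prop) : Prop :=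
  ∃ E : Set Ω, MeasurableSet E ∧ (∀ ω ∈ E, P ω) ∧ q ≤ μ.real E

/-! ### Nets of balls in finite-dimensional normed spaces -/

/-! Signs are scale invariant: with τ = 1/‖X‖_F and Y = τX, sign(⟨A_i, X⟩ − s_i) = sign(⟨A_i, Y⟩ −
s_i τ). For fixed Y, τ and a test matrix Z, ⟨A_i, Z⟩ is ⟨Y, Z⟩⟨A_i, Y⟩ plus a Gaussian independent
of ⟨A_i, Y⟩. Since E[sign(g − c) g] = √(2/π) exp(−c²/2) for standard Gaussian g, the mean of
sign(⟨A_i, Y⟩ − s_i τ)⟨A_i, Z⟩ is √(2/π) E[exp(−(s_i τ)²/2)] ⟨Y, Z⟩, which is the claimed scaling.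
Deviations are sub-exponential, and rank-one Z = uvᵀ from a net recover the operator norm.

The difficulty is uniformity in (Y, τ), because the sign is discontinuous and τ ranges over a
noncompact interval. Replacing (Y, τ) by a net point (Y', t) changes few signs
(`card_sgn_change_le`): a flip needs a large move of the measurement, a measurement within 2η of its
offset, an unusually large measurement, or an offset unstable between t and τ. Cauchy–Schwarz
together with a uniform bound on the sensing map over low-rank matrices turns a small number of
flips into a small error (`sign_stability`). The scales are cut into cells adapted to the offset
laws (`exists_offset_grid`): the averaged saturation of |s_i|τ rises by at most m in total, so the
number of cells depends on δ only. A union bound gives `IsGOEPairSample.exists_uniform_event`.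

Random corruption is this event for the full index set. For arbitrary corruption, the support T is
fixed first: on Tᶜ the event is applied with zero offsets, and on T the signs are treated as
adversarial through ∑_{i∈T} |⟨A_i, uvᵀ⟩|. Independence of the support from A then allows summation
over T. -/

theorem card_le_of_separated_unitBall {E : Type*} [NormedAddCommGroup E] [NormedSpace ℝ E]
    [FiniteDimensional ℝ E] {ε : ℝ} (hε : 0 < ε) (hε1 : ε ≤ 1) (N : Finset E)
    (hN : ∀ x ∈ N, ‖x‖ ≤ 1) (hsep : ∀ x ∈ N, ∀ y ∈ N, x ≠ y → ε ≤ ‖x - y‖) :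
    (N.card : ℝ) ≤ (3 / ε) ^ Module.finrank ℝ E := by
  borelize E
  let μ : Measure E := Measure.addHaar
  set n := Module.finrank ℝ E
  -- Volume comparison: disjoint balls of radius ε/2 lie in the ball of radius 1 + ε/2 ≤ 3/2, and
  -- (3/2)/(ε/2) = 3/ε.
  have hdisj : Set.Pairwise (N : Set E)
      (Function.onFun Disjoint fun x => Metric.ball x (ε / 2)) := by
    intro x hx y hy hxy
    apply Metric.ball_disjoint_ball
    rw [dist_eq_norm]
    linarith [hsep x hx y hy hxy]
  have hsub : (⋃ x ∈ N, Metric.ball x (ε / 2)) ⊆ Metric.ball (0 : E) (3 / 2) := by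
    refine Set.iUnion₂_subset fun x hx => Metric.ball_subset_ball' ?_ |>.trans
      (Metric.ball_subset_ball (le_refl (ε / 2 + 1))) |>.trans
      (Metric.ball_subset_ball (by linarith))
    simpa [dist_eq_norm] using hN x hx
  have hI : (N.card : ENNReal) * (ENNReal.ofReal ((ε / 2) ^ n) * μ (Metric.ball 0 1)) ≤
      ENNReal.ofReal ((3 / 2) ^ n) * μ (Metric.ball 0 1) := by
    calc (N.card : ENNReal) * (ENNReal.ofReal ((ε / 2) ^ n) * μ (Metric.ball 0 1))
        = ∑ x ∈ N, μ (Metric.ball x (ε / 2)) := by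
          rw [Finset.sum_congr rfl fun x _ => Measure.addHaar_ball_of_pos μ x (half_pos hε)]
          simp [n]
      _ = μ (⋃ x ∈ N, Metric.ball x (ε / 2)) :=
          (measure_biUnion_finset hdisj fun _ _ => measurableSet_ball).symm
      _ ≤ μ (Metric.ball 0 (3 / 2)) := measure_mono hsub
      _ = _ := Measure.addHaar_ball_of_pos μ 0 (by norm_num)
  rw [← mul_assoc, ENNReal.mul_le_mul_iff_left (Metric.measure_ball_pos μ _ one_pos).ne'
    measure_ball_lt_top.ne] at hI
  have hJ : (N.card : ℝ) * (ε / 2) ^ n ≤ (3 / 2) ^ n := by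
    have := ENNReal.toReal_mono ENNReal.ofReal_ne_top hI
    rwa [ENNReal.toReal_mul, ENNReal.toReal_ofReal (by positivity),
      ENNReal.toReal_ofReal (by positivity), ENNReal.toReal_natCast] at this
  rw [← le_div_iff₀ (by positivity), ← div_pow] at hJ
  refine hJ.trans (le_of_eq ?_)
  congr 1
  field_simp

/-- A separated set of maximal cardinality is a net, since a point far from all of it could be
added; the volume bound guarantees that the maximum exists. -/
theorem exists_net_unitBall (E : Type*) [NormedAddCommGroup E] [NormedSpace ℝ E]
    [FiniteDimensional ℝ E] {ε : ℝ} (hε : 0 < ε) (hε1 : ε ≤ 1) :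
    ∃ N : Finset E, (∀ x ∈ N, ‖x‖ ≤ 1) ∧ (N.card : ℝ) ≤ (3 / ε) ^ Module.finrank ℝ E ∧
      ∀ x : E, ‖x‖ ≤ 1 → ∃ y ∈ N, ‖x - y‖ ≤ ε := by
  classical
  let S : Set ℕ := {c | ∃ N : Finset E, N.card = c ∧ (∀ x ∈ N, ‖x‖ ≤ 1) ∧
    ∀ x ∈ N, ∀ y ∈ N, x ≠ y → ε ≤ ‖x - y‖}
  have hne : S.Nonempty := ⟨0, ∅, by simp⟩
  have hbdd : BddAbove S := by
    refine ⟨⌊(3 / ε) ^ Module.finrank ℝ E⌋₊, ?_⟩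
    rintro c ⟨N, rfl, h1, h2⟩
    exact Nat.le_floor (card_le_of_separated_unitBall hε hε1 N h1 h2)
  obtain ⟨N, hc, h1, h2⟩ := Nat.sSup_mem hne hbdd
  refine ⟨N, h1, card_le_of_separated_unitBall hε hε1 N h1 h2, fun x hx => ?_⟩
  by_contra! hcon
  have hxN : x ∉ N := fun h => by simpa using (hcon x h).le.trans_lt' hε
  have hmem : N.card + 1 ∈ S := by
    refine ⟨insert x N, Finset.card_insert_of_notMem hxN, ?_, ?_⟩
    · simpa [hx] using h1
    · intro a ha b hb hab
      rw [Finset.mem_insert] at ha hb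
      rcases ha with rfl | ha <;> rcases hb with rfl | hb
      · exact absurd rfl hab
      · exact (hcon b hb).le
      · rw [norm_sub_rev]; exact (hcon a ha).le
      · exact h2 a ha b hb hab
  have := le_csSup hbdd hmem
  omega

/-! ### The Frobenius unit ball of low-rank matrices -/

theorem frobNorm_sq {d : ℕ} (X : Matrix (Fin d) (Fin d) ℝ) :
    frobNorm X ^ 2 = ∑ i, ∑ j, X i j ^ 2 := by
  rw [frobNorm_eq, Real.sq_sqrt (by positivity)]

theorem frobNorm_nonneg {d : ℕ} (X : Matrix (Fin d) (Fin d) ℝ) : 0 ≤ frobNorm X := by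
  rw [frobNorm_eq]; positivity

theorem frobNorm_pos {d : ℕ} {X : Matrix (Fin d) (Fin d) ℝ} (hX : X ≠ 0) : 0 < frobNorm X :=
  (@norm_pos_iff _ Matrix.frobeniusNormedAddCommGroup.toNormedAddGroup X).2 hX

theorem frobNorm_smul {d : ℕ} (c : ℝ) (X : Matrix (Fin d) (Fin d) ℝ) :
    frobNorm (c • X) = |c| * frobNorm X := by
  rw [← sq_eq_sq₀ (frobNorm_nonneg _) (by have := frobNorm_nonneg X; positivity), mul_pow, sq_abs,
    frobNorm_sq, frobNorm_sq, Finset.mul_sum]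
  simp [Finset.mul_sum, mul_pow]

theorem matInner_add_right {d : ℕ} (A X Y : Matrix (Fin d) (Fin d) ℝ) :
    matInner A (X + Y) = matInner A X + matInner A Y := by
  simp [matInner, mul_add]

theorem matInner_sub_right {d : ℕ} (A X Y : Matrix (Fin d) (Fin d) ℝ) :
    matInner A (X - Y) = matInner A X - matInner A Y := by
  simp [matInner, mul_sub]

theorem matInner_smul_right {d : ℕ} (A X : Matrix (Fin d) (Fin d) ℝ) (c : ℝ) :
    matInner A (c • X) = c * matInner A X := by
  simp [matInner]

theorem matInner_self {d : ℕ} (X : Matrix (Fin d) (Fin d) ℝ) :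
    matInner X X = frobNorm X ^ 2 := by
  rw [matInner_eq, frobNorm_sq]
  simp [sq]

theorem matInner_comm {d : ℕ} (X Y : Matrix (Fin d) (Fin d) ℝ) :
    matInner X Y = matInner Y X := by
  simp [matInner_eq, mul_comm]

theorem abs_matInner_le {d : ℕ} (X Y : Matrix (Fin d) (Fin d) ℝ) :
    |matInner X Y| ≤ frobNorm X * frobNorm Y := by
  refine abs_le_of_sq_le_sq ?_ (mul_nonneg (frobNorm_nonneg _) (frobNorm_nonneg _))
  rw [mul_pow, frobNorm_sq, frobNorm_sq, matInner_eq]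
  simp only [← Finset.sum_product']
  exact Finset.sum_mul_sq_le_sq_mul_sq _ _ _

/-- The matrix whose columns are the images under `U` of the columns of `M`. -/
noncomputable def colMap {d k : ℕ} (U : EuclideanSpace ℝ (Fin k) →L[ℝ] EuclideanSpace ℝ (Fin d))
    (M : Matrix (Fin k) (Fin d) ℝ) : Matrix (Fin d) (Fin d) ℝ :=
  Matrix.of fun i j => U (WithLp.toLp 2 fun l => M l j) i

theorem colMap_sub_left {d k : ℕ} (U V : EuclideanSpace ℝ (Fin k) →L[ℝ] EuclideanSpace ℝ (Fin d))
    (M : Matrix (Fin k) (Fin d) ℝ) : colMap (U - V) M = colMap U M - colMap V M := by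
  ext i j; simp [colMap]

theorem colMap_smul_left {d k : ℕ} (c : ℝ)
    (U : EuclideanSpace ℝ (Fin k) →L[ℝ] EuclideanSpace ℝ (Fin d))
    (M : Matrix (Fin k) (Fin d) ℝ) : colMap (c • U) M = c • colMap U M := by
  ext i j; simp [colMap]

theorem colMap_sub_right {d k : ℕ} (U : EuclideanSpace ℝ (Fin k) →L[ℝ] EuclideanSpace ℝ (Fin d))
    (M M' : Matrix (Fin k) (Fin d) ℝ) : colMap U (M - M') = colMap U M - colMap U M' := by
  ext i j
  have : (WithLp.toLp 2 fun l => (M - M') l j : EuclideanSpace ℝ (Fin k)) =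
    WithLp.toLp 2 (fun l => M l j) - WithLp.toLp 2 (fun l => M' l j) := by ext; simp
  change U (WithLp.toLp 2 fun l => (M - M') l j) i = _
  rw [this, map_sub]
  rfl

theorem colMap_smul_right {d k : ℕ} (c : ℝ)
    (U : EuclideanSpace ℝ (Fin k) →L[ℝ] EuclideanSpace ℝ (Fin d))
    (M : Matrix (Fin k) (Fin d) ℝ) : colMap U (c • M) = c • colMap U M := by
  ext i j
  have : (WithLp.toLp 2 fun l => (c • M) l j : EuclideanSpace ℝ (Fin k)) =
    c • WithLp.toLp 2 (fun l => M l j) := by ext; simp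
  change U (WithLp.toLp 2 fun l => (c • M) l j) i = _
  rw [this, map_smul]
  rfl

section
attribute [local instance] Matrix.frobeniusNormedAddCommGroup Matrix.frobeniusNormedSpace

theorem frobenius_norm_sq_eq {k d : ℕ} (M : Matrix (Fin k) (Fin d) ℝ) :
    ‖M‖ ^ 2 = ∑ i, ∑ j, M i j ^ 2 := by
  rw [Matrix.frobenius_norm_def, ← Real.sqrt_eq_rpow, Real.sq_sqrt (by positivity)]
  simp

/-- Products `U M` of a contraction `U` of rank at most `k` and a matrix `M` in the Frobenius unit
ball. -/
def lowRankBall (d k : ℕ) : Set (Matrix (Fin d) (Fin d) ℝ) :=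
  {X | ∃ (U : EuclideanSpace ℝ (Fin k) →L[ℝ] EuclideanSpace ℝ (Fin d))
    (M : Matrix (Fin k) (Fin d) ℝ), ‖U‖ ≤ 1 ∧ ‖M‖ ≤ 1 ∧ X = colMap U M}

theorem frobNorm_colMap_le {d k : ℕ}
    (U : EuclideanSpace ℝ (Fin k) →L[ℝ] EuclideanSpace ℝ (Fin d))
    (M : Matrix (Fin k) (Fin d) ℝ) : frobNorm (colMap U M) ≤ ‖U‖ * ‖M‖ := by
  refine le_of_sq_le_sq ?_ (by positivity)
  rw [mul_pow, frobNorm_sq, frobenius_norm_sq_eq, Finset.sum_comm, Finset.sum_comm (γ := Fin k),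
    Finset.mul_sum]
  refine Finset.sum_le_sum fun j _ => ?_
  have h := U.le_opNorm (WithLp.toLp 2 fun l => M l j)
  have h2 := pow_le_pow_left₀ (norm_nonneg _) h 2
  rw [mul_pow, EuclideanSpace.norm_sq_eq, EuclideanSpace.norm_sq_eq] at h2
  simpa [colMap] using h2

theorem frobNorm_le_one_of_mem_lowRankBall {d k : ℕ} {X : Matrix (Fin d) (Fin d) ℝ}
    (hX : X ∈ lowRankBall d k) : frobNorm X ≤ 1 := by
  obtain ⟨U, M, hU, hM, rfl⟩ := hX
  exact (frobNorm_colMap_le U M).trans (mul_le_one₀ hU (norm_nonneg _) hM)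

theorem neg_mem_lowRankBall {d k : ℕ} {X : Matrix (Fin d) (Fin d) ℝ}
    (hX : X ∈ lowRankBall d k) : -X ∈ lowRankBall d k := by
  obtain ⟨U, M, hU, hM, rfl⟩ := hX
  refine ⟨-U, M, by rwa [norm_neg], hM, ?_⟩
  ext i j
  simp [colMap]

/-- With an orthonormal basis of the column space, U sends the first r coordinate vectors to the
basis and kills the rest, while M stores the coordinates of the columns. U is a partial isometry, so
M has the Frobenius norm of X. -/
theorem mem_lowRankBall {d k : ℕ} {X : Matrix (Fin d) (Fin d) ℝ} (hr : X.rank ≤ k)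
    (hX : frobNorm X ≤ 1) : X ∈ lowRankBall d k := by
  let col : Fin d → EuclideanSpace ℝ (Fin d) := fun j => WithLp.toLp 2 fun i => X i j
  let W : Submodule ℝ (EuclideanSpace ℝ (Fin d)) := Submodule.span ℝ (Set.range col)
  have hW : Module.finrank ℝ W = X.rank := by
    rw [Matrix.rank_eq_finrank_span_cols]
    have : W = (Submodule.span ℝ (Set.range X.col)).map
        (WithLp.linearEquiv 2 ℝ (Fin d → ℝ)).symm.toLinearMap := by
      rw [Submodule.map_span, ← Set.range_comp]
      rfl
    rw [this]
    exact LinearEquiv.finrank_map_eq _ _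
  let r := Module.finrank ℝ W
  have hrk : r ≤ k := hW.trans_le hr
  let b : OrthonormalBasis (Fin r) ℝ W := stdOrthonormalBasis ℝ W
  let e : Fin r ↪ Fin k := Fin.castLEEmb hrk
  have hcolW : ∀ j, col j ∈ W := fun j => Submodule.subset_span ⟨j, rfl⟩
  let c : Fin d → Fin r → ℝ := fun j l => inner ℝ (b l) (⟨col j, hcolW j⟩ : W)
  have horth : Orthonormal ℝ fun l => (b l : EuclideanSpace ℝ (Fin d)) :=
    b.orthonormal.comp_linearIsometry W.subtypeₗᵢ
  let Ul : EuclideanSpace ℝ (Fin k) →ₗ[ℝ] EuclideanSpace ℝ (Fin d) :=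
    ∑ l, (EuclideanSpace.projₗ (e l) : EuclideanSpace ℝ (Fin k) →ₗ[ℝ] ℝ).smulRight
      (b l : EuclideanSpace ℝ (Fin d))
  have hUl : ∀ x, Ul x = ∑ l, x (e l) • (b l : EuclideanSpace ℝ (Fin d)) := by
    intro x; simp [Ul]
  have hUnorm : ∀ x, ‖Ul x‖ ≤ 1 * ‖x‖ := by
    intro x
    rw [one_mul]
    refine le_of_sq_le_sq ?_ (norm_nonneg _)
    rw [hUl, ← real_inner_self_eq_norm_sq, horth.inner_sum, EuclideanSpace.norm_sq_eq]
    simp only [Real.norm_eq_abs, sq_abs]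
    calc ∑ l, (starRingEnd ℝ) (x (e l)) * x (e l) = ∑ l, x (e l) ^ 2 := by simp [sq]
      _ = ∑ l ∈ Finset.univ.map e, x l ^ 2 := by simp
      _ ≤ _ := Finset.sum_le_sum_of_subset_of_nonneg (Finset.subset_univ _)
          fun _ _ _ => sq_nonneg _
  let M : Matrix (Fin k) (Fin d) ℝ :=
    Matrix.of fun l j => if h : (l : ℕ) < r then c j ⟨l, h⟩ else 0
  have hMe : ∀ l j, M (e l) j = c j l := by
    intro l j; simp [M, e]
  refine ⟨LinearMap.mkContinuous Ul 1 hUnorm, M, ?_, ?_, ?_⟩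
  · exact LinearMap.mkContinuous_norm_le _ zero_le_one _
  · refine le_trans (le_of_sq_le_sq ?_ (frobNorm_nonneg X)) hX
    rw [frobenius_norm_sq_eq, frobNorm_sq, Finset.sum_comm, Finset.sum_comm (s := Finset.univ)
      (t := Finset.univ) (f := fun i j => X i j ^ 2)]
    refine Finset.sum_le_sum fun j _ => ?_
    have h1 : ∑ l, M l j ^ 2 = ∑ l, c j l ^ 2 := by
      symm
      calc ∑ l, c j l ^ 2 = ∑ l ∈ Finset.univ.map e, M l j ^ 2 := by simp [hMe]
        _ = _ := Finset.sum_subset (Finset.subset_univ _) fun l _ hl => by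
          have : ¬ (l : ℕ) < r := fun h => hl (by
            rw [Finset.mem_map]; exact ⟨⟨l, h⟩, Finset.mem_univ _, by ext; simp [e]⟩)
          simp [M, this]
    have h2 := b.sum_sq_norm_inner_right (⟨col j, hcolW j⟩ : W)
    rw [h1]
    simp only [Real.norm_eq_abs, sq_abs] at h2
    change ∑ l, inner ℝ (b l) (⟨col j, hcolW j⟩ : W) ^ 2 ≤ _
    rw [h2, Submodule.coe_norm, EuclideanSpace.norm_sq_eq]
    simp [col]
  · ext i j
    have h := congrArg (fun w : W => (w : EuclideanSpace ℝ (Fin d)) i)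
      (b.sum_repr' (⟨col j, hcolW j⟩ : W))
    simp only [colMap, Matrix.of_apply, LinearMap.mkContinuous_apply, hUl, hMe]
    simp only [AddSubmonoidClass.coe_finsetSum, Submodule.coe_smul] at h
    exact h.symm

/-- Both factors of UM range over balls of dimension dk, whence the exponent 2dk. Net points must
lie in T itself, because the Gaussian mean is later computed at symmetric matrices of norm one; so
each cell receives a representative, and comparing through the cell centre doubles the two
product-rule errors to four. Every error is again ε times an element of the same ball, so no passage
to rank 2k is needed. -/
theorem exists_net_of_subset_lowRankBall {d k : ℕ} {T : Set (Matrix (Fin d) (Fin d) ℝ)}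
    (hT : T ⊆ lowRankBall d k) {ε : ℝ} (hε : 0 < ε) (hε1 : ε ≤ 1) :
    ∃ N : Finset (Matrix (Fin d) (Fin d) ℝ), (∀ X ∈ N, X ∈ T) ∧
      (N.card : ℝ) ≤ (3 / ε) ^ (2 * (d * k)) ∧
      ∀ X ∈ T, ∃ X' ∈ N, ∃ D₁ ∈ lowRankBall d k, ∃ D₂ ∈ lowRankBall d k,
        ∃ D₃ ∈ lowRankBall d k, ∃ D₄ ∈ lowRankBall d k,
          X - X' = ε • (D₁ + D₂ + D₃ + D₄) := by
  classical
  obtain ⟨N₁, hN₁, hc₁, hcov₁⟩ :=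
    exists_net_unitBall (EuclideanSpace ℝ (Fin k) →L[ℝ] EuclideanSpace ℝ (Fin d)) hε hε1
  obtain ⟨N₂, hN₂, hc₂, hcov₂⟩ := exists_net_unitBall (Matrix (Fin k) (Fin d) ℝ) hε hε1
  have hr₁ : Module.finrank ℝ (EuclideanSpace ℝ (Fin k) →L[ℝ] EuclideanSpace ℝ (Fin d)) =
      d * k := by
    rw [← (LinearMap.toContinuousLinearMap (𝕜 := ℝ) (E := EuclideanSpace ℝ (Fin k))
      (F' := EuclideanSpace ℝ (Fin d))).finrank_eq, Module.finrank_linearMap]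
    simp [mul_comm]
  have hr₂ : Module.finrank ℝ (Matrix (Fin k) (Fin d) ℝ) = d * k := by
    simp [Module.finrank_matrix, mul_comm]
  rw [hr₁] at hc₁
  rw [hr₂] at hc₂
  -- Product rule: UM − U'M' = (U − U')M + U'(M − M').
  have hdiff : ∀ U U' : EuclideanSpace ℝ (Fin k) →L[ℝ] EuclideanSpace ℝ (Fin d),
      ∀ M M' : Matrix (Fin k) (Fin d) ℝ, ‖U'‖ ≤ 1 → ‖M‖ ≤ 1 → ‖U - U'‖ ≤ ε → ‖M - M'‖ ≤ ε →
      ∃ D₁ ∈ lowRankBall d k, ∃ D₂ ∈ lowRankBall d k,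
        colMap U M - colMap U' M' = ε • (D₁ + D₂) := by
    intro U U' M M' hU' hM h1 h2
    refine ⟨colMap (ε⁻¹ • (U - U')) M, ⟨_, _, ?_, hM, rfl⟩,
      colMap U' (ε⁻¹ • (M - M')), ⟨_, _, hU', ?_, rfl⟩, ?_⟩
    · rw [norm_smul, norm_inv, Real.norm_of_nonneg hε.le]
      exact inv_mul_le_one_of_le₀ h1 hε.le
    · rw [norm_smul, norm_inv, Real.norm_of_nonneg hε.le]
      exact inv_mul_le_one_of_le₀ h2 hε.le
    · rw [colMap_smul_left, colMap_smul_right, ← smul_add, smul_inv_smul₀ hε.ne',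
        colMap_sub_left, colMap_sub_right]
      abel
  let P := fun (p : (EuclideanSpace ℝ (Fin k) →L[ℝ] EuclideanSpace ℝ (Fin d)) ×
      Matrix (Fin k) (Fin d) ℝ) (X : Matrix (Fin d) (Fin d) ℝ) =>
    X ∈ T ∧ ∃ U M, ‖U‖ ≤ 1 ∧ ‖M‖ ≤ 1 ∧ X = colMap U M ∧ ‖U - p.1‖ ≤ ε ∧ ‖M - p.2‖ ≤ ε
  let N₀ := (N₁ ×ˢ N₂).filter fun p => ∃ X, P p X
  let rep : (EuclideanSpace ℝ (Fin k) →L[ℝ] EuclideanSpace ℝ (Fin d)) ×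
      Matrix (Fin k) (Fin d) ℝ → Matrix (Fin d) (Fin d) ℝ :=
    fun p => if h : ∃ X, P p X then h.choose else 0
  have hrep : ∀ p, (∃ X, P p X) → P p (rep p) := by
    intro p h
    simp only [rep, dif_pos h]
    exact h.choose_spec
  refine ⟨N₀.image rep, ?_, ?_, ?_⟩
  · intro X hX
    obtain ⟨p, hp, rfl⟩ := Finset.mem_image.1 hX
    exact (hrep p (Finset.mem_filter.1 hp).2).1
  · calc ((N₀.image rep).card : ℝ) ≤ (N₁ ×ˢ N₂).card := by
          exact_mod_cast Finset.card_image_le.trans (Finset.card_filter_le _ _)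
      _ = N₁.card * N₂.card := by simp
      _ ≤ (3 / ε) ^ (d * k) * (3 / ε) ^ (d * k) := by gcongr
      _ = _ := by rw [← pow_add, two_mul]
  · intro X hX
    obtain ⟨U, M, hU, hM, hXe⟩ := hT hX
    obtain ⟨U', hU', hUU'⟩ := hcov₁ U hU
    obtain ⟨M', hM', hMM'⟩ := hcov₂ M hM
    have hex : ∃ X, P (U', M') X := ⟨X, hX, U, M, hU, hM, hXe, hUU', hMM'⟩
    refine ⟨rep (U', M'), Finset.mem_image_of_mem _ (Finset.mem_filter.2
      ⟨Finset.mem_product.2 ⟨hU', hM'⟩, hex⟩), ?_⟩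
    obtain ⟨-, V, Q, hV, hQ, hXV, hVU, hQM⟩ := hrep _ hex
    obtain ⟨D₁, h₁, D₂, h₂, h12⟩ := hdiff U U' M M' (hN₁ _ hU') hM hUU' hMM'
    obtain ⟨D₃, h₃, D₄, h₄, h34⟩ := hdiff V U' Q M' (hN₁ _ hU') hQ hVU hQM
    refine ⟨D₁, h₁, D₂, h₂, -D₃, neg_mem_lowRankBall h₃, -D₄, neg_mem_lowRankBall h₄, ?_⟩
    have : X - rep (U', M') = (colMap U M - colMap U' M') - (colMap V Q - colMap U' M') := by
      rw [hXe, hXV]; abel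
    rw [this, h12, h34, ← smul_sub]
    congr 1
    abel

end

/-- Lets the uniform bound on the sensing map cover the rank-one test matrices that compute the
operator norm. -/
theorem vecMulVec_mem_lowRankBall {d k : ℕ} (hk : 1 ≤ k) {u v : EuclideanSpace ℝ (Fin d)}
    (hu : ‖u‖ ≤ 1) (hv : ‖v‖ ≤ 1) : Matrix.vecMulVec u v ∈ lowRankBall d k := by
  refine mem_lowRankBall ((Matrix.rank_vecMulVec_le _ _).trans hk) ?_
  rw [← sq_le_one_iff₀ (frobNorm_nonneg _), frobNorm_sq]
  have : ∑ i, ∑ j, Matrix.vecMulVec u v i j ^ 2 = ‖u‖ ^ 2 * ‖v‖ ^ 2 := by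
    rw [EuclideanSpace.norm_sq_eq, EuclideanSpace.norm_sq_eq, Finset.sum_mul_sum]
    simp [Matrix.vecMulVec_apply, mul_pow]
  rw [this]
  exact mul_le_one₀ (pow_le_one₀ (norm_nonneg _) hu) (by positivity)
    (pow_le_one₀ (norm_nonneg _) hv)

/-! ### Operator norm through nets -/

theorem matInner_vecMulVec {d : ℕ} (M : Matrix (Fin d) (Fin d) ℝ)
    (u v : EuclideanSpace ℝ (Fin d)) :
    matInner M (Matrix.vecMulVec u v) =
      inner ℝ u (Matrix.toEuclideanCLM (n := Fin d) (𝕜 := ℝ) M v) := by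
  rw [matInner_eq, PiLp.inner_apply]
  simp only [Matrix.vecMulVec_apply, Matrix.ofLp_toEuclideanCLM, Matrix.mulVec, dotProduct,
    RCLike.inner_apply, conj_trivial, Finset.sum_mul]
  exact Finset.sum_congr rfl fun i _ => Finset.sum_congr rfl fun j _ => by ring

theorem opNorm_add_le {d : ℕ} (M M' : Matrix (Fin d) (Fin d) ℝ) :
    opNorm (M + M') ≤ opNorm M + opNorm M' := by
  simpa [opNorm] using norm_add_le _ _

theorem opNorm_smul {d : ℕ} (c : ℝ) (M : Matrix (Fin d) (Fin d) ℝ) :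
    opNorm (c • M) = |c| * opNorm M := by
  simp [opNorm, norm_smul]

/-- Replacing u and v by net points costs ε‖T‖ each. One-sided bounds suffice because u may be taken
in the direction of Tv. -/
theorem opNorm_le_of_net {d : ℕ} {N : Finset (EuclideanSpace ℝ (Fin d))} {ε b : ℝ}
    (hN1 : ∀ u ∈ N, ‖u‖ ≤ 1) (hN : ∀ u : EuclideanSpace ℝ (Fin d), ‖u‖ ≤ 1 → ∃ v ∈ N, ‖u - v‖ ≤ ε)
    {M : Matrix (Fin d) (Fin d) ℝ}
    (h : ∀ u ∈ N, ∀ v ∈ N, matInner M (Matrix.vecMulVec u v) ≤ b) :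
    (1 - 2 * ε) * opNorm M ≤ b := by
  set T := Matrix.toEuclideanCLM (n := Fin d) (𝕜 := ℝ) M with hT
  have hε : 0 ≤ ε := by
    obtain ⟨v, -, hv⟩ := hN 0 (by simp)
    exact (norm_nonneg _).trans hv
  have key : ∀ u v : EuclideanSpace ℝ (Fin d), ‖u‖ ≤ 1 → ‖v‖ ≤ 1 →
      inner ℝ u (T v) ≤ b + 2 * ε * ‖T‖ := by
    intro u v hu hv
    obtain ⟨u', hu', huu⟩ := hN u hu
    obtain ⟨v', hv', hvv⟩ := hN v hv
    have e : inner ℝ u (T v) = inner ℝ u' (T v') + inner ℝ (u - u') (T v) +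
        inner ℝ u' (T (v - v')) := by
      rw [map_sub, inner_sub_left, inner_sub_right]; ring
    have h1 : inner ℝ u' (T v') ≤ b := by
      rw [← matInner_vecMulVec]; exact h _ hu' _ hv'
    have h2 : inner ℝ (u - u') (T v) ≤ ε * (‖T‖ * 1) :=
      (real_inner_le_norm _ _).trans (mul_le_mul huu ((T.le_opNorm v).trans
        (mul_le_mul_of_nonneg_left hv (norm_nonneg _))) (norm_nonneg _) hε)
    have h3 : inner ℝ u' (T (v - v')) ≤ 1 * (‖T‖ * ε) :=
      (real_inner_le_norm _ _).trans (mul_le_mul (hN1 _ hu') ((T.le_opNorm _).trans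
        (mul_le_mul_of_nonneg_left hvv (norm_nonneg _))) (norm_nonneg _) zero_le_one)
    rw [e]; linarith
  have h0 : 0 ≤ b + 2 * ε * ‖T‖ := by simpa using key 0 0 (by simp) (by simp)
  have hle : ‖T‖ ≤ b + 2 * ε * ‖T‖ := by
    refine T.opNorm_le_of_unit_norm h0 fun v hv => ?_
    rcases eq_or_ne (T v) 0 with hz | hz
    · rw [hz, norm_zero]; exact h0
    · have := key (‖T v‖⁻¹ • T v) v (by rw [norm_smul, norm_inv, norm_norm,
        inv_mul_cancel₀ (norm_ne_zero_iff.2 hz)]) hv.le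
      rwa [inner_smul_left, conj_trivial, real_inner_self_eq_norm_sq, sq, ← mul_assoc,
        inv_mul_cancel₀ (norm_ne_zero_iff.2 hz), one_mul] at this
  have : opNorm M = ‖T‖ := rfl
  rw [this]; linarith

/-! ### The sensing map -/

/-- The vector of measurements `⟨a i, Z⟩`. -/
noncomputable def sens {d m : ℕ} (a : Fin m → Matrix (Fin d) (Fin d) ℝ)
    (Z : Matrix (Fin d) (Fin d) ℝ) : EuclideanSpace ℝ (Fin m) :=
  WithLp.toLp 2 fun i => matInner (a i) Z

theorem sens_add {d m : ℕ} (a : Fin m → Matrix (Fin d) (Fin d) ℝ)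
    (Z W : Matrix (Fin d) (Fin d) ℝ) : sens a (Z + W) = sens a Z + sens a W := by
  ext i; simp [sens, matInner_add_right]

theorem sens_smul {d m : ℕ} (a : Fin m → Matrix (Fin d) (Fin d) ℝ) (c : ℝ)
    (Z : Matrix (Fin d) (Fin d) ℝ) : sens a (c • Z) = c • sens a Z := by
  ext i; simp [sens, matInner_smul_right]

theorem norm_sens_sq {d m : ℕ} (a : Fin m → Matrix (Fin d) (Fin d) ℝ)
    (Z : Matrix (Fin d) (Fin d) ℝ) : ‖sens a Z‖ ^ 2 = ∑ i, matInner (a i) Z ^ 2 := by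
  rw [EuclideanSpace.norm_sq_eq]; simp [sens]

theorem norm_sens_diff_le {d m k : ℕ} {a : Fin m → Matrix (Fin d) (Fin d) ℝ} {S ε : ℝ}
    (hε : 0 ≤ ε) (hS : ∀ Z ∈ lowRankBall d k, ‖sens a Z‖ ≤ S)
    {X D₁ D₂ D₃ D₄ : Matrix (Fin d) (Fin d) ℝ}
    (h₁ : D₁ ∈ lowRankBall d k) (h₂ : D₂ ∈ lowRankBall d k) (h₃ : D₃ ∈ lowRankBall d k)
    (h₄ : D₄ ∈ lowRankBall d k) (hX : X = ε • (D₁ + D₂ + D₃ + D₄)) :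
    ‖sens a X‖ ≤ ε * (4 * S) := by
  rw [hX, sens_smul, norm_smul, Real.norm_of_nonneg hε, sens_add, sens_add, sens_add]
  gcongr
  have e1 := norm_add_le (sens a D₁ + sens a D₂ + sens a D₃) (sens a D₄)
  have e2 := norm_add_le (sens a D₁ + sens a D₂) (sens a D₃)
  have e3 := norm_add_le (sens a D₁) (sens a D₂)
  linarith [hS _ h₁, hS _ h₂, hS _ h₃, hS _ h₄]

/-- Absorption: the supremum s over the ball satisfies s ≤ S + (1/8)(4s), hence s ≤ 2S. Its
finiteness, needed for absorbing, is Cauchy–Schwarz. -/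
theorem norm_sens_le_of_net {d m k : ℕ} {a : Fin m → Matrix (Fin d) (Fin d) ℝ} {S : ℝ}
    {N : Finset (Matrix (Fin d) (Fin d) ℝ)}
    (hN : ∀ X ∈ lowRankBall d k, ∃ X' ∈ N, ∃ D₁ ∈ lowRankBall d k, ∃ D₂ ∈ lowRankBall d k,
        ∃ D₃ ∈ lowRankBall d k, ∃ D₄ ∈ lowRankBall d k,
          X - X' = (1 / 8 : ℝ) • (D₁ + D₂ + D₃ + D₄))
    (hS : ∀ Z ∈ N, ‖sens a Z‖ ≤ S) {Z : Matrix (Fin d) (Fin d) ℝ} (hZ : Z ∈ lowRankBall d k) :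
    ‖sens a Z‖ ≤ 2 * S := by
  have hbdd : BddAbove ((fun Z => ‖sens a Z‖) '' lowRankBall d k) := by
    refine ⟨Real.sqrt (∑ i, frobNorm (a i) ^ 2), ?_⟩
    rintro _ ⟨W, hW, rfl⟩
    refine Real.le_sqrt_of_sq_le ?_
    rw [norm_sens_sq]
    refine Finset.sum_le_sum fun i _ => ?_
    rw [← sq_abs]
    refine pow_le_pow_left₀ (abs_nonneg _) ((abs_matInner_le _ _).trans ?_) 2
    exact mul_le_of_le_one_right (frobNorm_nonneg _) (frobNorm_le_one_of_mem_lowRankBall hW)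
  set s := sSup ((fun Z => ‖sens a Z‖) '' lowRankBall d k)
  have hs : ∀ W ∈ lowRankBall d k, ‖sens a W‖ ≤ s := fun W hW => le_csSup hbdd ⟨W, hW, rfl⟩
  have : s ≤ S + 1 / 8 * (4 * s) := by
    refine csSup_le ⟨_, Z, hZ, rfl⟩ ?_
    rintro _ ⟨W, hW, rfl⟩
    obtain ⟨W', hW', D₁, h₁, D₂, h₂, D₃, h₃, D₄, h₄, e⟩ := hN W hW
    have hd := norm_sens_diff_le (by norm_num) hs h₁ h₂ h₃ h₄ e
    have : sens a W = sens a W' + sens a (W - W') := by rw [← sens_add]; simp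
    have h2 := norm_add_le (sens a W') (sens a (W - W'))
    rw [← this] at h2
    linarith [hS _ hW']
  linarith [hs Z hZ]

/-! ### Stability of the signs -/

theorem sgn_eq_or (x : ℝ) : sgn x = -1 ∨ sgn x = 1 := by
  unfold sgn; split_ifs <;> simp

theorem abs_sgn (x : ℝ) : |sgn x| = 1 := by
  rcases sgn_eq_or x with h | h <;> simp [h]

theorem sgn_mul_of_pos {r : ℝ} (hr : 0 < r) (x : ℝ) : sgn (r * x) = sgn x := by
  simp [sgn, mul_neg_iff, hr, hr.not_gt]

theorem measurable_sgn : Measurable sgn :=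
  Measurable.ite measurableSet_Iio measurable_const measurable_const

/-- If both the measurement and the scaled offset move by at most η, a flip forces x' to lie within
2η of st. If instead |s|t ≥ B, both scaled offsets lie beyond B on the same side, so only a
measurement of size at least B can produce a flip. -/
theorem sgn_change {x x' s t τ η B : ℝ} (htτ : t ≤ τ)
    (h : sgn (x - s * τ) ≠ sgn (x' - s * t)) :
    η ≤ |x - x'| ∨ ¬ (|s| * (τ - t) ≤ η ∨ B ≤ |s| * t) ∨ |x' - s * t| ≤ 2 * η ∨
      B ≤ |x| ∨ B ≤ |x'| := by
  by_contra! hcon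
  obtain ⟨h1, h2, h3, h4, h5⟩ := hcon
  rw [abs_lt] at h1 h4 h5
  have hsg : (x - s * τ < 0 ∧ 0 ≤ x' - s * t) ∨ (0 ≤ x - s * τ ∧ x' - s * t < 0) := by
    unfold sgn at h
    split_ifs at h with ha hb hb
    · exact absurd rfl h
    · exact Or.inl ⟨ha, not_lt.1 hb⟩
    · exact Or.inr ⟨not_lt.1 ha, hb⟩
    · exact absurd rfl h
  rcases h2 with h2 | h2
  · have hs : |s * (τ - t)| ≤ η := by rwa [abs_mul, abs_of_nonneg (sub_nonneg.2 htτ)]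
    rw [abs_le] at hs
    rcases hsg with ⟨ha, hb⟩ | ⟨ha, hb⟩
    · rw [abs_of_nonneg hb] at h3; linarith
    · rw [abs_of_neg hb] at h3; linarith
  · rcases le_total 0 s with hs | hs
    · rw [abs_of_nonneg hs] at h2
      have : s * t ≤ s * τ := mul_le_mul_of_nonneg_left htτ hs
      rcases hsg with ⟨ha, hb⟩ | ⟨ha, hb⟩ <;> linarith
    · rw [abs_of_nonpos hs] at h2
      have : s * τ ≤ s * t := mul_le_mul_of_nonpos_left htτ hs
      rcases hsg with ⟨ha, hb⟩ | ⟨ha, hb⟩ <;> linarith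

theorem card_filter_le_sq_div {d m : ℕ} (a : Fin m → Matrix (Fin d) (Fin d) ℝ)
    (Z : Matrix (Fin d) (Fin d) ℝ) {b : ℝ} (hb : 0 < b) :
    ((Finset.univ.filter fun i => b ≤ |matInner (a i) Z|).card : ℝ) ≤ ‖sens a Z‖ ^ 2 / b ^ 2 := by
  rw [le_div_iff₀ (by positivity), norm_sens_sq, ← nsmul_eq_mul]
  calc _ ≤ ∑ i ∈ Finset.univ.filter fun i => b ≤ |matInner (a i) Z|, matInner (a i) Z ^ 2 := by
        refine Finset.card_nsmul_le_sum _ _ _ fun i hi => ?_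
        rw [← sq_abs (matInner _ _)]
        exact pow_le_pow_left₀ hb.le (Finset.mem_filter.1 hi).2 2
    _ ≤ _ := Finset.sum_le_sum_of_subset_of_nonneg (Finset.subset_univ _)
          fun _ _ _ => sq_nonneg _

-- Only indices with differing signs contribute, each at most 2|⟨a_i, Z⟩|; Cauchy–Schwarz on that
-- set leaves the number of flips times a norm that is controlled uniformly in Z.
open Classical in
theorem abs_sum_sgn_sub_le {d m : ℕ} (a : Fin m → Matrix (Fin d) (Fin d) ℝ) (σ σ' : Fin m → ℝ)
    (I : Finset (Fin m)) (Z : Matrix (Fin d) (Fin d) ℝ) (hσ : ∀ i, |σ i| = 1)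
    (hσ' : ∀ i, |σ' i| = 1) :
    |∑ i ∈ I, (σ i - σ' i) * matInner (a i) Z| ≤
      2 * Real.sqrt (Finset.univ.filter fun i => σ i ≠ σ' i).card * ‖sens a Z‖ := by
  set D := Finset.univ.filter fun i => σ i ≠ σ' i
  have h1 : |∑ i ∈ I, (σ i - σ' i) * matInner (a i) Z| ≤ ∑ i ∈ D, 2 * |matInner (a i) Z| := by
    calc _ ≤ ∑ i ∈ I, |(σ i - σ' i) * matInner (a i) Z| := Finset.abs_sum_le_sum_abs _ _
      _ ≤ ∑ i, |(σ i - σ' i) * matInner (a i) Z| :=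
          Finset.sum_le_sum_of_subset_of_nonneg (Finset.subset_univ _) fun _ _ _ => abs_nonneg _
      _ = ∑ i ∈ D, |(σ i - σ' i) * matInner (a i) Z| := by
          symm
          refine Finset.sum_subset (Finset.subset_univ _) fun i _ hi => ?_
          have : σ i = σ' i := by by_contra h; exact hi (by simp [D, h])
          simp [this]
      _ ≤ _ := Finset.sum_le_sum fun i _ => by
          rw [abs_mul]
          refine mul_le_mul_of_nonneg_right ((abs_sub _ _).trans ?_) (abs_nonneg _)
          rw [hσ, hσ']; norm_num
  refine h1.trans ?_
  rw [← Finset.mul_sum, mul_assoc]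
  refine mul_le_mul_of_nonneg_left ?_ zero_le_two
  refine abs_le_of_sq_le_sq' ?_ (by positivity) |>.2
  rw [mul_pow, Real.sq_sqrt (Nat.cast_nonneg _), norm_sens_sq]
  refine (sq_sum_le_card_mul_sum_sq (s := D)).trans ?_
  refine mul_le_mul_of_nonneg_left ?_ (Nat.cast_nonneg _)
  simp only [sq_abs]
  exact Finset.sum_le_sum_of_subset_of_nonneg (Finset.subset_univ _) fun _ _ _ => sq_nonneg _

open Classical in
theorem card_sgn_change_le {d m : ℕ} (a : Fin m → Matrix (Fin d) (Fin d) ℝ) (s : Fin m → ℝ)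
    (X X' : Matrix (Fin d) (Fin d) ℝ) {t τ η B : ℝ} (hη : 0 < η) (hB : 0 < B)
    (htτ : t ≤ τ) :
    ((Finset.univ.filter fun i =>
        sgn (matInner (a i) X - s i * τ) ≠ sgn (matInner (a i) X' - s i * t)).card : ℝ) ≤
      ‖sens a (X - X')‖ ^ 2 / η ^ 2 +
      (Finset.univ.filter fun i => ¬ (|s i| * (τ - t) ≤ η ∨ B ≤ |s i| * t)).card +
      (Finset.univ.filter fun i => |matInner (a i) X' - s i * t| ≤ 2 * η).card +
      ‖sens a X‖ ^ 2 / B ^ 2 + ‖sens a X'‖ ^ 2 / B ^ 2 := by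
  have hsub : (Finset.univ.filter fun i =>
        sgn (matInner (a i) X - s i * τ) ≠ sgn (matInner (a i) X' - s i * t)) ⊆
      (((((Finset.univ.filter fun i => η ≤ |matInner (a i) (X - X')|) ∪
      (Finset.univ.filter fun i => ¬ (|s i| * (τ - t) ≤ η ∨ B ≤ |s i| * t))) ∪
      (Finset.univ.filter fun i => |matInner (a i) X' - s i * t| ≤ 2 * η)) ∪
      (Finset.univ.filter fun i => B ≤ |matInner (a i) X|)) ∪
      (Finset.univ.filter fun i => B ≤ |matInner (a i) X'|)) := by
    intro i hi
    have := sgn_change (η := η) (B := B) htτ (Finset.mem_filter.1 hi).2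
    simp only [Finset.mem_union, Finset.mem_filter, Finset.mem_univ, true_and,
      matInner_sub_right]
    tauto
  have h1 := card_filter_le_sq_div a (X - X') hη
  have h2 := card_filter_le_sq_div a X hB
  have h3 := card_filter_le_sq_div a X' hB
  have h4 := Finset.card_le_card hsub
  have h5 := h4.trans ((Finset.card_union_le _ _).trans (Nat.add_le_add_right
    ((Finset.card_union_le _ _).trans (Nat.add_le_add_right ((Finset.card_union_le _ _).trans
    (Nat.add_le_add_right (Finset.card_union_le _ _) _)) _)) _))
  have h6 : ((Finset.univ.filter fun i =>
      sgn (matInner (a i) X - s i * τ) ≠ sgn (matInner (a i) X' - s i * t)).card : ℝ) ≤ _ :=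
    Nat.cast_le.2 h5
  push_cast at h6
  linarith

open Classical in
theorem sign_stability {d m : ℕ} (a : Fin m → Matrix (Fin d) (Fin d) ℝ) (s : Fin m → ℝ)
    (X X' Z : Matrix (Fin d) (Fin d) ℝ) (I : Finset (Fin m)) {t τ δ : ℝ} (hδ : 0 < δ)
    (htτ : t ≤ τ)
    (hXX' : ‖sens a (X - X')‖ ≤ δ ^ 3 / 2 ^ 27 * (16 * Real.sqrt m))
    (hX : ‖sens a X‖ ≤ 4 * Real.sqrt m) (hX' : ‖sens a X'‖ ≤ 4 * Real.sqrt m)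
    (hZ : ‖sens a Z‖ ≤ 4 * Real.sqrt m)
    (hbad : ((Finset.univ.filter fun i =>
      ¬ (|s i| * (τ - t) ≤ δ ^ 2 / 2 ^ 16 ∨ 2 ^ 10 / δ ≤ |s i| * t)).card : ℝ) ≤
      δ ^ 2 * m / 2 ^ 14)
    (hnear : ((Finset.univ.filter fun i =>
      |matInner (a i) X' - s i * t| ≤ 2 * (δ ^ 2 / 2 ^ 16)).card : ℝ) ≤
      3 * (δ ^ 2 / 2 ^ 16) * m) :
    |∑ i ∈ I, (sgn (matInner (a i) X - s i * τ) - sgn (matInner (a i) X' - s i * t)) *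
      matInner (a i) Z| ≤ δ / 8 * m := by
  have hm : Real.sqrt m ^ 2 = m := Real.sq_sqrt (Nat.cast_nonneg m)
  have h := card_sgn_change_le a s X X' (t := t) (τ := τ) (η := δ ^ 2 / 2 ^ 16)
    (B := 2 ^ 10 / δ) (by positivity) (by positivity) htτ
  have e1 : ‖sens a (X - X')‖ ^ 2 / (δ ^ 2 / 2 ^ 16) ^ 2 ≤ δ ^ 2 * m / 2 ^ 14 := by
    rw [div_le_iff₀ (by positivity)]
    refine (pow_le_pow_left₀ (norm_nonneg _) hXX' 2).trans (le_of_eq ?_)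
    rw [mul_pow, mul_pow, hm]; ring
  have e2 : ∀ W : Matrix (Fin d) (Fin d) ℝ, ‖sens a W‖ ≤ 4 * Real.sqrt m →
      ‖sens a W‖ ^ 2 / (2 ^ 10 / δ) ^ 2 ≤ δ ^ 2 * m / 2 ^ 16 := by
    intro W hW
    rw [div_le_iff₀ (by positivity)]
    refine (pow_le_pow_left₀ (norm_nonneg _) hW 2).trans (le_of_eq ?_)
    rw [mul_pow, hm]; field_simp; ring
  have hcard := h.trans (add_le_add (add_le_add (add_le_add (add_le_add e1 hbad) hnear)
    (e2 X hX)) (e2 X' hX'))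
  refine (abs_sum_sgn_sub_le a _ _ I Z (fun _ => abs_sgn _) (fun _ => abs_sgn _)).trans ?_
  have h0 : 0 ≤ δ ^ 2 * m := by positivity
  -- In units of δ²m/2¹⁶ the five contributions are 4, 4, 3, 1 and 1. Their total 13 is below 16, so
  -- there are at most δ²m/2¹² flips.
  have hsq : Real.sqrt (Finset.univ.filter fun i =>
      sgn (matInner (a i) X - s i * τ) ≠ sgn (matInner (a i) X' - s i * t)).card ≤
      δ / 2 ^ 6 * Real.sqrt m := by
    rw [Real.sqrt_le_left (by positivity), mul_pow, hm]
    refine hcard.trans ?_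
    nlinarith
  calc _ ≤ 2 * (δ / 2 ^ 6 * Real.sqrt m) * (4 * Real.sqrt m) := by gcongr
    _ = δ / 8 * Real.sqrt m ^ 2 := by ring
    _ = _ := by rw [hm]

/-! ### Linear functionals of a GOE matrix -/

/-- Coefficients of `⟨A, Z⟩` in terms of the entries of a symmetric `A` on and above the
diagonal. -/
def upperCoef {d : ℕ} (Z : Matrix (Fin d) (Fin d) ℝ)
    (e : {e : Fin d × Fin d // e.1 ≤ e.2}) : ℝ :=
  if e.1.1 = e.1.2 then Z e.1.1 e.1.1 else Z e.1.1 e.1.2 + Z e.1.2 e.1.1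

/-- Variances of the entries of a GOE matrix. -/
noncomputable def upperVar {d : ℕ} (e : {e : Fin d × Fin d // e.1 ≤ e.2}) : ℝ :=
  if e.1.1 = e.1.2 then 1 else 1 / 2

theorem sum_sum_eq_sum_upper {d : ℕ} (f : Fin d → Fin d → ℝ) :
    ∑ i, ∑ j, f i j = ∑ e : {e : Fin d × Fin d // e.1 ≤ e.2},
      if e.1.1 = e.1.2 then f e.1.1 e.1.1 else f e.1.1 e.1.2 + f e.1.2 e.1.1 := by
  have h0 : ∀ i j, f i j = (if i ≤ j then f i j else 0) + if j < i then f i j else 0 := by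
    intro i j
    by_cases h : i ≤ j
    · simp [h, h.not_gt]
    · simp [h, not_le.1 h]
  have h1 : ∑ e : {e : Fin d × Fin d // e.1 ≤ e.2},
      (if e.1.1 = e.1.2 then f e.1.1 e.1.1 else f e.1.1 e.1.2 + f e.1.2 e.1.1) =
      ∑ i, ∑ j, if i ≤ j then (if i = j then f i i else f i j + f j i) else 0 := by
    rw [← Finset.sum_product' (f := fun i j => if i ≤ j then
      (if i = j then f i i else f i j + f j i) else 0), Finset.univ_product_univ,
      ← Finset.sum_filter]
    exact (Finset.sum_subtype (p := fun e : Fin d × Fin d => e.1 ≤ e.2) _ (by simp)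
      (fun e => if e.1 = e.2 then f e.1 e.1 else f e.1 e.2 + f e.2 e.1)).symm
  rw [h1, Finset.sum_congr rfl fun i _ => Finset.sum_congr rfl fun j _ => h0 i j]
  simp only [Finset.sum_add_distrib]
  rw [Finset.sum_comm (f := fun i j => if j < i then f i j else 0)]
  simp only [← Finset.sum_add_distrib]
  refine Finset.sum_congr rfl fun i _ => Finset.sum_congr rfl fun j _ => ?_
  rcases lt_trichotomy i j with h | h | h
  · simp [h.le, h, h.ne]
  · subst h; simp
  · simp [h.not_ge, h.not_gt]

theorem matInner_eq_sum_upper {d : ℕ} {a : Matrix (Fin d) (Fin d) ℝ} (ha : a.IsSymm)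
    (Z : Matrix (Fin d) (Fin d) ℝ) :
    matInner a Z = ∑ e : {e : Fin d × Fin d // e.1 ≤ e.2}, upperCoef Z e * a e.1.1 e.1.2 := by
  rw [matInner_eq, sum_sum_eq_sum_upper]
  refine Finset.sum_congr rfl fun e _ => ?_
  unfold upperCoef
  split_ifs with h
  · rw [← h]; ring
  · rw [ha.apply e.1.1 e.1.2]; ring

/-- The left side is Cov(⟨A, X⟩, ⟨A, Z⟩). For symmetric X the factor 2 in the off-diagonal
coefficient cancels the variance 1/2, so orthogonality to X means independence. -/
theorem sum_upperCoef_mul {d : ℕ} {X : Matrix (Fin d) (Fin d) ℝ} (hX : X.IsSymm)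
    (Z : Matrix (Fin d) (Fin d) ℝ) :
    ∑ e, upperCoef X e * upperCoef Z e * upperVar e = matInner X Z := by
  rw [matInner_eq, sum_sum_eq_sum_upper]
  refine Finset.sum_congr rfl fun e _ => ?_
  unfold upperCoef upperVar
  split_ifs with h
  · ring
  · rw [hX.apply e.1.1 e.1.2]; ring

/-- The left side is the squared Frobenius norm of the symmetric part of Z. An inequality is needed
because the test matrices uvᵀ are not symmetric. -/
theorem sum_upperCoef_sq_le {d : ℕ} (Z : Matrix (Fin d) (Fin d) ℝ) :
    ∑ e, upperCoef Z e * upperCoef Z e * upperVar e ≤ frobNorm Z ^ 2 := by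
  rw [frobNorm_sq, sum_sum_eq_sum_upper]
  refine Finset.sum_le_sum fun e _ => ?_
  unfold upperCoef upperVar
  split_ifs with h
  · exact le_of_eq (by ring)
  · nlinarith [sq_nonneg (Z e.1.1 e.1.2 - Z e.1.2 e.1.1)]

theorem measurable_matInner_right {d : ℕ} (Z : Matrix (Fin d) (Fin d) ℝ) :
    Measurable fun a : Matrix (Fin d) (Fin d) ℝ => matInner a Z := by
  simp only [matInner_eq]
  refine Finset.measurable_sum _ fun i _ => Finset.measurable_sum _ fun j _ => ?_
  exact ((measurable_pi_apply j).comp (measurable_pi_apply i)).mul_const _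

namespace IsGOE

variable {Ω : Type*} [MeasurableSpace Ω] {μ : Measure Ω} {d : ℕ}
  {A : Ω → Matrix (Fin d) (Fin d) ℝ}

theorem measurable_entry (hA : IsGOE A μ) (i j : Fin d) : Measurable fun ω => A ω i j :=
  (measurable_pi_apply j).comp ((measurable_pi_apply i).comp hA.measurable)

theorem measurable_matInner (hA : IsGOE A μ) (Z : Matrix (Fin d) (Fin d) ℝ) :
    Measurable fun ω => matInner (A ω) Z :=
  (measurable_matInner_right Z).comp hA.measurable

theorem map_upper (hA : IsGOE A μ) (e : {e : Fin d × Fin d // e.1 ≤ e.2}) :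
    ∃ v : NNReal, (v : ℝ) = upperVar e ∧ μ.map (fun ω => A ω e.1.1 e.1.2) = gaussianReal 0 v := by
  unfold upperVar
  split_ifs with h
  · exact ⟨1, by simp, by rw [← h]; exact hA.diag_law _⟩
  · exact ⟨1 / 2, by simp, hA.offDiag_law _ _ (lt_of_le_of_ne e.2 h)⟩

theorem hasGaussianLaw_upper (hA : IsGOE A μ) (e : {e : Fin d × Fin d // e.1 ≤ e.2}) :
    HasGaussianLaw (fun ω => A ω e.1.1 e.1.2) μ := by
  obtain ⟨v, -, hv⟩ := hA.map_upper e
  constructor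
  rw [hv]
  infer_instance

theorem hasGaussianLaw_pi (hA : IsGOE A μ) :
    HasGaussianLaw (fun ω (e : {e : Fin d × Fin d // e.1 ≤ e.2}) => A ω e.1.1 e.1.2) μ :=
  hA.indep.hasGaussianLaw hA.hasGaussianLaw_upper

theorem ae_matInner_eq (hA : IsGOE A μ) (Z : Matrix (Fin d) (Fin d) ℝ) :
    (fun ω => matInner (A ω) Z) =ᵐ[μ] fun ω => ∑ e : {e : Fin d × Fin d // e.1 ≤ e.2},
      upperCoef Z e * A ω e.1.1 e.1.2 := by
  filter_upwards [hA.symm] with ω hω using matInner_eq_sum_upper hω Z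

theorem hasGaussianLaw_matInner_prod (hA : IsGOE A μ) (Z W : Matrix (Fin d) (Fin d) ℝ) :
    HasGaussianLaw (fun ω => (matInner (A ω) Z, matInner (A ω) W)) μ := by
  let L : Matrix (Fin d) (Fin d) ℝ → ({e : Fin d × Fin d // e.1 ≤ e.2} → ℝ) →L[ℝ] ℝ :=
    fun Z => ∑ e, upperCoef Z e • ContinuousLinearMap.proj e
  have hL : ∀ Z y, L Z y = ∑ e, upperCoef Z e * y e := by
    intro Z y; simp [L]
  refine (hA.hasGaussianLaw_pi.map_fun ((L Z).prod (L W))).congr ?_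
  filter_upwards [hA.ae_matInner_eq Z, hA.ae_matInner_eq W] with ω h1 h2
  simp only [ContinuousLinearMap.prod_apply, hL, h1, h2]

theorem hasGaussianLaw_matInner (hA : IsGOE A μ) (Z : Matrix (Fin d) (Fin d) ℝ) :
    HasGaussianLaw (fun ω => matInner (A ω) Z) μ :=
  (hA.hasGaussianLaw_matInner_prod Z Z).fst

theorem integral_upper (hA : IsGOE A μ) (e : {e : Fin d × Fin d // e.1 ≤ e.2}) :
    ∫ ω, A ω e.1.1 e.1.2 ∂μ = 0 := by
  obtain ⟨v, -, hv⟩ := hA.map_upper e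
  have := integral_map (μ := μ) (hA.measurable_entry e.1.1 e.1.2).aemeasurable
    (f := fun x : ℝ => x) aestronglyMeasurable_id
  rw [← this, hv]
  exact integral_id_gaussianReal

theorem variance_upper (hA : IsGOE A μ) (e : {e : Fin d × Fin d // e.1 ≤ e.2}) :
    Var[fun ω => A ω e.1.1 e.1.2; μ] = upperVar e := by
  obtain ⟨v, hv', hv⟩ := hA.map_upper e
  have := variance_map (μ := μ) (X := fun x : ℝ => x) (Y := fun ω => A ω e.1.1 e.1.2)
    aemeasurable_id (hA.measurable_entry e.1.1 e.1.2).aemeasurable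
  rw [hv, variance_fun_id_gaussianReal, hv'] at this
  exact this.symm

theorem integral_matInner (hA : IsGOE A μ) (Z : Matrix (Fin d) (Fin d) ℝ) :
    ∫ ω, matInner (A ω) Z ∂μ = 0 := by
  rw [integral_congr_ae (hA.ae_matInner_eq Z), integral_finsetSum]
  · simp [integral_const_mul, hA.integral_upper]
  · exact fun e _ => (hA.hasGaussianLaw_upper e).integrable.const_mul _

theorem covariance_matInner (hA : IsGOE A μ) (Z W : Matrix (Fin d) (Fin d) ℝ) :
    cov[fun ω => matInner (A ω) Z, fun ω => matInner (A ω) W; μ] =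
      ∑ e, upperCoef Z e * upperCoef W e * upperVar e := by
  have := (hA.hasGaussianLaw_matInner Z).isProbabilityMeasure
  have hc : cov[fun ω => matInner (A ω) Z, fun ω => matInner (A ω) W; μ] =
      cov[fun ω => ∑ e : {e : Fin d × Fin d // e.1 ≤ e.2}, upperCoef Z e * A ω e.1.1 e.1.2,
        fun ω => ∑ e : {e : Fin d × Fin d // e.1 ≤ e.2}, upperCoef W e * A ω e.1.1 e.1.2; μ] := by
    unfold covariance
    rw [integral_congr_ae (hA.ae_matInner_eq Z), integral_congr_ae (hA.ae_matInner_eq W)]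
    refine integral_congr_ae ?_
    filter_upwards [hA.ae_matInner_eq Z, hA.ae_matInner_eq W] with ω h1 h2
    rw [h1, h2]
  rw [hc]
  have hm : ∀ (c : ℝ) (e : {e : Fin d × Fin d // e.1 ≤ e.2}),
      MemLp (fun ω => c * A ω e.1.1 e.1.2) 2 μ :=
    fun c e => (hA.hasGaussianLaw_upper e).memLp_two.const_mul c
  rw [covariance_fun_sum_fun_sum (fun e => hm _ e) (fun e => hm _ e)]
  refine Finset.sum_congr rfl fun e _ => ?_
  rw [Finset.sum_eq_single e]
  · rw [covariance_const_mul_left, covariance_const_mul_right,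
      covariance_self (hA.measurable_entry _ _).aemeasurable, hA.variance_upper]
    ring
  · intro e' _ hne
    rw [covariance_const_mul_left, covariance_const_mul_right,
      (hA.indep.indepFun hne.symm).covariance_eq_zero (hA.hasGaussianLaw_upper e).memLp_two
        (hA.hasGaussianLaw_upper e').memLp_two]
    ring
  · simp

theorem map_matInner (hA : IsGOE A μ) (Z : Matrix (Fin d) (Fin d) ℝ) :
    ∃ v : NNReal, (v : ℝ) ≤ frobNorm Z ^ 2 ∧
      μ.map (fun ω => matInner (A ω) Z) = gaussianReal 0 v := by
  have h := (hA.hasGaussianLaw_matInner Z).map_eq_gaussianReal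
  rw [hA.integral_matInner] at h
  refine ⟨_, ?_, h⟩
  rw [Real.coe_toNNReal _ (variance_nonneg _ _),
    ← covariance_self (hA.measurable_matInner Z).aemeasurable, hA.covariance_matInner]
  exact sum_upperCoef_sq_le Z

theorem map_matInner_of_isSymm (hA : IsGOE A μ) {X : Matrix (Fin d) (Fin d) ℝ} (hX : X.IsSymm)
    (hX1 : frobNorm X = 1) : μ.map (fun ω => matInner (A ω) X) = gaussianReal 0 1 := by
  have h := (hA.hasGaussianLaw_matInner X).map_eq_gaussianReal
  rw [hA.integral_matInner, ← covariance_self (hA.measurable_matInner X).aemeasurable,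
    hA.covariance_matInner, sum_upperCoef_mul hX, matInner_self, hX1] at h
  simpa using h

theorem indepFun_matInner (hA : IsGOE A μ) {X W : Matrix (Fin d) (Fin d) ℝ} (hX : X.IsSymm)
    (hXW : matInner X W = 0) :
    IndepFun (fun ω => matInner (A ω) X) (fun ω => matInner (A ω) W) μ := by
  refine (hA.hasGaussianLaw_matInner_prod X W).indepFun_of_covariance_eq_zero ?_
  rw [hA.covariance_matInner, sum_upperCoef_mul hX, hXW]

end IsGOE

/-! ### One-dimensional Gaussian estimates -/

/-- For a centered variable the linear term integrates to zero, so its moment generating function is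
bounded by an exponential of a square. -/
theorem exp_le_add_exp_sq (x : ℝ) : Real.exp x ≤ x + Real.exp (x ^ 2) := by
  have h2 := Real.add_one_le_exp (x ^ 2)
  rcases le_or_gt |x| 1 with h | h
  · have := (abs_le.1 (Real.abs_exp_sub_one_sub_id_le h)).2
    linarith
  · rcases lt_abs.1 h with h | h
    · have : Real.exp x ≤ Real.exp (x ^ 2) := Real.exp_le_exp.2 (by nlinarith)
      linarith
    · have : Real.exp x ≤ 1 := Real.exp_le_one_iff.2 (by linarith)
      nlinarith

theorem gaussianPDFReal_mul_exp_sq {v : NNReal} (hv : v ≠ 0) (θ x : ℝ) :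
    gaussianPDFReal 0 v x * Real.exp (θ * x ^ 2) =
      (Real.sqrt (2 * Real.pi * v))⁻¹ * Real.exp (-(1 / (2 * v) - θ) * x ^ 2) := by
  have hv' : (v : ℝ) ≠ 0 := by exact_mod_cast hv
  rw [gaussianPDFReal, mul_assoc, ← Real.exp_add]
  congr 2
  field_simp
  ring

theorem integrable_exp_sq_gaussianReal {v : NNReal} (hv : (v : ℝ) ≤ 1) {θ : ℝ} (hθ : θ ≤ 1 / 4) :
    Integrable (fun x => Real.exp (θ * x ^ 2)) (gaussianReal 0 v) := by
  rcases eq_or_ne v 0 with rfl | h0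
  · rw [gaussianReal_zero_var]
    exact integrable_dirac (by simp)
  · have hpos : (0 : ℝ) < v := by positivity
    have hb : 0 < 1 / (2 * (v : ℝ)) - θ := by
      have : 1 / 2 ≤ 1 / (2 * (v : ℝ)) := one_div_le_one_div_of_le (by positivity) (by linarith)
      linarith
    rw [gaussianReal_of_var_ne_zero 0 h0, integrable_withDensity_iff_integrable_smul'
      (measurable_gaussianPDF 0 v) (by simp [gaussianPDF])]
    simp only [toReal_gaussianPDF, smul_eq_mul, gaussianPDFReal_mul_exp_sq h0]
    exact (integrable_exp_neg_mul_sq hb).const_mul _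

/-- For v ≠ 0 the exact value is (1 − y)^(−1/2) with y = 2vθ ≤ 1/2, and 1/(1 − y) ≤ e^{2y} on that
range. -/
theorem integral_exp_sq_gaussianReal_le {v : NNReal} (hv : (v : ℝ) ≤ 1) {θ : ℝ} (hθ0 : 0 ≤ θ)
    (hθ : θ ≤ 1 / 4) :
    ∫ x, Real.exp (θ * x ^ 2) ∂(gaussianReal 0 v) ≤ Real.exp (2 * θ) := by
  rcases eq_or_ne v 0 with rfl | h0
  · rw [gaussianReal_zero_var, integral_dirac]
    simpa using hθ0
  · have hpos : (0 : ℝ) < v := by positivity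
    set y : ℝ := 2 * v * θ with hy
    have hy0 : 0 ≤ y := by positivity
    have hy2 : y ≤ 2 * θ := by rw [hy]; nlinarith
    have hb : 1 / (2 * (v : ℝ)) - θ = (1 - y) / (2 * v) := by rw [hy]; field_simp
    rw [integral_gaussianReal_eq_integral_smul h0]
    simp only [smul_eq_mul, gaussianPDFReal_mul_exp_sq h0, hb]
    rw [integral_const_mul, integral_gaussian, ← Real.sqrt_inv,
      ← Real.sqrt_mul (by positivity)]
    have e : (2 * Real.pi * v)⁻¹ * (Real.pi / ((1 - y) / (2 * v))) = 1 / (1 - y) := by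
      have := Real.pi_pos.ne'
      have : 1 - y ≠ 0 := by linarith
      field_simp
    rw [e]
    refine Real.sqrt_le_iff.2 ⟨(Real.exp_pos _).le, ?_⟩
    rw [← Real.exp_nat_mul, div_le_iff₀ (by linarith)]
    have h1 : 1 + 2 * y + 2 * y ^ 2 ≤ Real.exp (2 * y) := by
      have := Real.quadratic_le_exp_of_nonneg (x := 2 * y) (by linarith)
      linarith
    have h2 : Real.exp (2 * y) ≤ Real.exp ((2 : ℕ) * (2 * θ)) :=
      Real.exp_le_exp.2 (by push_cast; linarith)
    have hy1 : y ≤ 1 / 2 := by linarith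
    calc 1 ≤ (1 + 2 * y + 2 * y ^ 2) * (1 - y) := by
          nlinarith [mul_nonneg hy0 (mul_nonneg hy0 (by linarith : (0 : ℝ) ≤ 1 - y)),
            mul_nonneg hy0 hy0]
      _ ≤ _ := mul_le_mul_of_nonneg_right (h1.trans h2) (by linarith)

theorem gaussianPDFReal_std (x : ℝ) :
    gaussianPDFReal 0 1 x = (Real.sqrt (2 * Real.pi))⁻¹ * Real.exp (-(x ^ 2) / 2) := by
  simp [gaussianPDFReal]

theorem gaussianReal_std_near_le (η c : ℝ) :
    (gaussianReal 0 1) {x | |x - c| ≤ 2 * η} ≤ ENNReal.ofReal (2 * η) := by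
  have hset : {x : ℝ | |x - c| ≤ 2 * η} = Set.Icc (c - 2 * η) (c + 2 * η) := by
    ext x; simp only [Set.mem_ofPred_eq, abs_le, Set.mem_Icc]; constructor <;> intro h <;>
      constructor <;> linarith [h.1, h.2]
  rw [gaussianReal_apply 0 one_ne_zero]
  have hpdf : ∀ x, gaussianPDF 0 1 x ≤ ENNReal.ofReal (1 / 2) := by
    intro x
    refine ENNReal.ofReal_le_ofReal ?_
    rw [gaussianPDFReal_std]
    have h2 : 2 ≤ Real.sqrt (2 * Real.pi) :=
      Real.le_sqrt_of_sq_le (by nlinarith [Real.pi_gt_three])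
    have h3 : (Real.sqrt (2 * Real.pi))⁻¹ ≤ 1 / 2 := by
      rw [← one_div]; exact one_div_le_one_div_of_le two_pos h2
    have h4 : Real.exp (-(x ^ 2) / 2) ≤ 1 := Real.exp_le_one_iff.2 (by nlinarith [sq_nonneg x])
    calc _ ≤ 1 / 2 * 1 := mul_le_mul h3 h4 (Real.exp_pos _).le (by norm_num)
      _ = _ := by norm_num
  calc _ ≤ ∫⁻ _ in {x : ℝ | |x - c| ≤ 2 * η}, ENNReal.ofReal (1 / 2) :=
        lintegral_mono fun x => hpdf x
    _ = ENNReal.ofReal (1 / 2) * ENNReal.ofReal (4 * η) := by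
        rw [setLIntegral_const, hset, Real.volume_Icc]; congr 2; ring
    _ = _ := by rw [← ENNReal.ofReal_mul (by norm_num)]; congr 1; ring

/-- Write sgn(x − c) = 2·1_{x ≥ c} − 1. The Gaussian density φ satisfies xφ(x) = −φ'(x), so the
integral is 2φ(c). -/
theorem integral_sgn_mul_gaussianReal_std (c : ℝ) :
    ∫ x, sgn (x - c) * x ∂(gaussianReal 0 1) =
      Real.sqrt (2 / Real.pi) * Real.exp (-c ^ 2 / 2) := by
  have hint : Integrable (fun x : ℝ => x) (gaussianReal 0 1) :=
    (memLp_id_gaussianReal' (μ := 0) (v := 1) 1 (by simp)).integrable le_rfl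
  have hdec : ∀ x, sgn (x - c) * x = 2 * (Set.Ici c).indicator (fun x => x) x - x := by
    intro x
    by_cases h : c ≤ x
    · rw [Set.indicator_of_mem (by simpa using h), sgn, if_neg (by linarith)]; ring
    · rw [Set.indicator_of_notMem (by simpa using h), sgn, if_pos (by linarith)]; ring
  have hpdfint : Integrable (fun x : ℝ => x * gaussianPDFReal 0 1 x) := by
    rw [gaussianReal_of_var_ne_zero 0 one_ne_zero, integrable_withDensity_iff_integrable_smul'
      (measurable_gaussianPDF 0 1) (by simp [gaussianPDF])] at hint
    simpa only [toReal_gaussianPDF, smul_eq_mul, mul_comm] using hint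
  have hderiv : ∀ x ∈ Set.Ici c, HasDerivAt (fun x => -gaussianPDFReal 0 1 x)
      (x * gaussianPDFReal 0 1 x) x := by
    intro x _
    have h1 : HasDerivAt (fun x : ℝ => -(x ^ 2) / 2) (-x) x := by
      have := ((hasDerivAt_pow 2 x).neg).div_const 2
      refine this.congr_deriv ?_
      push_cast; ring
    have h2 := ((h1.exp).const_mul (Real.sqrt (2 * Real.pi))⁻¹).neg
    have e : (fun x => -gaussianPDFReal 0 1 x) =
        fun x => -((Real.sqrt (2 * Real.pi))⁻¹ * Real.exp (-(x ^ 2) / 2)) := by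
      ext x; rw [gaussianPDFReal_std]
    rw [e, gaussianPDFReal_std]
    exact h2.congr_deriv (by ring)
  have hlim : Filter.Tendsto (fun x => -gaussianPDFReal 0 1 x) Filter.atTop (nhds 0) := by
    simp only [gaussianPDFReal_std]
    have h1 : Filter.Tendsto (fun x : ℝ => x ^ 2 / 2) Filter.atTop Filter.atTop :=
      (Filter.tendsto_pow_atTop two_ne_zero).atTop_div_const two_pos
    have h2 := (Real.tendsto_exp_neg_atTop_nhds_zero.comp h1).const_mul
      (Real.sqrt (2 * Real.pi))⁻¹
    have h3 := h2.neg
    simp only [mul_zero, neg_zero] at h3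
    refine h3.congr fun x => ?_
    simp [neg_div]
  have hset : ∫ x in Set.Ici c, x * gaussianPDFReal 0 1 x = gaussianPDFReal 0 1 c := by
    rw [integral_Ici_eq_integral_Ioi, integral_Ioi_of_hasDerivAt_of_tendsto'
      hderiv hpdfint.integrableOn hlim]
    ring
  have hind : ∫ x, (Set.Ici c).indicator (fun x => x) x ∂(gaussianReal 0 1) =
      gaussianPDFReal 0 1 c := by
    rw [integral_gaussianReal_eq_integral_smul one_ne_zero, ← hset,
      ← integral_indicator measurableSet_Ici]
    congr 1
    ext x
    by_cases h : x ∈ Set.Ici c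
    · simp [Set.indicator_of_mem h, mul_comm]
    · simp [Set.indicator_of_notMem h]
  simp only [hdec]
  rw [integral_sub ((hint.indicator measurableSet_Ici).const_mul 2) hint, integral_const_mul, hind,
    integral_id_gaussianReal, gaussianPDFReal_std, sub_zero, ← mul_assoc]
  congr 1
  rw [Real.sqrt_div zero_le_two, Real.sqrt_mul zero_le_two]
  have h2 : Real.sqrt 2 ≠ 0 := by positivity
  have hp : Real.sqrt Real.pi ≠ 0 := by have := Real.pi_pos; positivity
  field_simp
  exact (Real.sq_sqrt zero_le_two).symm

/-! ### Exponential tail bounds for independent sums -/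

section Chernoff

variable {Ω : Type*} [MeasurableSpace Ω] {μ : Measure Ω} [IsProbabilityMeasure μ]

theorem measureReal_le_exp_of_mgf_le {ι : Type*} {X : ι → Ω → ℝ} (hind : iIndepFun X μ)
    (hm : ∀ i, Measurable (X i)) (I : Finset ι) {t b C : ℝ} (ht : 0 ≤ t)
    (hint : ∀ i ∈ I, Integrable (fun ω => Real.exp (t * X i ω)) μ)
    (hmgf : ∀ i ∈ I, mgf (X i) μ t ≤ Real.exp C) :
    μ.real {ω | b ≤ ∑ i ∈ I, X i ω} ≤ Real.exp (I.card * C - t * b) := by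
  have h1 := measure_ge_le_exp_mul_mgf (X := ∑ i ∈ I, X i) b ht
    (hind.integrable_exp_mul_sum hm hint)
  rw [hind.mgf_sum hm] at h1
  have h2 : ∏ i ∈ I, mgf (X i) μ t ≤ Real.exp C ^ I.card := by
    rw [← Finset.prod_const]
    exact Finset.prod_le_prod (fun i _ => mgf_nonneg) hmgf
  simp only [Finset.sum_apply] at h1
  refine h1.trans ((mul_le_mul_of_nonneg_left h2 (Real.exp_pos _).le).trans (le_of_eq ?_))
  rw [← Real.exp_nat_mul, ← Real.exp_add]
  congr 1
  ring

theorem measureReal_card_filter_le {ι 𝒳 : Type*} [Fintype ι] [MeasurableSpace 𝒳] {P : ι → Ω → 𝒳}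
    (hind : iIndepFun P μ) (hm : ∀ i, Measurable (P i)) {B : ι → Set 𝒳}
    (hB : ∀ i, MeasurableSet (B i)) [∀ i x, Decidable (x ∈ B i)] {p η : ℝ} (hη : 0 ≤ η)
    (hp : ∑ i, μ.real (P i ⁻¹' B i) ≤ p * Fintype.card ι) :
    μ.real {ω | (p + η) * Fintype.card ι ≤ (Finset.univ.filter fun i => P i ω ∈ B i).card} ≤
      Real.exp (-(2 * η ^ 2 * Fintype.card ι)) := by
  let Y : ι → Ω → ℝ := fun i ω => (B i).indicator (fun _ => (1 : ℝ)) (P i ω)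
  have hYm : ∀ i, Measurable (Y i) := fun i => (measurable_const.indicator (hB i)).comp (hm i)
  have hY : ∀ i, ∫ ω, Y i ω ∂μ = μ.real (P i ⁻¹' B i) := by
    intro i
    have : Y i = (P i ⁻¹' B i).indicator (fun _ => (1 : ℝ)) := rfl
    rw [this, integral_indicator (hm i (hB i))]
    simp
  have hYind : iIndepFun (fun i ω => Y i ω - ∫ ω', Y i ω' ∂μ) μ :=
    hind.comp (fun i x => (B i).indicator (fun _ => (1 : ℝ)) x - ∫ ω', Y i ω' ∂μ)
      fun i => (measurable_const.indicator (hB i)).sub_const _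
  have hsub : ∀ i ∈ Finset.univ, HasSubgaussianMGF (fun ω => Y i ω - ∫ ω', Y i ω' ∂μ)
      ((‖(1 : ℝ) - 0‖₊ / 2) ^ 2) μ := by
    intro i _
    refine hasSubgaussianMGF_of_mem_Icc (hYm i).aemeasurable (Filter.Eventually.of_forall ?_)
    intro ω
    by_cases h : P i ω ∈ B i <;> simp [Y, h]
  have h := HasSubgaussianMGF.measure_sum_ge_le_of_iIndepFun hYind hsub
    (ε := η * Fintype.card ι) (by positivity)
  refine (measureReal_mono ?_).trans (h.trans (le_of_eq ?_))
  · intro ω hω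
    have hc : ((Finset.univ.filter fun i => P i ω ∈ B i).card : ℝ) = ∑ i, Y i ω := by
      simp only [Y, Set.indicator_apply, Finset.sum_boole]
    rw [Set.mem_ofPred_eq, hc] at hω
    rw [Set.mem_ofPred_eq, Finset.sum_sub_distrib]
    simp only [hY]
    linarith
  · congr 1
    rcases Nat.eq_zero_or_pos (Fintype.card ι) with h0 | h0
    · simp [h0]
    · have : (Fintype.card ι : ℝ) ≠ 0 := by positivity
      simp
      field_simp

/-- Domination by a Gaussian replaces knowledge of the law of ξ. With e = Eξ, (ξ − e)² ≤ 2g² + 2e²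
and e² ≤ 3, so the exponent is at most 6t² + 4t². The restriction on t keeps 2t² within the range
where exp(2t²g²) is controlled. -/
theorem centered_mgf_le_of_abs_le_gaussian {ξ g : Ω → ℝ} (hξ : Measurable ξ) (hg : Measurable g)
    (hle : ∀ ω, |ξ ω| ≤ |g ω|) {v : NNReal} (hv : (v : ℝ) ≤ 1)
    (hlaw : μ.map g = gaussianReal 0 v) {t : ℝ} (ht : t ^ 2 ≤ 1 / 8) :
    Integrable (fun ω => Real.exp (t * (ξ ω - ∫ ω', ξ ω' ∂μ))) μ ∧
      mgf (fun ω => ξ ω - ∫ ω', ξ ω' ∂μ) μ t ≤ Real.exp (10 * t ^ 2) := by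
  have hexp : ∀ θ : ℝ, θ ≤ 1 / 4 → Integrable (fun ω => Real.exp (θ * g ω ^ 2)) μ := by
    intro θ hθ
    have := integrable_exp_sq_gaussianReal hv hθ
    rw [← hlaw] at this
    exact this.comp_measurable hg
  have hexpi : ∀ θ : ℝ, 0 ≤ θ → θ ≤ 1 / 4 →
      ∫ ω, Real.exp (θ * g ω ^ 2) ∂μ ≤ Real.exp (2 * θ) := by
    intro θ hθ0 hθ
    rw [← integral_map (μ := μ) (φ := g) (f := fun x => Real.exp (θ * x ^ 2)) hg.aemeasurable
      (by fun_prop), hlaw]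
    exact integral_exp_sq_gaussianReal_le hv hθ0 hθ
  have habs : ∀ x : ℝ, |x| ≤ Real.exp (1 / 4 * x ^ 2) := by
    intro x
    have h1 := Real.add_one_le_exp (1 / 4 * x ^ 2)
    rw [← sq_abs] at h1 ⊢
    nlinarith [sq_nonneg (|x| - 2)]
  have hξle : ∀ ω, ‖ξ ω‖ ≤ Real.exp (1 / 4 * g ω ^ 2) := fun ω => (hle ω).trans (habs _)
  have hξint : Integrable ξ μ :=
    (hexp (1 / 4) le_rfl).mono' hξ.aestronglyMeasurable (Filter.Eventually.of_forall hξle)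
  set e := ∫ ω', ξ ω' ∂μ with he
  -- From |x| ≤ exp(x²/4) follows |e| ≤ E exp(g²/4) ≤ exp(1/2), whose square is below 3.
  have hesq : e ^ 2 ≤ 3 := by
    have h1 : |e| ≤ Real.exp (2 * (1 / 4)) := by
      refine (abs_integral_le_integral_abs).trans ((integral_mono hξint.abs
        (hexp (1 / 4) le_rfl) hξle).trans (hexpi _ (by norm_num) le_rfl))
    rw [← sq_abs]
    refine (pow_le_pow_left₀ (abs_nonneg _) h1 2).trans ?_
    rw [← Real.exp_nat_mul]
    have := Real.exp_one_lt_d9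
    norm_num at this ⊢
    linarith
  have hpt : ∀ ω, Real.exp (t * (ξ ω - e)) ≤
      t * (ξ ω - e) + Real.exp (2 * t ^ 2 * e ^ 2) * Real.exp (2 * t ^ 2 * g ω ^ 2) := by
    intro ω
    refine (exp_le_add_exp_sq _).trans (add_le_add_right ?_ _)
    rw [← Real.exp_add]
    refine Real.exp_le_exp.2 ?_
    have h1 : ξ ω ^ 2 ≤ g ω ^ 2 := sq_le_sq.2 (hle ω)
    have h2 : (ξ ω - e) ^ 2 ≤ 2 * g ω ^ 2 + 2 * e ^ 2 := by nlinarith [sq_nonneg (ξ ω + e)]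
    rw [mul_pow]
    nlinarith [sq_nonneg t]
  have hint2 : Integrable (fun ω => t * (ξ ω - e) +
      Real.exp (2 * t ^ 2 * e ^ 2) * Real.exp (2 * t ^ 2 * g ω ^ 2)) μ :=
    ((hξint.sub (integrable_const e)).const_mul t).add ((hexp _ (by linarith)).const_mul _)
  have hint : Integrable (fun ω => Real.exp (t * (ξ ω - e))) μ := by
    refine hint2.mono' (by fun_prop) (Filter.Eventually.of_forall fun ω => ?_)
    rw [Real.norm_of_nonneg (Real.exp_pos _).le]
    exact hpt ω
  refine ⟨hint, (integral_mono hint hint2 hpt).trans ?_⟩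
  have hξe : Integrable (fun ω => t * (ξ ω - e)) μ :=
    (hξint.sub (integrable_const e)).const_mul t
  rw [integral_add hξe ((hexp _ (by linarith)).const_mul _), integral_const_mul,
    integral_const_mul, integral_sub hξint (integrable_const e)]
  simp only [integral_const, probReal_univ, one_smul, ← he, sub_self, mul_zero, zero_add]
  calc _ ≤ Real.exp (2 * t ^ 2 * e ^ 2) * Real.exp (2 * (2 * t ^ 2)) :=
        mul_le_mul_of_nonneg_left (hexpi _ (by positivity) (by linarith)) (Real.exp_pos _).le
    _ = Real.exp (2 * t ^ 2 * e ^ 2 + 2 * (2 * t ^ 2)) := (Real.exp_add _ _).symm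
    _ ≤ _ := Real.exp_le_exp.2 (by nlinarith [sq_nonneg t])

theorem measureReal_centered_sum_ge_le {ι : Type*} {ξ g : ι → Ω → ℝ} (hind : iIndepFun ξ μ)
    (hξ : ∀ i, Measurable (ξ i)) (hg : ∀ i, Measurable (g i))
    (hle : ∀ i ω, |ξ i ω| ≤ |g i ω|)
    (hlaw : ∀ i, ∃ v : NNReal, (v : ℝ) ≤ 1 ∧ μ.map (g i) = gaussianReal 0 v)
    (I : Finset ι) {n b : ℝ} (hI : (I.card : ℝ) ≤ n) (hb0 : 0 ≤ b) (hb : b ≤ 1) :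
    μ.real {ω | b * n ≤ ∑ i ∈ I, (ξ i ω - ∫ ω', ξ i ω' ∂μ)} ≤ Real.exp (-(b ^ 2 / 40 * n)) := by
  -- The parameter b/20 minimizes 10t² − tb, with minimum −b²/40.
  have ht : (b / 20) ^ 2 ≤ 1 / 8 := by nlinarith
  have hmg : ∀ i, Integrable (fun ω => Real.exp (b / 20 * (ξ i ω - ∫ ω', ξ i ω' ∂μ))) μ ∧
      mgf (fun ω => ξ i ω - ∫ ω', ξ i ω' ∂μ) μ (b / 20) ≤ Real.exp (10 * (b / 20) ^ 2) := by
    intro i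
    obtain ⟨v, hv, hl⟩ := hlaw i
    exact centered_mgf_le_of_abs_le_gaussian (hξ i) (hg i) (hle i) hv hl ht
  refine (measureReal_le_exp_of_mgf_le (b := b * n)
    (hind.comp (fun i x => x - ∫ ω', ξ i ω' ∂μ) fun i => by fun_prop)
    (fun i => (hξ i).sub_const _) I (t := b / 20) (by positivity) (fun i _ => (hmg i).1)
    (fun i _ => (hmg i).2)).trans (Real.exp_le_exp.2 ?_)
  nlinarith [mul_le_mul_of_nonneg_right hI (sq_nonneg b)]

end Chernoff

/-- Since e^{t|g|} ≤ e^{tg} + e^{−tg}, the absolute value costs only log 2. Explicit constants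
matter here: they must fit under the coefficient 3 of p in the arbitrary corruption model. -/
theorem mgf_abs_le_of_gaussian {Ω : Type*} [MeasurableSpace Ω] {μ : Measure Ω} {g : Ω → ℝ} (hg : Measurable g) {v : NNReal} (hv : (v : ℝ) ≤ 1)
    (hlaw : μ.map g = gaussianReal 0 v) (t : ℝ) :
    Integrable (fun ω => Real.exp (t * |g ω|)) μ ∧
      mgf (fun ω => |g ω|) μ t ≤ Real.exp (Real.log 2 + t ^ 2 / 2) := by
  have hint : ∀ t : ℝ, Integrable (fun ω => Real.exp (t * g ω)) μ := by
    intro t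
    have := integrable_exp_mul_gaussianReal (μ := 0) (v := v) t
    rw [← hlaw] at this
    exact this.comp_measurable hg
  have hpt : ∀ ω, Real.exp (t * |g ω|) ≤ Real.exp (t * g ω) + Real.exp (-t * g ω) := by
    intro ω
    rcases abs_cases (g ω) with ⟨h, -⟩ | ⟨h, -⟩
    · rw [h]; linarith [Real.exp_pos (-t * g ω)]
    · rw [h, mul_neg, neg_mul]; linarith [Real.exp_pos (t * g ω)]
  have hint' : Integrable (fun ω => Real.exp (t * |g ω|)) μ := by
    refine ((hint t).add (hint (-t))).mono' (by fun_prop) (Filter.Eventually.of_forall fun ω => ?_)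
    rw [Real.norm_of_nonneg (Real.exp_pos _).le]
    exact hpt ω
  refine ⟨hint', (integral_mono hint' ((hint t).add (hint (-t))) hpt).trans ?_⟩
  have h1 : ∀ t : ℝ, ∫ ω, Real.exp (t * g ω) ∂μ = Real.exp (v * t ^ 2 / 2) := by
    intro t
    have := mgf_gaussianReal hlaw t
    rw [zero_mul, zero_add] at this
    exact this
  rw [integral_add' (hint t) (hint (-t)), h1, h1, Real.exp_add, Real.exp_log two_pos, neg_sq,
    ← two_mul]
  refine mul_le_mul_of_nonneg_left (Real.exp_le_exp.2 ?_) zero_le_two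
  nlinarith [sq_nonneg t]

/-! ### A GOE matrix with an independent offset -/

namespace IsGOE

variable {Ω : Type*} [MeasurableSpace Ω] {μ : Measure Ω} {d : ℕ}
  {A : Ω → Matrix (Fin d) (Fin d) ℝ} {s : Ω → ℝ}

theorem integrable_matInner (hA : IsGOE A μ) (Z : Matrix (Fin d) (Fin d) ℝ) :
    Integrable (fun ω => matInner (A ω) Z) μ :=
  (hA.hasGaussianLaw_matInner Z).integrable

theorem integral_sgn_mul_matInner (hA : IsGOE A μ) {X : Matrix (Fin d) (Fin d) ℝ}
    (hX : X.IsSymm) (hX1 : frobNorm X = 1) (Z : Matrix (Fin d) (Fin d) ℝ) (c : ℝ) :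
    ∫ ω, sgn (matInner (A ω) X - c) * matInner (A ω) Z ∂μ =
      Real.sqrt (2 / Real.pi) * Real.exp (-c ^ 2 / 2) * matInner X Z := by
  -- The component of Z orthogonal to X: ⟨A, W⟩ is centered and independent of the sign, so only the
  -- multiple of X contributes to the mean.
  set W := Z - matInner X Z • X with hW
  have hXW : matInner X W = 0 := by
    rw [hW, matInner_sub_right, matInner_smul_right, matInner_self, hX1]; ring
  have hms : Measurable fun ω => sgn (matInner (A ω) X - c) :=
    measurable_sgn.comp ((hA.measurable_matInner X).sub_const c)
  have hbd : ∀ Y : Matrix (Fin d) (Fin d) ℝ,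
      Integrable (fun ω => sgn (matInner (A ω) X - c) * matInner (A ω) Y) μ := by
    intro Y
    refine (hA.integrable_matInner Y).mono
      (hms.mul (hA.measurable_matInner Y)).aestronglyMeasurable
      (Filter.Eventually.of_forall fun ω => ?_)
    simp [abs_sgn]
  have hdec : ∀ ω, sgn (matInner (A ω) X - c) * matInner (A ω) Z =
      matInner X Z * (sgn (matInner (A ω) X - c) * matInner (A ω) X) +
        sgn (matInner (A ω) X - c) * matInner (A ω) W := by
    intro ω
    rw [hW, matInner_sub_right, matInner_smul_right]; ring
  have h1 : ∫ ω, sgn (matInner (A ω) X - c) * matInner (A ω) X ∂μ =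
      Real.sqrt (2 / Real.pi) * Real.exp (-c ^ 2 / 2) := by
    rw [← integral_sgn_mul_gaussianReal_std, ← hA.map_matInner_of_isSymm hX hX1,
      integral_map (hA.measurable_matInner X).aemeasurable]
    exact ((measurable_sgn.comp (measurable_id.sub_const c)).mul
      measurable_id).aestronglyMeasurable
  have h2 : ∫ ω, sgn (matInner (A ω) X - c) * matInner (A ω) W ∂μ = 0 := by
    have hi : IndepFun (fun ω => sgn (matInner (A ω) X - c)) (fun ω => matInner (A ω) W) μ :=
      (hA.indepFun_matInner hX hXW).comp (measurable_sgn.comp (measurable_id.sub_const c))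
        measurable_id
    rw [hi.integral_fun_mul_eq_mul_integral hms.aestronglyMeasurable
      (hA.measurable_matInner W).aestronglyMeasurable, hA.integral_matInner, mul_zero]
  simp only [hdec]
  rw [integral_add ((hbd X).const_mul _) (hbd W), integral_const_mul, h1, h2]
  ring

theorem measurable_sgn_matInner_mul (X Z : Matrix (Fin d) (Fin d) ℝ) (t : ℝ) :
    Measurable fun q : Matrix (Fin d) (Fin d) ℝ × ℝ =>
      sgn (matInner q.1 X - q.2 * t) * matInner q.1 Z :=
  (measurable_sgn.comp (((measurable_matInner_right X).comp measurable_fst).sub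
    (measurable_snd.mul_const t))).mul ((measurable_matInner_right Z).comp measurable_fst)

variable [IsProbabilityMeasure μ]

/-- By Fubini the independent offset can be frozen, reducing to the deterministic offset c·t. -/
theorem integral_sgn_sub_mul_matInner (hA : IsGOE A μ) (hs : Measurable s)
    (hAs : IndepFun A s μ) {X : Matrix (Fin d) (Fin d) ℝ}
    (hX : X.IsSymm) (hX1 : frobNorm X = 1) (Z : Matrix (Fin d) (Fin d) ℝ) (t : ℝ) :
    ∫ ω, sgn (matInner (A ω) X - s ω * t) * matInner (A ω) Z ∂μ =
      Real.sqrt (2 / Real.pi) * (∫ ω, Real.exp (-(s ω * t) ^ 2 / 2) ∂μ) * matInner X Z := by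
  have := Measure.isProbabilityMeasure_map (μ := μ) hA.measurable.aemeasurable
  have := Measure.isProbabilityMeasure_map (μ := μ) hs.aemeasurable
  let φ : Matrix (Fin d) (Fin d) ℝ × ℝ → ℝ := fun q =>
    sgn (matInner q.1 X - q.2 * t) * matInner q.1 Z
  have hφ : Measurable φ := measurable_sgn_matInner_mul X Z t
  have hpair : Measurable fun ω => (A ω, s ω) := hA.measurable.prodMk hs
  have hint : Integrable φ (μ.map fun ω => (A ω, s ω)) := by
    rw [integrable_map_measure hφ.aestronglyMeasurable hpair.aemeasurable]
    refine (hA.integrable_matInner Z).mono (hφ.comp hpair).aestronglyMeasurable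
      (Filter.Eventually.of_forall fun ω => ?_)
    simp [φ, abs_sgn]
  have h1 : ∫ ω, sgn (matInner (A ω) X - s ω * t) * matInner (A ω) Z ∂μ =
      ∫ q, φ q ∂(μ.map fun ω => (A ω, s ω)) :=
    (integral_map hpair.aemeasurable hφ.aestronglyMeasurable).symm
  rw [hAs.map_prod_eq_prod_map_map hA.measurable.aemeasurable hs.aemeasurable] at hint h1
  rw [h1, integral_prod_symm _ hint]
  have h2 : ∀ c : ℝ, ∫ a, φ (a, c) ∂(μ.map A) =
      Real.sqrt (2 / Real.pi) * matInner X Z * Real.exp (-(c * t) ^ 2 / 2) := by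
    intro c
    have hc : Measurable fun a => φ (a, c) := hφ.comp measurable_prodMk_right
    rw [integral_map hA.measurable.aemeasurable hc.aestronglyMeasurable]
    refine (hA.integral_sgn_mul_matInner hX hX1 Z (c * t)).trans ?_
    ring
  simp only [h2]
  rw [integral_const_mul, integral_map hs.aemeasurable (by fun_prop)]
  ring

theorem measureReal_near_le (hA : IsGOE A μ) (hs : Measurable s)
    (hAs : IndepFun A s μ) {X : Matrix (Fin d) (Fin d) ℝ}
    (hX : X.IsSymm) (hX1 : frobNorm X = 1) (t : ℝ) {η : ℝ} (hη : 0 ≤ η) :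
    μ.real {ω | |matInner (A ω) X - s ω * t| ≤ 2 * η} ≤ 2 * η := by
  have := Measure.isProbabilityMeasure_map (μ := μ) hA.measurable.aemeasurable
  have := Measure.isProbabilityMeasure_map (μ := μ) hs.aemeasurable
  let B : Set (Matrix (Fin d) (Fin d) ℝ × ℝ) := {q | |matInner q.1 X - q.2 * t| ≤ 2 * η}
  have hB : MeasurableSet B := measurableSet_le
    (((measurable_matInner_right X).comp measurable_fst).sub (measurable_snd.mul_const t)).abs
    measurable_const
  have hpair : Measurable fun ω => (A ω, s ω) := hA.measurable.prodMk hs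
  have h1 : μ {ω | |matInner (A ω) X - s ω * t| ≤ 2 * η} = (μ.map fun ω => (A ω, s ω)) B :=
    (Measure.map_apply hpair hB).symm
  rw [hAs.map_prod_eq_prod_map_map hA.measurable.aemeasurable hs.aemeasurable,
    Measure.prod_apply_symm hB] at h1
  refine ENNReal.toReal_le_of_le_ofReal (by linarith) ?_
  rw [h1]
  calc _ ≤ ∫⁻ _, ENNReal.ofReal (2 * η) ∂(μ.map s) := by
        refine lintegral_mono fun c => ?_
        rw [Measure.map_apply hA.measurable (hB.preimage measurable_prodMk_right)]
        have h2 := gaussianReal_std_near_le η (c * t)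
        rw [← hA.map_matInner_of_isSymm hX hX1, Measure.map_apply (hA.measurable_matInner X)
          (measurableSet_le (by fun_prop) measurable_const)] at h2
        exact h2
    _ = _ := by simp

end IsGOE

/-- Independent pairs of a GOE matrix and an offset, the two components being independent. -/
structure IsGOEPairSample {Ω : Type*} [MeasurableSpace Ω] {d m : ℕ}
    (A : Fin m → Ω → Matrix (Fin d) (Fin d) ℝ) (s : Fin m → Ω → ℝ) (μ : Measure Ω) : Prop where
  goe : ∀ i, IsGOE (A i) μ
  measurable : ∀ i, Measurable (s i)
  indep : iIndepFun (fun i ω => (A i ω, s i ω)) μ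
  indep_offset : ∀ i, IndepFun (A i) (s i) μ

namespace IsGOEPairSample

variable {Ω : Type*} [MeasurableSpace Ω] {μ : Measure Ω} {d m : ℕ}
  {A : Fin m → Ω → Matrix (Fin d) (Fin d) ℝ} {s : Fin m → Ω → ℝ}

theorem measurable_pair (h : IsGOEPairSample A s μ) (i : Fin m) :
    Measurable fun ω => (A i ω, s i ω) :=
  (h.goe i).measurable.prodMk (h.measurable i)

theorem map_matInner_le_one (h : IsGOEPairSample A s μ) (i : Fin m)
    {Z : Matrix (Fin d) (Fin d) ℝ} (hZ : frobNorm Z ≤ 1) :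
    ∃ v : NNReal, (v : ℝ) ≤ 1 ∧ μ.map (fun ω => matInner (A i ω) Z) = gaussianReal 0 v := by
  obtain ⟨v, hv, hl⟩ := (h.goe i).map_matInner Z
  exact ⟨v, hv.trans (pow_le_one₀ (frobNorm_nonneg _) hZ), hl⟩

variable [IsProbabilityMeasure μ]

/-- Chernoff for ∑⟨A_i, Z⟩² at parameter 1/4 and threshold 4m: the exponent is m/2 − m. -/
theorem measureReal_sens_le (h : IsGOEPairSample A s μ)
    {Z : Matrix (Fin d) (Fin d) ℝ} (hZ : frobNorm Z ≤ 1) :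
    μ.real {ω | 2 * Real.sqrt m ≤ ‖sens (fun i => A i ω) Z‖} ≤ Real.exp (-(m / 2)) := by
  have hind : iIndepFun (fun i ω => matInner (A i ω) Z ^ 2) μ :=
    h.indep.comp (fun _ q => matInner q.1 Z ^ 2)
      fun _ => ((measurable_matInner_right Z).comp measurable_fst).pow_const 2
  have hmeas : ∀ i, Measurable fun ω => matInner (A i ω) Z := fun i =>
    (h.goe i).measurable_matInner Z
  have hmg : ∀ i, Integrable (fun ω => Real.exp (1 / 4 * matInner (A i ω) Z ^ 2)) μ ∧
      mgf (fun ω => matInner (A i ω) Z ^ 2) μ (1 / 4) ≤ Real.exp (1 / 2) := by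
    intro i
    obtain ⟨v, hv, hl⟩ := h.map_matInner_le_one i hZ
    have h1 := integrable_exp_sq_gaussianReal hv (θ := 1 / 4) le_rfl
    have h2 := integral_exp_sq_gaussianReal_le hv (θ := 1 / 4) (by norm_num) le_rfl
    rw [← hl] at h1 h2
    rw [integral_map (hmeas i).aemeasurable (by fun_prop)] at h2
    refine ⟨h1.comp_measurable (hmeas i), h2.trans (Real.exp_le_exp.2 (by norm_num))⟩
  refine (measureReal_mono ?_).trans ((measureReal_le_exp_of_mgf_le (b := 4 * m) hind
    (fun i => (hmeas i).pow_const 2) Finset.univ (t := 1 / 4) (by norm_num)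
    (fun i _ => (hmg i).1) (fun i _ => (hmg i).2)).trans (Real.exp_le_exp.2 ?_))
  · intro ω hω
    rw [Set.mem_ofPred_eq] at hω ⊢
    rw [← norm_sens_sq]
    have := pow_le_pow_left₀ (by positivity) hω 2
    rw [mul_pow, Real.sq_sqrt (Nat.cast_nonneg m)] at this
    linarith
  · simp only [Finset.card_univ, Fintype.card_fin]
    linarith

theorem measureReal_sgn_sum_le (h : IsGOEPairSample A s μ) {X Z : Matrix (Fin d) (Fin d) ℝ}
    (hX : X.IsSymm) (hX1 : frobNorm X = 1) (hZ : frobNorm Z ≤ 1) (t : ℝ) (I : Finset (Fin m))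
    {b : ℝ} (hb0 : 0 ≤ b) (hb : b ≤ 1) :
    μ.real {ω | b * m ≤ ∑ i ∈ I, (sgn (matInner (A i ω) X - s i ω * t) * matInner (A i ω) Z -
        Real.sqrt (2 / Real.pi) * (∫ ω', Real.exp (-(s i ω' * t) ^ 2 / 2) ∂μ) * matInner X Z)} ≤
      Real.exp (-(b ^ 2 / 40 * m)) := by
  have hφ := IsGOE.measurable_sgn_matInner_mul X Z t
  have hξ : ∀ i, Measurable fun ω => sgn (matInner (A i ω) X - s i ω * t) * matInner (A i ω) Z := by
    intro i
    have := hφ.comp (h.measurable_pair i)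
    exact this
  have hind : iIndepFun (fun i ω => sgn (matInner (A i ω) X - s i ω * t) * matInner (A i ω) Z) μ := by
    have := h.indep.comp (fun _ q => sgn (matInner q.1 X - q.2 * t) * matInner q.1 Z) fun _ => hφ
    exact this
  have hle : ∀ i ω, |sgn (matInner (A i ω) X - s i ω * t) * matInner (A i ω) Z| ≤ |matInner (A i ω) Z| := by
    intro i ω
    simp only [abs_mul, abs_sgn, one_mul, le_refl]
  have hmean : ∀ i, ∫ ω', sgn (matInner (A i ω') X - s i ω' * t) * matInner (A i ω') Z ∂μ = Real.sqrt (2 / Real.pi) *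
      (∫ ω', Real.exp (-(s i ω' * t) ^ 2 / 2) ∂μ) * matInner X Z := fun i =>
    (h.goe i).integral_sgn_sub_mul_matInner (h.measurable i) (h.indep_offset i) hX hX1 Z t
  have hI : (I.card : ℝ) ≤ m := by
    exact_mod_cast (Finset.card_le_univ I).trans_eq (Fintype.card_fin m)
  have key := measureReal_centered_sum_ge_le hind hξ
    (fun i => (h.goe i).measurable_matInner Z) hle
    (fun i => h.map_matInner_le_one i hZ) I hI hb0 hb
  simp only [hmean] at key
  exact key

open Classical in
theorem measureReal_near_card_le (h : IsGOEPairSample A s μ) {X : Matrix (Fin d) (Fin d) ℝ}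
    (hX : X.IsSymm) (hX1 : frobNorm X = 1) (t : ℝ) {η : ℝ} (hη : 0 ≤ η) :
    μ.real {ω | 3 * η * m ≤
      (Finset.univ.filter fun i => |matInner (A i ω) X - s i ω * t| ≤ 2 * η).card} ≤
      Real.exp (-(2 * η ^ 2 * m)) := by
  let B : Set (Matrix (Fin d) (Fin d) ℝ × ℝ) := {q | |matInner q.1 X - q.2 * t| ≤ 2 * η}
  have hB : MeasurableSet B := measurableSet_le
    (((measurable_matInner_right X).comp measurable_fst).sub (measurable_snd.mul_const t)).abs
    measurable_const
  have := measureReal_card_filter_le h.indep h.measurable_pair (B := fun _ => B) (fun _ => hB)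
    (p := 2 * η) hη (by
      calc _ ≤ ∑ _i : Fin m, 2 * η := Finset.sum_le_sum fun i _ =>
            (h.goe i).measureReal_near_le (h.measurable i) (h.indep_offset i) hX hX1 t hη
        _ = _ := by simp [mul_comm])
  rw [Fintype.card_fin, show 2 * η + η = 3 * η by ring] at this
  exact this

open Classical in
theorem measureReal_offset_card_le (h : IsGOEPairSample A s μ) {B : Set ℝ} (hB : MeasurableSet B)
    {p : ℝ} (hp0 : 0 ≤ p) (hp : ∑ i, μ.real (s i ⁻¹' B) ≤ p * m) :
    μ.real {ω | 2 * p * m ≤ (Finset.univ.filter fun i => s i ω ∈ B).card} ≤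
      Real.exp (-(2 * p ^ 2 * m)) := by
  have := measureReal_card_filter_le h.indep h.measurable_pair
    (B := fun _ => {q : Matrix (Fin d) (Fin d) ℝ × ℝ | q.2 ∈ B})
    (fun _ => hB.preimage measurable_snd) (p := p) hp0 (by rw [Fintype.card_fin]; exact hp)
  rw [Fintype.card_fin, ← two_mul] at this
  exact this

end IsGOEPairSample

/-! ### Discretization of the scale -/

/-- Cut where f has risen by Δ (intermediate value theorem) and repeat. The count depends only on
the total rise, which makes it uniform over the offset laws. -/
theorem exists_grid_of_continuousOn {f : ℝ → ℝ} {b Δ : ℝ} (hΔ : 0 < Δ) (n : ℕ) :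
    ∀ a ≤ b, ContinuousOn f (Set.Icc a b) → f b - f a ≤ n * Δ →
    ∃ G : Finset (ℝ × ℝ), G.card ≤ n + 1 ∧
      (∀ g ∈ G, a ≤ g.1 ∧ g.1 ≤ g.2 ∧ g.2 ≤ b ∧ f g.2 - f g.1 ≤ Δ) ∧
      ∀ x ∈ Set.Icc a b, ∃ g ∈ G, g.1 ≤ x ∧ x ≤ g.2 := by
  classical
  induction n with
  | zero =>
    intro a hab _ h
    refine ⟨{(a, b)}, by simp, ?_, ?_⟩
    · simp only [Finset.mem_singleton, forall_eq]
      exact ⟨le_rfl, hab, le_rfl, by simp at h; linarith⟩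
    · intro x hx; exact ⟨(a, b), by simp, hx.1, hx.2⟩
  | succ n ih =>
    intro a hab hf h
    by_cases hs : f b - f a ≤ Δ
    · refine ⟨{(a, b)}, by simp, ?_, ?_⟩
      · simp only [Finset.mem_singleton, forall_eq]
        exact ⟨le_rfl, hab, le_rfl, hs⟩
      · intro x hx; exact ⟨(a, b), by simp, hx.1, hx.2⟩
    · obtain ⟨c, hc, hfc⟩ := intermediate_value_Icc hab hf
        (show f a + Δ ∈ Set.Icc (f a) (f b) from ⟨by linarith, by linarith⟩)
      obtain ⟨G, hG1, hG2, hG3⟩ := ih c hc.2 (hf.mono (Set.Icc_subset_Icc_left hc.1))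
        (by push_cast at h; linarith)
      refine ⟨insert (a, c) G, (Finset.card_insert_le _ _).trans (by omega), ?_, ?_⟩
      · intro g hg
        rcases Finset.mem_insert.1 hg with rfl | hg
        · exact ⟨le_rfl, hc.1, hc.2, by dsimp only; linarith⟩
        · obtain ⟨h1, h2, h3, h4⟩ := hG2 g hg
          exact ⟨hc.1.trans h1, h2, h3, h4⟩
      · intro x hx
        rcases le_total x c with hxc | hxc
        · exact ⟨_, Finset.mem_insert_self _ _, hx.1, hxc⟩
        · obtain ⟨g, hg, h1⟩ := hG3 x ⟨hxc, hx.2⟩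
          exact ⟨g, Finset.mem_insert_of_mem hg, h1⟩

/-- The saturation `|s| τ / (|s| τ + 1)` of the scaled offset, where `τ = x / (1 - x)`. -/
noncomputable def saturation (s x : ℝ) : ℝ := |s| * x / (|s| * x + (1 - x))

theorem saturation_denom_pos {s x : ℝ} (hs : s ≠ 0) (h0 : 0 ≤ x) (h1 : x ≤ 1) :
    0 < |s| * x + (1 - x) := by
  have := abs_pos.2 hs
  rcases eq_or_lt_of_le h1 with rfl | h
  · linarith
  · have := mul_nonneg this.le h0; linarith

theorem saturation_mem_Icc (s : ℝ) {x : ℝ} (h0 : 0 ≤ x) (h1 : x ≤ 1) :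
    saturation s x ∈ Set.Icc 0 1 := by
  have h := mul_nonneg (abs_nonneg s) h0
  unfold saturation
  exact ⟨by apply div_nonneg h; linarith, div_le_one_of_le₀ (by linarith) (by linarith)⟩

theorem saturation_mono (s : ℝ) {x y : ℝ} (h0 : 0 ≤ x) (hxy : x ≤ y) (h1 : y ≤ 1) :
    saturation s x ≤ saturation s y := by
  rcases eq_or_ne s 0 with rfl | hs
  · simp [saturation]
  · unfold saturation
    rw [div_le_div_iff₀ (saturation_denom_pos hs h0 (hxy.trans h1))
      (saturation_denom_pos hs (h0.trans hxy) h1)]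
    nlinarith [abs_pos.2 hs]

theorem continuousOn_saturation (s : ℝ) : ContinuousOn (saturation s) (Set.Icc 0 1) := by
  rcases eq_or_ne s 0 with rfl | hs
  -- At s = 0, x = 1 the quotient is 0/0, which evaluates to 0, so continuity survives at the
  -- endpoint.
  · have : saturation 0 = fun _ => 0 := by ext; simp [saturation]
    rw [this]; exact continuousOn_const
  · unfold saturation
    exact ContinuousOn.div (by fun_prop) (by fun_prop)
      fun x hx => (saturation_denom_pos hs hx.1 hx.2).ne'

theorem measurable_saturation (x : ℝ) : Measurable fun s => saturation s x := by
  unfold saturation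
  exact (measurable_id.abs.mul_const x).div ((measurable_id.abs.mul_const x).add_const _)

theorem saturation_eq (s : ℝ) {x : ℝ} (h1 : x < 1) :
    saturation s x = |s| * (x / (1 - x)) / (|s| * (x / (1 - x)) + 1) := by
  have : 1 - x ≠ 0 := by linarith
  have e : |s| * (x / (1 - x)) + 1 = (|s| * x + (1 - x)) / (1 - x) := by field_simp
  rw [saturation, e, ← mul_div_assoc, div_div_div_cancel_right₀ this]

theorem div_one_sub_mono {l x : ℝ} (h0 : 0 ≤ l) (hlx : l ≤ x) (h1 : x < 1) :
    l / (1 - l) ≤ x / (1 - x) :=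
  div_le_div₀ (h0.trans hlx) hlx (by linarith) (by linarith)

/-- With z = |s|t and y = |s|τ, where t = l/(1 − l) and τ = x/(1 − x), the saturation difference is
(y − z)/((y + 1)(z + 1)). If z < 2¹⁰/δ then z + 1 ≤ 2¹¹/δ, so y − z ≤ (δ³/2²⁸)(y + 1). Splitting y +
1 = (z + 1) + (y − z) and absorbing the last part gives y − z ≤ δ²/2¹⁶. -/
theorem close_or_large_of_saturation {s l x r δ : ℝ} (hδ : 0 < δ) (hδ1 : δ ≤ 1) (h0 : 0 ≤ l)
    (hlx : l ≤ x) (hxr : x ≤ r) (hr : r ≤ 1) (hx : x < 1)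
    (h : saturation s r - saturation s l ≤ δ ^ 4 / 2 ^ 39) :
    |s| * (x / (1 - x) - l / (1 - l)) ≤ δ ^ 2 / 2 ^ 16 ∨ 2 ^ 10 / δ ≤ |s| * (l / (1 - l)) := by
  by_contra! hcon
  obtain ⟨hc1, hc2⟩ := hcon
  have h2 := saturation_mono s (h0.trans hlx) hxr hr
  have h3 : saturation s x - saturation s l ≤ δ ^ 4 / 2 ^ 39 := by linarith
  rw [saturation_eq s hx, saturation_eq s (hlx.trans_lt hx)] at h3
  have hl0 : 0 ≤ |s| * (l / (1 - l)) :=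
    mul_nonneg (abs_nonneg s) (div_nonneg h0 (by linarith))
  have hyz : |s| * (l / (1 - l)) ≤ |s| * (x / (1 - x)) :=
    mul_le_mul_of_nonneg_left (div_one_sub_mono h0 hlx hx) (abs_nonneg s)
  rw [mul_sub] at hc1
  generalize |s| * (l / (1 - l)) = z at *
  generalize |s| * (x / (1 - x)) = y at *
  have h4 : y / (y + 1) - z / (z + 1) = (y - z) / ((y + 1) * (z + 1)) := by
    have : y + 1 ≠ 0 := by linarith
    have : z + 1 ≠ 0 := by linarith
    field_simp; ring
  rw [h4, div_le_iff₀ (mul_pos (by linarith) (by linarith))] at h3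
  set K : ℝ := 2 ^ 11 / δ with hK
  have hzK : z + 1 ≤ K := by
    have : 1 ≤ 2 ^ 10 / δ := by rw [le_div_iff₀ hδ]; linarith
    have : K = 2 ^ 10 / δ + 2 ^ 10 / δ := by rw [hK]; ring
    linarith
  have e1 : δ ^ 4 / 2 ^ 39 * K = δ ^ 3 / 2 ^ 28 := by rw [hK]; field_simp
  have e2 : δ ^ 3 / 2 ^ 28 * K = δ ^ 2 / 2 ^ 17 := by rw [hK]; field_simp
  have hyz' : 0 ≤ y - z := by linarith
  have h5 : y - z ≤ δ ^ 3 / 2 ^ 28 * (y + 1) := by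
    refine h3.trans ?_
    rw [← e1]
    have : 0 ≤ y + 1 := by linarith
    calc _ ≤ δ ^ 4 / 2 ^ 39 * ((y + 1) * K) := by gcongr
      _ = _ := by ring
  have h6 : δ ^ 3 / 2 ^ 28 * (z + 1) ≤ δ ^ 2 / 2 ^ 17 := by
    rw [← e2]; gcongr
  have h7 : δ ^ 3 / 2 ^ 28 ≤ 1 / 2 := by
    have : δ ^ 3 ≤ 1 := pow_le_one₀ hδ.le hδ1
    linarith
  have h8 : y - z ≤ δ ^ 3 / 2 ^ 28 * (z + 1) + 1 / 2 * (y - z) := by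
    have : δ ^ 3 / 2 ^ 28 * (y - z) ≤ 1 / 2 * (y - z) := mul_le_mul_of_nonneg_right h7 hyz'
    nlinarith
  have h9 : δ ^ 2 / 2 ^ 16 = 2 * (δ ^ 2 / 2 ^ 17) := by ring
  linarith

/-- Steps of length at least 1 are trivial. Otherwise (z + y)/2 ≤ y + 1/2 ≤ 1 + y²/2, and this
factor is absorbed by exp(−y²/2). -/
theorem exp_neg_sq_sub_le_of_le {y z : ℝ} (hyz : y ≤ z) :
    Real.exp (-y ^ 2 / 2) - Real.exp (-z ^ 2 / 2) ≤ z - y := by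
  rcases le_total 1 (z - y) with h | h
  · have h1 : Real.exp (-y ^ 2 / 2) ≤ 1 := Real.exp_le_one_iff.2 (by nlinarith)
    linarith [Real.exp_pos (-z ^ 2 / 2)]
  · have h1 : Real.exp (-z ^ 2 / 2) =
        Real.exp (-y ^ 2 / 2) * Real.exp (-((z - y) * (z + y) / 2)) := by
      rw [← Real.exp_add]; congr 1; ring
    have h2 := Real.add_one_le_exp (-((z - y) * (z + y) / 2))
    have h3 : Real.exp (-y ^ 2 / 2) * (1 + y ^ 2 / 2) ≤ 1 := by
      have h4 := Real.add_one_le_exp (y ^ 2 / 2)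
      have h5 : Real.exp (-y ^ 2 / 2) * Real.exp (y ^ 2 / 2) = 1 := by
        rw [← Real.exp_add]; simp [neg_div]
      rw [← h5]
      exact mul_le_mul_of_nonneg_left (by linarith) (Real.exp_pos _).le
    have h6 : (z + y) / 2 ≤ 1 + y ^ 2 / 2 := by nlinarith [sq_nonneg (y - 1)]
    have hp := Real.exp_pos (-y ^ 2 / 2)
    rw [h1]
    calc _ = Real.exp (-y ^ 2 / 2) * (1 - Real.exp (-((z - y) * (z + y) / 2))) := by ring
      _ ≤ Real.exp (-y ^ 2 / 2) * ((z - y) * (1 + y ^ 2 / 2)) := by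
          refine mul_le_mul_of_nonneg_left ?_ hp.le
          have := mul_le_mul_of_nonneg_left h6 (sub_nonneg.2 hyz)
          linarith
      _ = (z - y) * (Real.exp (-y ^ 2 / 2) * (1 + y ^ 2 / 2)) := by ring
      _ ≤ _ := mul_le_of_le_one_right (sub_nonneg.2 hyz) h3

theorem abs_exp_neg_sq_sub_le {s t τ η B : ℝ} (ht : 0 ≤ t) (htτ : t ≤ τ) (hB : 0 < B)
    (h : |s| * (τ - t) ≤ η ∨ B ≤ |s| * t) :
    |Real.exp (-(s * τ) ^ 2 / 2) - Real.exp (-(s * t) ^ 2 / 2)| ≤ max η (2 / B ^ 2) := by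
  have hsq : ∀ u : ℝ, (s * u) ^ 2 = (|s| * u) ^ 2 := fun u => by rw [mul_pow, mul_pow, sq_abs]
  rw [hsq, hsq]
  have h0 : 0 ≤ |s| * t := mul_nonneg (abs_nonneg _) ht
  have h1 : |s| * t ≤ |s| * τ := mul_le_mul_of_nonneg_left htτ (abs_nonneg _)
  have h2 : Real.exp (-(|s| * τ) ^ 2 / 2) ≤ Real.exp (-(|s| * t) ^ 2 / 2) :=
    Real.exp_le_exp.2 (by nlinarith)
  rw [abs_sub_comm, abs_of_nonneg (by linarith)]
  rcases h with h | h
  · refine le_max_of_le_left ((exp_neg_sq_sub_le_of_le h1).trans ?_)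
    linarith
  · refine le_max_of_le_right ?_
    have h3 : Real.exp (-(|s| * t) ^ 2 / 2) ≤ Real.exp (-(B ^ 2 / 2)) :=
      Real.exp_le_exp.2 (by nlinarith)
    have h4 : Real.exp (-(B ^ 2 / 2)) ≤ 2 / B ^ 2 := by
      have h5 := Real.add_one_le_exp (B ^ 2 / 2)
      rw [Real.exp_neg, ← one_div, one_div_le (Real.exp_pos _) (by positivity), one_div_div]
      linarith
    linarith [Real.exp_pos (-(|s| * τ) ^ 2 / 2)]

/-- The offsets whose saturation moves much between the two ends of a grid cell. -/
def unstableOffsets (δ : ℝ) (g : ℝ × ℝ) : Set ℝ :=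
  {s | δ ^ 4 / 2 ^ 39 < saturation s g.2 - saturation s g.1}

theorem measurableSet_unstableOffsets (δ : ℝ) (g : ℝ × ℝ) :
    MeasurableSet (unstableOffsets δ g) :=
  measurableSet_lt measurable_const ((measurable_saturation _).sub (measurable_saturation _))

section

variable {Ω : Type*} [MeasurableSpace Ω] {μ : Measure Ω} [IsProbabilityMeasure μ] {m : ℕ}
  {s : Fin m → Ω → ℝ}

/-- The sum of the expected saturations is continuous on [0, 1] and rises by at most m. In a cell
where it rises little, Markov's inequality leaves few offsets, on average, whose own saturation
rises much. The coordinate x compactifies τ = x/(1 − x). -/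
theorem exists_offset_grid (hs : ∀ i, Measurable (s i)) (hm : 1 ≤ m) {δ : ℝ} (hδ : 0 < δ)
    (hδ1 : δ ≤ 1) :
    ∃ G : Finset (ℝ × ℝ), (G.card : ℝ) ≤ 2 ^ 56 / δ ^ 6 ∧
      (∀ g ∈ G, 0 ≤ g.1 ∧ g.1 ≤ g.2 ∧ g.2 ≤ 1 ∧
        ∑ i, μ.real (s i ⁻¹' unstableOffsets δ g) ≤ δ ^ 2 / 2 ^ 15 * m) ∧
      ∀ x ∈ Set.Icc (0 : ℝ) 1, ∃ g ∈ G, g.1 ≤ x ∧ x ≤ g.2 := by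
  let H : ℝ → ℝ := fun x => ∑ i, ∫ ω, saturation (s i ω) x ∂μ
  have hmeas : ∀ i x, Measurable fun ω => saturation (s i ω) x :=
    fun i x => (measurable_saturation x).comp (hs i)
  have hbd : ∀ i, ∀ x ∈ Set.Icc (0 : ℝ) 1, ∀ ω, ‖saturation (s i ω) x‖ ≤ 1 := by
    intro i x hx ω
    have := saturation_mem_Icc (s i ω) hx.1 hx.2
    rw [Real.norm_of_nonneg this.1]; exact this.2
  have hint : ∀ i, ∀ x ∈ Set.Icc (0 : ℝ) 1, Integrable (fun ω => saturation (s i ω) x) μ :=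
    fun i x hx => (integrable_const (1 : ℝ)).mono' (hmeas i x).aestronglyMeasurable
      (Filter.Eventually.of_forall (hbd i x hx))
  have hcont : ContinuousOn H (Set.Icc 0 1) := by
    refine continuousOn_finsetSum _ fun i _ => ?_
    refine continuousOn_of_dominated (bound := fun _ => 1)
      (fun x _ => (hmeas i x).aestronglyMeasurable)
      (fun x hx => Filter.Eventually.of_forall (hbd i x hx)) (integrable_const _)
      (Filter.Eventually.of_forall fun ω => continuousOn_saturation _)
  have hH : H 1 - H 0 ≤ m := by
    have h0 : 0 ≤ H 0 := Finset.sum_nonneg fun i _ => integral_nonneg fun ω =>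
      (saturation_mem_Icc (s i ω) le_rfl zero_le_one).1
    have h1 : H 1 ≤ ∑ _i : Fin m, (1 : ℝ) := Finset.sum_le_sum fun i _ => by
      refine (integral_mono (hint i 1 (by simp)) (integrable_const (1 : ℝ)) fun ω =>
        (saturation_mem_Icc (s i ω) zero_le_one le_rfl).2).trans ?_
      simp
    simp at h1
    linarith
  have hm0 : (0 : ℝ) < m := by exact_mod_cast hm
  -- Product of the instability threshold δ⁴/2³⁹ and the tolerated mean count δ²m/2¹⁵, as Markov's
  -- inequality requires.
  set Δ : ℝ := m * (δ ^ 6 / 2 ^ 54) with hΔ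
  have hn := Nat.le_ceil (2 ^ 54 / δ ^ 6 : ℝ)
  obtain ⟨G, hG1, hG2, hG3⟩ := exists_grid_of_continuousOn (f := H) (b := 1) (Δ := Δ)
    (by positivity) ⌈(2 ^ 54 / δ ^ 6 : ℝ)⌉₊ 0 zero_le_one hcont (by
      refine hH.trans ?_
      calc (m : ℝ) = 2 ^ 54 / δ ^ 6 * Δ := by rw [hΔ]; field_simp
        _ ≤ _ := by gcongr)
  refine ⟨G, ?_, ?_, hG3⟩
  · have h1 : (1 : ℝ) ≤ 2 ^ 54 / δ ^ 6 := by
      rw [le_div_iff₀ (by positivity)]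
      have : δ ^ 6 ≤ 1 := pow_le_one₀ hδ.le hδ1
      linarith
    have h2 := (Nat.ceil_lt_add_one (by positivity : (0 : ℝ) ≤ 2 ^ 54 / δ ^ 6)).le
    have h3 : (G.card : ℝ) ≤ ⌈(2 ^ 54 / δ ^ 6 : ℝ)⌉₊ + 1 := by exact_mod_cast hG1
    have h4 : (2 : ℝ) ^ 56 / δ ^ 6 = 4 * (2 ^ 54 / δ ^ 6) := by ring
    linarith
  · intro g hg
    obtain ⟨h1, h2, h3, h4⟩ := hG2 g hg
    refine ⟨h1, h2, h3, ?_⟩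
    have hg1 : g.1 ∈ Set.Icc (0 : ℝ) 1 := ⟨h1, h2.trans h3⟩
    have hg2 : g.2 ∈ Set.Icc (0 : ℝ) 1 := ⟨h1.trans h2, h3⟩
    have hmarkov : ∀ i, δ ^ 4 / 2 ^ 39 * μ.real (s i ⁻¹' unstableOffsets δ g) ≤
        ∫ ω, saturation (s i ω) g.2 ∂μ - ∫ ω, saturation (s i ω) g.1 ∂μ := by
      intro i
      rw [← integral_sub (hint i _ hg2) (hint i _ hg1)]
      refine le_trans ?_ (mul_meas_ge_le_integral_of_nonneg (Filter.Eventually.of_forall fun ω =>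
        sub_nonneg.2 (saturation_mono (s i ω) h1 h2 h3))
        ((hint i _ hg2).sub (hint i _ hg1)) (δ ^ 4 / 2 ^ 39))
      refine mul_le_mul_of_nonneg_left (measureReal_mono ?_) (by positivity)
      intro ω hω
      simp only [Set.mem_preimage, unstableOffsets, Set.mem_ofPred_eq] at hω
      exact hω.le
    have hsum := Finset.sum_le_sum fun i (_ : i ∈ Finset.univ) => hmarkov i
    rw [← Finset.mul_sum, Finset.sum_sub_distrib] at hsum
    have h5 : δ ^ 4 / 2 ^ 39 * ∑ i, μ.real (s i ⁻¹' unstableOffsets δ g) ≤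
        δ ^ 4 / 2 ^ 39 * (δ ^ 2 / 2 ^ 15 * m) := by
      refine (hsum.trans h4).trans (le_of_eq ?_)
      rw [hΔ]; ring
    exact le_of_mul_le_mul_left h5 (by positivity)

/-- A stable offset changes the Gaussian profile by at most δ²/2¹⁶ (the large-offset alternative
gives δ²/2¹⁹), an unstable one by at most 1, and unstable ones are rare in the mean. -/
theorem sum_abs_expMean_sub_le (hs : ∀ i, Measurable (s i)) {δ : ℝ} (hδ : 0 < δ)
    (hδ1 : δ ≤ 1) {g : ℝ × ℝ} {x : ℝ} (h0 : 0 ≤ g.1) (h1 : g.1 ≤ x) (h2 : x ≤ g.2) (h3 : g.2 ≤ 1)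
    (hx : x < 1) (hg : ∑ i, μ.real (s i ⁻¹' unstableOffsets δ g) ≤ δ ^ 2 / 2 ^ 15 * m) :
    ∑ i, |∫ ω, Real.exp (-(s i ω * (x / (1 - x))) ^ 2 / 2) ∂μ -
      ∫ ω, Real.exp (-(s i ω * (g.1 / (1 - g.1))) ^ 2 / 2) ∂μ| ≤ δ / 64 * m := by
  have hint : ∀ i (t : ℝ), Integrable (fun ω => Real.exp (-(s i ω * t) ^ 2 / 2)) μ := by
    intro i t
    have := hs i
    refine (integrable_const (1 : ℝ)).mono' (by fun_prop) (Filter.Eventually.of_forall fun ω => ?_)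
    rw [Real.norm_of_nonneg (Real.exp_pos _).le]
    exact Real.exp_le_one_iff.2 (by nlinarith [sq_nonneg (s i ω * t)])
  have ht0 : 0 ≤ g.1 / (1 - g.1) := div_nonneg h0 (by linarith)
  have htτ := div_one_sub_mono h0 h1 hx
  have hpt : ∀ i ω, |Real.exp (-(s i ω * (x / (1 - x))) ^ 2 / 2) -
      Real.exp (-(s i ω * (g.1 / (1 - g.1))) ^ 2 / 2)| ≤
      δ ^ 2 / 2 ^ 16 + (s i ⁻¹' unstableOffsets δ g).indicator (fun _ => (1 : ℝ)) ω := by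
    intro i ω
    by_cases hω : ω ∈ s i ⁻¹' unstableOffsets δ g
    · rw [Set.indicator_of_mem hω]
      have e : ∀ u : ℝ, Real.exp (-(s i ω * u) ^ 2 / 2) ≤ 1 := fun u =>
        Real.exp_le_one_iff.2 (by nlinarith [sq_nonneg (s i ω * u)])
      have : 0 ≤ δ ^ 2 / 2 ^ 16 := by positivity
      rw [abs_le]
      constructor <;> linarith [e (x / (1 - x)), e (g.1 / (1 - g.1)),
        Real.exp_pos (-(s i ω * (x / (1 - x))) ^ 2 / 2),
        Real.exp_pos (-(s i ω * (g.1 / (1 - g.1))) ^ 2 / 2)]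
    · rw [Set.indicator_of_notMem hω, add_zero]
      have hcl := close_or_large_of_saturation hδ hδ1 h0 h1 h2 h3 hx (not_lt.1 hω)
      refine (abs_exp_neg_sq_sub_le ht0 htτ (by positivity) hcl).trans (max_le le_rfl ?_)
      rw [div_pow, div_div_eq_mul_div, div_le_div_iff₀ (by positivity) (by positivity)]
      nlinarith [sq_nonneg δ]
  have hi : ∀ i, |∫ ω, Real.exp (-(s i ω * (x / (1 - x))) ^ 2 / 2) ∂μ -
      ∫ ω, Real.exp (-(s i ω * (g.1 / (1 - g.1))) ^ 2 / 2) ∂μ| ≤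
      δ ^ 2 / 2 ^ 16 + μ.real (s i ⁻¹' unstableOffsets δ g) := by
    intro i
    have hms := hs i (measurableSet_unstableOffsets δ g)
    have hind : Integrable ((s i ⁻¹' unstableOffsets δ g).indicator (fun _ => (1 : ℝ))) μ :=
      (integrable_const 1).indicator hms
    rw [← integral_sub (hint i _) (hint i _)]
    refine abs_integral_le_integral_abs.trans ((integral_mono ((hint i _).sub (hint i _)).abs
      ((integrable_const _).add hind) (hpt i)).trans (le_of_eq ?_))
    rw [integral_add' (integrable_const _) hind, integral_indicator hms]
    simp
  have hsum := Finset.sum_le_sum fun i (_ : i ∈ Finset.univ) => hi i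
  rw [Finset.sum_add_distrib] at hsum
  simp only [Finset.sum_const, Finset.card_univ, Fintype.card_fin, nsmul_eq_mul] at hsum
  refine (hsum.trans (add_le_add_right hg _)).trans ?_
  have hd : δ ^ 2 ≤ δ := by nlinarith
  have hm0 : (0 : ℝ) ≤ m := Nat.cast_nonneg m
  have := mul_le_mul_of_nonneg_right hd hm0
  nlinarith [mul_nonneg hδ.le hm0]

end

/-! ### Uniform concentration of the subgradient over low-rank matrices -/

theorem matInner_sum_left {d : ℕ} {ι : Type*} (I : Finset ι)
    (M : ι → Matrix (Fin d) (Fin d) ℝ) (Z : Matrix (Fin d) (Fin d) ℝ) :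
    matInner (∑ i ∈ I, M i) Z = ∑ i ∈ I, matInner (M i) Z := by
  simp [matInner, Matrix.transpose_sum, Finset.sum_mul, Matrix.trace_sum]

theorem matInner_sub_left {d : ℕ} (A B Z : Matrix (Fin d) (Fin d) ℝ) :
    matInner (A - B) Z = matInner A Z - matInner B Z := by
  rw [matInner_comm, matInner_sub_right, matInner_comm Z, matInner_comm Z]

theorem matInner_smul_left {d : ℕ} (c : ℝ) (A Z : Matrix (Fin d) (Fin d) ℝ) :
    matInner (c • A) Z = c * matInner A Z := by
  rw [matInner_comm, matInner_smul_right, matInner_comm Z]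

/-- The symmetric matrices of rank at most `k` and Frobenius norm one. -/
def lowRankSphere (d k : ℕ) : Set (Matrix (Fin d) (Fin d) ℝ) :=
  {X | X.IsSymm ∧ X.rank ≤ k ∧ frobNorm X = 1}

theorem lowRankSphere_subset (d k : ℕ) : lowRankSphere d k ⊆ lowRankBall d k :=
  fun _ hX => mem_lowRankBall hX.2.1 hX.2.2.le

theorem inv_frobNorm_smul_mem_lowRankSphere {d k : ℕ} {X : Matrix (Fin d) (Fin d) ℝ}
    (hX : X.IsSymm) (h0 : X ≠ 0) (hr : X.rank ≤ k) :
    (frobNorm X)⁻¹ • X ∈ lowRankSphere d k := by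
  have hp := frobNorm_pos h0
  refine ⟨hX.smul _, ?_, ?_⟩
  · have e : (frobNorm X)⁻¹ • X = ((frobNorm X)⁻¹ • (1 : Matrix (Fin d) (Fin d) ℝ)) * X := by
      rw [Matrix.smul_mul, one_mul]
    rw [e]
    exact (Matrix.rank_mul_le_right _ _).trans hr
  · rw [frobNorm_smul, abs_of_pos (inv_pos.2 hp), inv_mul_cancel₀ hp.ne']

theorem sqrt_two_div_pi_le_one : Real.sqrt (2 / Real.pi) ≤ 1 := by
  rw [← Real.sqrt_one]
  refine Real.sqrt_le_sqrt ?_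
  rw [div_le_one Real.pi_pos]
  linarith [Real.pi_gt_three]

open Classical in
/-- Deterministic core: closeness at a net point and a grid point gives closeness at `Y`, `τ`. -/
theorem sum_sgn_sub_mean_le {d m k : ℕ} {a : Fin m → Matrix (Fin d) (Fin d) ℝ} {s : Fin m → ℝ}
    {F F' : Fin m → ℝ} {Y Y' Z : Matrix (Fin d) (Fin d) ℝ} {I : Finset (Fin m)} {t τ δ : ℝ}
    (hδ : 0 < δ) (hδ1 : δ ≤ 1) (htτ : t ≤ τ)
    (hrip : ∀ Z ∈ lowRankBall d k, ‖sens a Z‖ ≤ 4 * Real.sqrt m)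
    (hY : Y ∈ lowRankBall d k) (hY' : Y' ∈ lowRankBall d k) (hZ : Z ∈ lowRankBall d k)
    (hYY' : ∃ D₁ ∈ lowRankBall d k, ∃ D₂ ∈ lowRankBall d k,
        ∃ D₃ ∈ lowRankBall d k, ∃ D₄ ∈ lowRankBall d k,
          Y - Y' = (δ ^ 3 / 2 ^ 27) • (D₁ + D₂ + D₃ + D₄))
    (hbad : ((Finset.univ.filter fun i =>
      ¬ (|s i| * (τ - t) ≤ δ ^ 2 / 2 ^ 16 ∨ 2 ^ 10 / δ ≤ |s i| * t)).card : ℝ) ≤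
      δ ^ 2 * m / 2 ^ 14)
    (hnear : ((Finset.univ.filter fun i =>
      |matInner (a i) Y' - s i * t| ≤ 2 * (δ ^ 2 / 2 ^ 16)).card : ℝ) ≤
      3 * (δ ^ 2 / 2 ^ 16) * m)
    (hF0 : ∀ i, 0 ≤ F i) (hF1 : ∀ i, F i ≤ 1)
    (hFF' : ∑ i, |F i - F' i| ≤ δ / 64 * m)
    (hconc : ∑ i ∈ I, (sgn (matInner (a i) Y' - s i * t) * matInner (a i) Z -
      Real.sqrt (2 / Real.pi) * F' i * matInner Y' Z) ≤ δ / 8 * m) :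
    ∑ i ∈ I, (sgn (matInner (a i) Y - s i * τ) * matInner (a i) Z -
      Real.sqrt (2 / Real.pi) * F i * matInner Y Z) ≤ δ / 2 * m := by
  obtain ⟨D₁, h₁, D₂, h₂, D₃, h₃, D₄, h₄, hD⟩ := hYY'
  have hstab := sign_stability a s Y Y' Z I hδ htτ
    ((norm_sens_diff_le (by positivity) hrip h₁ h₂ h₃ h₄ hD).trans (le_of_eq (by ring)))
    (hrip _ hY) (hrip _ hY') (hrip _ hZ) hbad hnear
  set κ := Real.sqrt (2 / Real.pi) with hκ
  have hκ0 : 0 ≤ κ := Real.sqrt_nonneg _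
  have hκ1 : κ ≤ 1 := sqrt_two_div_pi_le_one
  have hin : ∀ W ∈ lowRankBall d k, |matInner W Z| ≤ 1 := fun W hW =>
    (abs_matInner_le _ _).trans (mul_le_one₀ (frobNorm_le_one_of_mem_lowRankBall hW)
      (frobNorm_nonneg _) (frobNorm_le_one_of_mem_lowRankBall hZ))
  have hdiff : |matInner Y Z - matInner Y' Z| ≤ δ / 64 := by
    have hsplit : matInner (D₁ + D₂ + D₃ + D₄) Z =
        matInner D₁ Z + matInner D₂ Z + matInner D₃ Z + matInner D₄ Z := by
      rw [matInner_comm, matInner_add_right, matInner_add_right, matInner_add_right]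
      simp only [matInner_comm Z]
    rw [← matInner_sub_left, hD, matInner_smul_left, abs_mul,
      abs_of_nonneg (by positivity : (0 : ℝ) ≤ δ ^ 3 / 2 ^ 27), hsplit]
    have h4 : |matInner D₁ Z + matInner D₂ Z + matInner D₃ Z + matInner D₄ Z| ≤ 4 := by
      have e1 := abs_le.1 (hin _ h₁)
      have e2 := abs_le.1 (hin _ h₂)
      have e3 := abs_le.1 (hin _ h₃)
      have e4 := abs_le.1 (hin _ h₄)
      rw [abs_le]; constructor <;> linarith [e1.1, e1.2, e2.1, e2.2, e3.1, e3.2, e4.1, e4.2]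
    have h5 : δ ^ 3 ≤ δ := by
      have : δ ^ 2 ≤ 1 := pow_le_one₀ hδ.le hδ1
      nlinarith
    calc _ ≤ δ ^ 3 / 2 ^ 27 * 4 := by gcongr
      _ ≤ _ := by linarith
  have hm0 : (0 : ℝ) ≤ m := Nat.cast_nonneg m
  have hA : ∑ i ∈ I, (κ * (F' i - F i) * matInner Y' Z) ≤ δ / 64 * m := by
    refine le_trans ?_ hFF'
    refine (Finset.sum_le_sum fun i _ => ?_).trans (Finset.sum_le_sum_of_subset_of_nonneg
      (Finset.subset_univ I) fun _ _ _ => abs_nonneg _)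
    refine (le_abs_self _).trans ?_
    rw [abs_mul, abs_mul, abs_of_nonneg hκ0, abs_sub_comm]
    calc _ ≤ 1 * |F i - F' i| * 1 := by
          gcongr
          exact hin _ hY'
      _ = _ := by ring
  have hB : ∑ i ∈ I, (κ * F i * (matInner Y' Z - matInner Y Z)) ≤ δ / 64 * m := by
    calc _ ≤ ∑ _i : Fin m, δ / 64 := by
          refine (Finset.sum_le_sum fun i _ => ?_).trans (Finset.sum_le_sum_of_subset_of_nonneg
            (Finset.subset_univ I) fun _ _ _ => by positivity)
          refine (le_abs_self _).trans ?_
          rw [abs_mul, abs_of_nonneg (mul_nonneg hκ0 (hF0 i)), abs_sub_comm]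
          exact (mul_le_of_le_one_left (abs_nonneg _)
            (mul_le_one₀ hκ1 (hF0 i) (hF1 i))).trans hdiff
      _ = _ := by simp [mul_comm]
  -- Four errors: flipped signs, concentration at the net point, change of the profile, change of
  -- direction. Divided by m they are at most δ/8, δ/8, δ/64 and δ/64.
  have hsplit : ∑ i ∈ I, (sgn (matInner (a i) Y - s i * τ) * matInner (a i) Z -
      κ * F i * matInner Y Z) =
      (∑ i ∈ I, (sgn (matInner (a i) Y - s i * τ) - sgn (matInner (a i) Y' - s i * t)) *
        matInner (a i) Z) +
      (∑ i ∈ I, (sgn (matInner (a i) Y' - s i * t) * matInner (a i) Z -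
        κ * F' i * matInner Y' Z)) +
      (∑ i ∈ I, (κ * (F' i - F i) * matInner Y' Z)) +
      (∑ i ∈ I, (κ * F i * (matInner Y' Z - matInner Y Z))) := by
    simp only [← Finset.sum_add_distrib]
    exact Finset.sum_congr rfl fun i _ => by ring
  rw [hsplit]
  have := (abs_le.1 hstab).2
  nlinarith [mul_nonneg hδ.le hm0]

theorem measurable_sens {d m : ℕ} (Z : Matrix (Fin d) (Fin d) ℝ) :
    Measurable fun q : Fin m → Matrix (Fin d) (Fin d) ℝ × ℝ => ‖sens (fun i => (q i).1) Z‖ := by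
  have : (fun q : Fin m → Matrix (Fin d) (Fin d) ℝ × ℝ => ‖sens (fun i => (q i).1) Z‖) =
      fun q => Real.sqrt (∑ i, matInner (q i).1 Z ^ 2) := by
    ext q
    rw [← norm_sens_sq (fun i => (q i).1), Real.sqrt_sq (norm_nonneg _)]
  rw [this]
  refine (Finset.measurable_sum _ fun i _ => ?_).sqrt
  exact ((measurable_matInner_right Z).comp
    (measurable_fst.comp (measurable_pi_apply i))).pow_const 2

theorem measurable_card_filter {m : ℕ} {𝒳 : Type*} [MeasurableSpace 𝒳] {P : 𝒳 → Prop}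
    [DecidablePred P] (hP : MeasurableSet {x | P x}) :
    Measurable fun q : Fin m → 𝒳 => ((Finset.univ.filter fun i => P (q i)).card : ℝ) := by
  have : (fun q : Fin m → 𝒳 => ((Finset.univ.filter fun i => P (q i)).card : ℝ)) =
      fun q => ∑ i, {x | P x}.indicator (fun _ => (1 : ℝ)) (q i) := by
    ext q
    simp [Set.indicator_apply]
  rw [this]
  exact Finset.measurable_sum _ fun i _ =>
    (measurable_const.indicator hP).comp (measurable_pi_apply i)

/-! ### Union bound and its exponents -/

theorem measureReal_biUnion_le_card_mul {α ι : Type*} [MeasurableSpace α] {ν : Measure α}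
    (S : Finset ι) (B : ι → Set α) {b : ℝ}
    (h : ∀ x ∈ S, ν.real (B x) ≤ b) : ν.real (⋃ x ∈ S, B x) ≤ S.card * b := by
  refine (measureReal_biUnion_finset_le S B).trans ?_
  rw [← nsmul_eq_mul]
  exact Finset.sum_le_card_nsmul _ _ _ h

/-- The slowest tail is the second one, from counting near-ties at resolution δ²/2¹⁶: its exponent
is exactly y/2³¹ and accounts for δ⁴ in the sample size. Half of it pays for the cardinalities,
since y/2³² ≥ 256Λ ≥ 2 + 134Λ. -/
theorem exp_mul_sum_le {Λ y m δ p₁ p₂ p₃ p₄ : ℝ} (hΛ1 : 1 ≤ Λ) (hδ : 0 < δ) (hδ1 : δ ≤ 1)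
    (hm0 : 0 ≤ m) (hy : y = m * δ ^ 4) (hyΛ : 2 ^ 40 * Λ ≤ y)
    (h₁ : p₁ ≤ Real.exp (134 * Λ)) (h₂ : p₂ ≤ Real.exp (134 * Λ))
    (h₃ : p₃ ≤ Real.exp (134 * Λ)) (h₄ : p₄ ≤ Real.exp (134 * Λ)) :
    p₁ * Real.exp (-(m / 2)) + p₂ * Real.exp (-(2 * (δ ^ 2 / 2 ^ 16) ^ 2 * m)) +
      p₃ * Real.exp (-((δ / 8) ^ 2 / 40 * m)) +
      p₄ * Real.exp (-(2 * (δ ^ 2 / 2 ^ 15) ^ 2 * m)) ≤ Real.exp (-(y / 2 ^ 32)) := by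
  have hδ2 : δ ^ 4 ≤ δ ^ 2 := pow_le_pow_of_le_one hδ.le hδ1 (by norm_num)
  have hδ4 : δ ^ 4 ≤ 1 := pow_le_one₀ hδ.le hδ1
  have hy1 : y ≤ m := by rw [hy]; exact mul_le_of_le_one_right hm0 hδ4
  have hy2 : y ≤ m * δ ^ 2 := by rw [hy]; exact mul_le_mul_of_nonneg_left hδ2 hm0
  have hterm : ∀ p e : ℝ, p ≤ Real.exp (134 * Λ) → y / 2 ^ 31 ≤ e →
      p * Real.exp (-e) ≤ Real.exp (134 * Λ - y / 2 ^ 31) := by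
    intro p e hp he
    calc _ ≤ Real.exp (134 * Λ) * Real.exp (-e) :=
          mul_le_mul_of_nonneg_right hp (Real.exp_pos _).le
      _ = Real.exp (134 * Λ + -e) := (Real.exp_add _ _).symm
      _ ≤ _ := Real.exp_le_exp.2 (by linarith)
  have hy0 : 0 ≤ y := by rw [hy]; positivity
  have e3 : (δ / 8) ^ 2 / 40 * m = m * δ ^ 2 / 2560 := by ring
  have e4 : 2 * (δ ^ 2 / 2 ^ 15) ^ 2 * m = y / 2 ^ 29 := by rw [hy]; ring
  have e2 : 2 * (δ ^ 2 / 2 ^ 16) ^ 2 * m = y / 2 ^ 31 := by rw [hy]; ring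
  have t1 := hterm p₁ (m / 2) h₁ (by linarith)
  have t2 := hterm p₂ _ h₂ e2.ge
  have t3 := hterm p₃ ((δ / 8) ^ 2 / 40 * m) h₃ (by rw [e3]; linarith)
  have t4 := hterm p₄ (2 * (δ ^ 2 / 2 ^ 15) ^ 2 * m) h₄ (by rw [e4]; linarith)
  have hsum : 4 * Real.exp (134 * Λ - y / 2 ^ 31) ≤ Real.exp (-(y / 2 ^ 32)) := by
    have h4 : (4 : ℝ) ≤ Real.exp 2 := by
      have h2 := Real.add_one_le_exp (1 : ℝ)
      have : Real.exp 2 = Real.exp 1 * Real.exp 1 := by rw [← Real.exp_add]; norm_num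
      rw [this]; nlinarith
    calc _ ≤ Real.exp 2 * Real.exp (134 * Λ - y / 2 ^ 31) :=
          mul_le_mul_of_nonneg_right h4 (Real.exp_pos _).le
      _ = Real.exp (2 + (134 * Λ - y / 2 ^ 31)) := (Real.exp_add _ _).symm
      _ ≤ _ := Real.exp_le_exp.2 (by linarith)
  linarith

/-- The logarithm of every net or grid size is a constant multiple of Λ = dk·max(log(1/δ), 1). The
largest combination, net times grid times pairs of test vectors, costs 64 + 62 + 8 = 134. -/
theorem union_bound_exponent {d k m : ℕ} {δ : ℝ} (hd : 1 ≤ d) (hk : 1 ≤ k) (hδ : 0 < δ)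
    (hδ1 : δ ≤ 1)
    (hm : 2 ^ 40 * ((d : ℝ) * k * max (Real.log (1 / δ)) 1 / δ ^ 4) ≤ m)
    {n₀ n g v : ℝ} (hg : 0 ≤ g) (hv0 : 0 ≤ v)
    (hn₀' : n₀ ≤ (3 / (1 / 8)) ^ (2 * (d * k)))
    (hn' : n ≤ (3 / (δ ^ 3 / 2 ^ 27)) ^ (2 * (d * k))) (hg' : g ≤ 2 ^ 56 / δ ^ 6)
    (hv : v ≤ (3 / (1 / 4)) ^ d) :
    n₀ * Real.exp (-(m / 2)) + n * g * Real.exp (-(2 * (δ ^ 2 / 2 ^ 16) ^ 2 * m)) +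
      n * g * (v * v) * Real.exp (-((δ / 8) ^ 2 / 40 * m)) +
      g * Real.exp (-(2 * (δ ^ 2 / 2 ^ 15) ^ 2 * m)) ≤ Real.exp (-(m * δ ^ 4 / 2 ^ 32)) := by
  set L := max (Real.log (1 / δ)) 1 with hL
  have hL1 : 1 ≤ L := le_max_right _ _
  have hδL : 1 / δ ≤ Real.exp L := by
    rw [← Real.exp_log (by positivity : (0 : ℝ) < 1 / δ)]
    exact Real.exp_le_exp.2 (le_max_left _ _)
  have hd' : (1 : ℝ) ≤ d := by exact_mod_cast hd
  have hk' : (1 : ℝ) ≤ k := by exact_mod_cast hk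
  have hdk : (1 : ℝ) ≤ d * k := one_le_mul_of_one_le_of_one_le hd' hk'
  set Λ : ℝ := d * k * L with hΛ
  have hΛL : L ≤ Λ := by rw [hΛ]; exact le_mul_of_one_le_left (by linarith) hdk
  have hΛd : (d : ℝ) ≤ Λ := by
    rw [hΛ, mul_assoc]
    exact le_mul_of_one_le_right (by linarith) (one_le_mul_of_one_le_of_one_le hk' hL1)
  have hΛdk : (d : ℝ) * k ≤ Λ := le_mul_of_one_le_right (by linarith) hL1
  have hΛ1 : 1 ≤ Λ := hL1.trans hΛL
  set y : ℝ := m * δ ^ 4 with hy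
  have hyΛ : 2 ^ 40 * Λ ≤ y := by
    rw [← mul_div_assoc, div_le_iff₀ (by positivity)] at hm
    exact hm
  have h2 : (2 : ℝ) ≤ Real.exp 1 := by linarith [Real.add_one_le_exp (1 : ℝ)]
  have hpow2 : ∀ j : ℕ, (2 : ℝ) ^ j ≤ Real.exp j := fun j => by
    rw [← Real.exp_one_pow]; exact pow_le_pow_left₀ zero_le_two h2 j
  have hpowδ : ∀ j : ℕ, (1 / δ) ^ j ≤ Real.exp (j * L) := fun j => by
    rw [Real.exp_nat_mul]; exact pow_le_pow_left₀ (by positivity) hδL j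
  have hN₀ : n₀ ≤ Real.exp (134 * Λ) := by
    refine hn₀'.trans ?_
    have h24 : (3 / (1 / 8) : ℝ) ≤ Real.exp 5 := by
      have := hpow2 5; norm_num at this ⊢; linarith
    calc _ ≤ Real.exp 5 ^ (2 * (d * k)) := pow_le_pow_left₀ (by norm_num) h24 _
      _ = Real.exp (10 * (d * k)) := by rw [← Real.exp_nat_mul]; push_cast; ring_nf
      _ ≤ _ := Real.exp_le_exp.2 (by linarith)
  have hN : n ≤ Real.exp (64 * Λ) := by
    refine hn'.trans ?_
    have h3 : 3 / (δ ^ 3 / 2 ^ 27) ≤ Real.exp (32 * L) := by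
      calc 3 / (δ ^ 3 / 2 ^ 27) ≤ 2 ^ 29 * (1 / δ) ^ 3 := by
            rw [div_div_eq_mul_div, one_div, inv_pow, ← div_eq_mul_inv]
            gcongr; norm_num
        _ ≤ Real.exp (29 : ℕ) * Real.exp ((3 : ℕ) * L) :=
            mul_le_mul (hpow2 29) (hpowδ 3) (by positivity) (Real.exp_pos _).le
        _ = Real.exp (29 + 3 * L) := by rw [← Real.exp_add]; push_cast; rfl
        _ ≤ _ := Real.exp_le_exp.2 (by linarith)
    calc _ ≤ Real.exp (32 * L) ^ (2 * (d * k)) := pow_le_pow_left₀ (by positivity) h3 _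
      _ = Real.exp (64 * Λ) := by rw [← Real.exp_nat_mul, hΛ]; push_cast; ring_nf
  have hG : g ≤ Real.exp (62 * Λ) := by
    refine hg'.trans ?_
    calc 2 ^ 56 / δ ^ 6 = 2 ^ 56 * (1 / δ) ^ 6 := by
          rw [one_div, inv_pow, ← div_eq_mul_inv]
      _ ≤ Real.exp (56 : ℕ) * Real.exp ((6 : ℕ) * L) :=
          mul_le_mul (hpow2 56) (hpowδ 6) (by positivity) (Real.exp_pos _).le
      _ = Real.exp (56 + 6 * L) := by rw [← Real.exp_add]; push_cast; rfl
      _ ≤ _ := Real.exp_le_exp.2 (by linarith)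
  have hV : v ≤ Real.exp (4 * Λ) := by
    refine hv.trans ?_
    have h12 : (3 / (1 / 4) : ℝ) ≤ Real.exp 4 := by
      have := hpow2 4; norm_num at this ⊢; linarith
    calc _ ≤ Real.exp 4 ^ d := pow_le_pow_left₀ (by norm_num) h12 _
      _ = Real.exp (4 * d) := by rw [← Real.exp_nat_mul]; ring_nf
      _ ≤ _ := Real.exp_le_exp.2 (by linarith)
  have hNG : n * g ≤ Real.exp (126 * Λ) := by
    calc n * g ≤ Real.exp (64 * Λ) * Real.exp (62 * Λ) :=
          mul_le_mul hN hG hg (Real.exp_pos _).le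
      _ = _ := by rw [← Real.exp_add]; ring_nf
  have hVV : v * v ≤ Real.exp (8 * Λ) := by
    calc v * v ≤ Real.exp (4 * Λ) * Real.exp (4 * Λ) :=
          mul_le_mul hV hV hv0 (Real.exp_pos _).le
      _ = _ := by rw [← Real.exp_add]; ring_nf
  have hNGV : n * g * (v * v) ≤ Real.exp (134 * Λ) := by
    calc _ ≤ Real.exp (126 * Λ) * Real.exp (8 * Λ) :=
          mul_le_mul hNG hVV (by positivity) (Real.exp_pos _).le
      _ = _ := by rw [← Real.exp_add]; ring_nf
  have hmono : ∀ c : ℝ, c ≤ 134 → Real.exp (c * Λ) ≤ Real.exp (134 * Λ) := fun c hc =>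
    Real.exp_le_exp.2 (mul_le_mul_of_nonneg_right hc (by linarith))
  exact exp_mul_sum_le hΛ1 hδ hδ1 (Nat.cast_nonneg m) rfl hyΛ hN₀
    (hNG.trans (hmono _ (by norm_num))) hNGV (hG.trans (hmono _ (by norm_num)))

/-- Some low-rank direction `Z` is stretched too much by the sensing map. -/
def stretchEvent {d m : ℕ} (Z : Matrix (Fin d) (Fin d) ℝ) :
    Set (Fin m → Matrix (Fin d) (Fin d) ℝ × ℝ) :=
  {q | 2 * Real.sqrt m ≤ ‖sens (fun i => (q i).1) Z‖}

theorem measurableSet_stretchEvent {d m : ℕ} (Z : Matrix (Fin d) (Fin d) ℝ) :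
    MeasurableSet (stretchEvent (m := m) Z) :=
  measurableSet_le measurable_const (measurable_sens Z)

open Classical in
/-- Too many measurements of `X` are close to the scaled offsets. -/
def nearEvent {d m : ℕ} (η t : ℝ) (X : Matrix (Fin d) (Fin d) ℝ) :
    Set (Fin m → Matrix (Fin d) (Fin d) ℝ × ℝ) :=
  {q | 3 * η * m ≤ (Finset.univ.filter fun i =>
    |matInner (q i).1 X - (q i).2 * t| ≤ 2 * η).card}

theorem measurableSet_nearEvent {d m : ℕ} (η t : ℝ) (X : Matrix (Fin d) (Fin d) ℝ) :
    MeasurableSet (nearEvent (m := m) η t X) := by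
  have hB : MeasurableSet {p : Matrix (Fin d) (Fin d) ℝ × ℝ |
      |matInner p.1 X - p.2 * t| ≤ 2 * η} := measurableSet_le
    (((measurable_matInner_right _).comp measurable_fst).sub (measurable_snd.mul_const _)).abs
    measurable_const
  have hc := measurable_card_filter (m := m) hB
  exact measurableSet_le measurable_const hc

open Classical in
theorem card_lt_of_notMem_nearEvent {d m : ℕ} {η t : ℝ} {X : Matrix (Fin d) (Fin d) ℝ}
    {q : Fin m → Matrix (Fin d) (Fin d) ℝ × ℝ} (hq : q ∉ nearEvent η t X) :
    ((Finset.univ.filter fun i => |matInner (q i).1 X - (q i).2 * t| ≤ 2 * η).card : ℝ) <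
      3 * η * m := by
  simpa only [nearEvent, Set.mem_ofPred_eq, not_le] using hq

/-- The signed sum at `X` deviates from its mean in the direction `Z`. -/
def deviationEvent {d m : ℕ} (I : Finset (Fin m)) (b t : ℝ) (c : Fin m → ℝ)
    (X Z : Matrix (Fin d) (Fin d) ℝ) : Set (Fin m → Matrix (Fin d) (Fin d) ℝ × ℝ) :=
  {q | b * m ≤ ∑ i ∈ I, (sgn (matInner (q i).1 X - (q i).2 * t) * matInner (q i).1 Z -
    Real.sqrt (2 / Real.pi) * c i * matInner X Z)}

theorem measurableSet_deviationEvent {d m : ℕ} (I : Finset (Fin m)) (b t : ℝ) (c : Fin m → ℝ)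
    (X Z : Matrix (Fin d) (Fin d) ℝ) : MeasurableSet (deviationEvent I b t c X Z) := by
  refine measurableSet_le measurable_const (Finset.measurable_sum _ fun i _ => ?_)
  have h1 : Measurable fun q : Fin m → Matrix (Fin d) (Fin d) ℝ × ℝ => q i := measurable_pi_apply i
  have h2 := (IsGOE.measurable_sgn_matInner_mul X Z t).comp h1
  exact h2.sub_const _

theorem sum_lt_of_notMem_deviationEvent {d m : ℕ} {I : Finset (Fin m)} {b t : ℝ} {c : Fin m → ℝ}
    {X Z : Matrix (Fin d) (Fin d) ℝ} {q : Fin m → Matrix (Fin d) (Fin d) ℝ × ℝ}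
    (hq : q ∉ deviationEvent I b t c X Z) :
    ∑ i ∈ I, (sgn (matInner (q i).1 X - (q i).2 * t) * matInner (q i).1 Z -
      Real.sqrt (2 / Real.pi) * c i * matInner X Z) < b * m := by
  simpa only [deviationEvent, Set.mem_ofPred_eq, not_le] using hq

open Classical in
/-- Too many offsets are unstable in the grid cell `g`. -/
def unstableEvent {d m : ℕ} (δ : ℝ) (g : ℝ × ℝ) :
    Set (Fin m → Matrix (Fin d) (Fin d) ℝ × ℝ) :=
  {q | 2 * (δ ^ 2 / 2 ^ 15) * m ≤ (Finset.univ.filter fun i =>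
    (q i).2 ∈ unstableOffsets δ g).card}

open Classical in
theorem measurableSet_unstableEvent {d m : ℕ} (δ : ℝ) (g : ℝ × ℝ) :
    MeasurableSet (unstableEvent (d := d) (m := m) δ g) := by
  have hB : MeasurableSet {p : Matrix (Fin d) (Fin d) ℝ × ℝ | p.2 ∈ unstableOffsets δ g} :=
    (measurableSet_unstableOffsets δ g).preimage measurable_snd
  have hc := measurable_card_filter (m := m) 
    (P := fun p : Matrix (Fin d) (Fin d) ℝ × ℝ => p.2 ∈ unstableOffsets δ g) hB
  exact measurableSet_le measurable_const hc

open Classical in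
theorem card_lt_of_notMem_unstableEvent {d m : ℕ} {δ : ℝ} {g : ℝ × ℝ}
    {q : Fin m → Matrix (Fin d) (Fin d) ℝ × ℝ} (hq : q ∉ unstableEvent δ g) :
    ((Finset.univ.filter fun i => (q i).2 ∈ unstableOffsets δ g).card : ℝ) <
      2 * (δ ^ 2 / 2 ^ 15) * m := by
  simpa only [unstableEvent, Set.mem_ofPred_eq, not_le] using hq

-- The exceptional set lives in the space of samples rather than in Ω, so that off it the bound is a
-- deterministic statement. In the arbitrary corruption model this allows the set to be read as one
-- of matrices alone. The subset I is free because there it is the uncorrupted set.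
open Classical in
theorem IsGOEPairSample.exists_uniform_event {Ω : Type*} [MeasurableSpace Ω] {μ : Measure Ω}
    [IsProbabilityMeasure μ] {d k m : ℕ} {A : Fin m → Ω → Matrix (Fin d) (Fin d) ℝ}
    {s : Fin m → Ω → ℝ} (h : IsGOEPairSample A s μ) (I : Finset (Fin m)) {δ : ℝ}
    (hd : 1 ≤ d) (hk : 1 ≤ k) (hδ : 0 < δ) (hδ1 : δ ≤ 1)
    (hm : 2 ^ 40 * ((d : ℝ) * k * max (Real.log (1 / δ)) 1 / δ ^ 4) ≤ m) :
    ∃ W : Set (Fin m → Matrix (Fin d) (Fin d) ℝ × ℝ), MeasurableSet W ∧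
      μ.real ((fun ω i => (A i ω, s i ω)) ⁻¹' W) ≤ Real.exp (-(m * δ ^ 4 / 2 ^ 32)) ∧
      ∀ q ∉ W, ∀ X : Matrix (Fin d) (Fin d) ℝ, X.IsSymm → X ≠ 0 → X.rank ≤ k →
        opNorm (∑ i ∈ I, (sgn (matInner (q i).1 X - (q i).2) • (q i).1 -
          (Real.sqrt (2 / Real.pi) *
            ∫ ω, Real.exp (-(s i ω) ^ 2 / (2 * frobNorm X ^ 2)) ∂μ) •
              ((frobNorm X)⁻¹ • X))) ≤ δ * m := by
  have hm1 : 1 ≤ m := by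
    rcases Nat.eq_zero_or_pos m with rfl | h0
    · have h1 : 0 < max (Real.log (1 / δ)) 1 := lt_max_of_lt_right one_pos
      have h2 : (0 : ℝ) < d := by exact_mod_cast hd
      have h3 : (0 : ℝ) < k := by exact_mod_cast hk
      have : 0 < 2 ^ 40 * ((d : ℝ) * k * max (Real.log (1 / δ)) 1 / δ ^ 4) := by positivity
      rw [Nat.cast_zero] at hm
      linarith
    · exact h0
  have hm0 : (0 : ℝ) < m := by exact_mod_cast hm1
  have hε1 : δ ^ 3 / 2 ^ 27 ≤ 1 := by
    have : δ ^ 3 ≤ 1 := pow_le_one₀ hδ.le hδ1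
    linarith
  obtain ⟨N₀, hN₀, hN₀c, hN₀cov⟩ := exists_net_of_subset_lowRankBall (d := d) (k := k)
    (T := lowRankBall d k) (fun _ hX => hX) (ε := 1 / 8) (by norm_num) (by norm_num)
  obtain ⟨N, hN, hNc, hNcov⟩ := exists_net_of_subset_lowRankBall (lowRankSphere_subset d k)
    (ε := δ ^ 3 / 2 ^ 27) (by positivity) hε1
  obtain ⟨V, hV, hVc, hVcov⟩ := exists_net_unitBall (EuclideanSpace ℝ (Fin d)) (ε := 1 / 4)
    (by norm_num) (by norm_num)
  obtain ⟨G, hGc, hG, hGcov⟩ := exists_offset_grid (μ := μ) h.measurable hm1 hδ hδ1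
  rw [finrank_euclideanSpace_fin] at hVc
  set η : ℝ := δ ^ 2 / 2 ^ 16 with hη
  let F : Fin m → ℝ → ℝ := fun i t => ∫ ω, Real.exp (-(s i ω * t) ^ 2 / 2) ∂μ
  let t : ℝ × ℝ → ℝ := fun g => g.1 / (1 - g.1)
  let Z : EuclideanSpace ℝ (Fin d) × EuclideanSpace ℝ (Fin d) → Matrix (Fin d) (Fin d) ℝ :=
    fun w => Matrix.vecMulVec w.1 w.2
  let W₁ : Matrix (Fin d) (Fin d) ℝ → Set (Fin m → Matrix (Fin d) (Fin d) ℝ × ℝ) :=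
    stretchEvent
  let W₂ : Matrix (Fin d) (Fin d) ℝ × (ℝ × ℝ) → Set (Fin m → Matrix (Fin d) (Fin d) ℝ × ℝ) :=
    fun x => nearEvent η (t x.2) x.1
  let W₃ : (Matrix (Fin d) (Fin d) ℝ × (ℝ × ℝ)) ×
      (EuclideanSpace ℝ (Fin d) × EuclideanSpace ℝ (Fin d)) →
      Set (Fin m → Matrix (Fin d) (Fin d) ℝ × ℝ) :=
    fun x => deviationEvent I (δ / 8) (t x.1.2) (fun i => F i (t x.1.2)) x.1.1 (Z x.2)
  let W₄ : ℝ × ℝ → Set (Fin m → Matrix (Fin d) (Fin d) ℝ × ℝ) :=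
    unstableEvent δ
  have hW₁m : ∀ x, MeasurableSet (W₁ x) := measurableSet_stretchEvent
  have hW₂m : ∀ x, MeasurableSet (W₂ x) := fun x => measurableSet_nearEvent _ _ _
  have hW₃m : ∀ x, MeasurableSet (W₃ x) := fun x => measurableSet_deviationEvent _ _ _ _ _ _
  have hW₄m : ∀ x, MeasurableSet (W₄ x) := measurableSet_unstableEvent δ
  have hΦ : Measurable fun ω i => (A i ω, s i ω) := measurable_pi_lambda _ h.measurable_pair
  set Φ : Ω → Fin m → Matrix (Fin d) (Fin d) ℝ × ℝ := fun ω i => (A i ω, s i ω) with hΦdef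
  have := Measure.isProbabilityMeasure_map (μ := μ) hΦ.aemeasurable
  have hZ : ∀ w ∈ V ×ˢ V, Z w ∈ lowRankBall d k := fun w hw =>
    vecMulVec_mem_lowRankBall hk (hV _ (Finset.mem_product.1 hw).1)
      (hV _ (Finset.mem_product.1 hw).2)
  have hη0 : 0 ≤ η := by positivity
  let W := (((⋃ x ∈ N₀, W₁ x) ∪ ⋃ x ∈ N ×ˢ G, W₂ x) ∪ ⋃ x ∈ (N ×ˢ G) ×ˢ (V ×ˢ V), W₃ x) ∪
    ⋃ x ∈ G, W₄ x
  have hWm : MeasurableSet W :=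
    (((Finset.measurableSet_biUnion _ fun x _ => hW₁m x).union
      (Finset.measurableSet_biUnion _ fun x _ => hW₂m x)).union
      (Finset.measurableSet_biUnion _ fun x _ => hW₃m x)).union
      (Finset.measurableSet_biUnion _ fun x _ => hW₄m x)
  refine ⟨W, hWm, ?_, ?_⟩
  · rw [← map_measureReal_apply hΦ hWm]
    have b₁ := measureReal_biUnion_le_card_mul (ν := μ.map Φ) N₀ W₁ fun x hx => by
      rw [map_measureReal_apply hΦ (hW₁m x)]
      exact h.measureReal_sens_le (frobNorm_le_one_of_mem_lowRankBall (hN₀ x hx))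
    have b₂ := measureReal_biUnion_le_card_mul (ν := μ.map Φ) (N ×ˢ G) W₂ fun x hx => by
      rw [map_measureReal_apply hΦ (hW₂m x)]
      have hx1 := hN _ (Finset.mem_product.1 hx).1
      exact h.measureReal_near_card_le hx1.1 hx1.2.2 _ hη0
    have b₃ := measureReal_biUnion_le_card_mul (ν := μ.map Φ) ((N ×ˢ G) ×ˢ (V ×ˢ V)) W₃
      fun x hx => by
        rw [map_measureReal_apply hΦ (hW₃m x)]
        obtain ⟨hx1, hx2⟩ := Finset.mem_product.1 hx
        have hx3 := hN _ (Finset.mem_product.1 hx1).1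
        exact h.measureReal_sgn_sum_le hx3.1 hx3.2.2
          (frobNorm_le_one_of_mem_lowRankBall (hZ _ hx2)) _ I (by positivity) (by linarith)
    have b₄ := measureReal_biUnion_le_card_mul (ν := μ.map Φ) G W₄ fun x hx => by
      rw [map_measureReal_apply hΦ (hW₄m x)]
      exact h.measureReal_offset_card_le (measurableSet_unstableOffsets δ x)
        (by positivity) (hG x hx).2.2.2
    have u₁ := measureReal_union_le (μ := μ.map Φ)
      (((⋃ x ∈ N₀, W₁ x) ∪ ⋃ x ∈ N ×ˢ G, W₂ x) ∪ ⋃ x ∈ (N ×ˢ G) ×ˢ (V ×ˢ V), W₃ x)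
      (⋃ x ∈ G, W₄ x)
    have u₂ := measureReal_union_le (μ := μ.map Φ)
      ((⋃ x ∈ N₀, W₁ x) ∪ ⋃ x ∈ N ×ˢ G, W₂ x) (⋃ x ∈ (N ×ˢ G) ×ˢ (V ×ˢ V), W₃ x)
    have u₃ := measureReal_union_le (μ := μ.map Φ) (⋃ x ∈ N₀, W₁ x) (⋃ x ∈ N ×ˢ G, W₂ x)
    simp only [Finset.card_product, Nat.cast_mul] at b₂ b₃
    have key := union_bound_exponent hd hk hδ hδ1 hm (n₀ := N₀.card) (n := N.card)
      (g := G.card) (v := V.card) (Nat.cast_nonneg _) (Nat.cast_nonneg _)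
      hN₀c hNc hGc hVc
    exact (u₁.trans (add_le_add (u₂.trans (add_le_add (u₃.trans (add_le_add b₁ b₂)) b₃))
      b₄)).trans key
  · intro q hq X hX hX0 hXr
    simp only [W, Set.mem_union, Set.mem_iUnion, not_or, not_exists] at hq
    obtain ⟨⟨⟨q₁, q₂⟩, q₃⟩, q₄⟩ := hq
    have hrip : ∀ Z ∈ lowRankBall d k, ‖sens (fun i => (q i).1) Z‖ ≤ 4 * Real.sqrt m := by
      intro Z hZ
      refine (norm_sens_le_of_net (S := 2 * Real.sqrt m) hN₀cov (fun x hx => ?_) hZ).trans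
        (le_of_eq (by ring))
      exact (not_le.1 (q₁ x hx)).le
    have hr := frobNorm_pos hX0
    set r := frobNorm X with hrdef
    have hY := inv_frobNorm_smul_mem_lowRankSphere hX hX0 hXr
    rw [← hrdef] at hY
    set Y := r⁻¹ • X with hYdef
    -- The compactified scale, chosen so that x/(1 − x) = 1/r.
    set x : ℝ := r⁻¹ / (1 + r⁻¹) with hx
    have hrinv : 0 < r⁻¹ := inv_pos.2 hr
    have hx0 : 0 ≤ x := by positivity
    have hx1 : x < 1 := by rw [hx, div_lt_one (by positivity)]; linarith
    have hxτ : x / (1 - x) = r⁻¹ := by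
      have : 1 + r⁻¹ ≠ 0 := by positivity
      have h1x : 1 - x = 1 / (1 + r⁻¹) := by rw [hx]; field_simp; ring
      rw [h1x, hx]; field_simp
    obtain ⟨g, hg, hg1, hg2⟩ := hGcov x ⟨hx0, hx1.le⟩
    obtain ⟨hg3, hg4, hg5, hg6⟩ := hG g hg
    obtain ⟨Y', hY', hD⟩ := hNcov Y hY
    have htτ : t g ≤ r⁻¹ := by rw [← hxτ]; exact div_one_sub_mono hg3 hg1 hx1
    have hbad : ((Finset.univ.filter fun i => ¬ (|(q i).2| * (r⁻¹ - t g) ≤ δ ^ 2 / 2 ^ 16 ∨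
        2 ^ 10 / δ ≤ |(q i).2| * t g)).card : ℝ) ≤ δ ^ 2 * m / 2 ^ 14 := by
      have h4 := (card_lt_of_notMem_unstableEvent (q₄ g hg)).le
      refine le_trans ?_ (h4.trans (le_of_eq (by ring)))
      rw [Nat.cast_le]
      refine Finset.card_le_card fun i hi => ?_
      rw [Finset.mem_filter] at hi ⊢
      refine ⟨hi.1, ?_⟩
      by_contra hns
      refine hi.2 ?_
      have := close_or_large_of_saturation hδ hδ1 hg3 hg1 hg2 hg5 hx1 (not_lt.1 hns)
      rwa [hxτ] at this
    have hnear := (card_lt_of_notMem_nearEvent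
      (q₂ (Y', g) (Finset.mem_product.2 ⟨hY', hg⟩))).le
    have hF0 : ∀ i, 0 ≤ F i r⁻¹ := fun i => integral_nonneg fun ω => (Real.exp_pos _).le
    have hF1 : ∀ i, F i r⁻¹ ≤ 1 := by
      intro i
      have hle : ∀ ω, Real.exp (-(s i ω * r⁻¹) ^ 2 / 2) ≤ 1 := fun ω =>
        Real.exp_le_one_iff.2 (by nlinarith [sq_nonneg (s i ω * r⁻¹)])
      refine (integral_mono_of_nonneg (Filter.Eventually.of_forall fun ω => (Real.exp_pos _).le)
        (integrable_const (1 : ℝ)) (Filter.Eventually.of_forall hle)).trans ?_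
      simp
    have hFF' : ∑ i, |F i r⁻¹ - F i (t g)| ≤ δ / 64 * m := by
      have := sum_abs_expMean_sub_le (μ := μ) h.measurable hδ hδ1 hg3 hg1 hg2 hg5 hx1 hg6
      rwa [hxτ] at this
    have hFeq : ∀ i, ∫ ω, Real.exp (-(s i ω) ^ 2 / (2 * r ^ 2)) ∂μ = F i r⁻¹ := by
      intro i
      refine integral_congr_ae (Filter.Eventually.of_forall fun ω => ?_)
      dsimp only
      congr 1
      field_simp
    have hsgn : ∀ i, sgn (matInner (q i).1 X - (q i).2) =
        sgn (matInner (q i).1 Y - (q i).2 * r⁻¹) := by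
      intro i
      rw [← sgn_mul_of_pos hrinv (matInner (q i).1 X - (q i).2), hYdef, matInner_smul_right]
      congr 1; ring
    simp only [hFeq, hsgn]
    have hnet : ∀ u ∈ V, ∀ v ∈ V, matInner (∑ i ∈ I,
        (sgn (matInner (q i).1 Y - (q i).2 * r⁻¹) • (q i).1 -
          (Real.sqrt (2 / Real.pi) * F i r⁻¹) • Y)) (Matrix.vecMulVec u v) ≤ δ / 2 * m := by
      intro u hu v hv
      have huv : (u, v) ∈ V ×ˢ V := Finset.mem_product.2 ⟨hu, hv⟩
      have hconc := (sum_lt_of_notMem_deviationEvent (q₃ ((Y', g), (u, v))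
        (Finset.mem_product.2 ⟨Finset.mem_product.2 ⟨hY', hg⟩, huv⟩))).le
      have := sum_sgn_sub_mean_le (a := fun i => (q i).1) (s := fun i => (q i).2)
        (F := fun i => F i r⁻¹) (F' := fun i => F i (t g)) (I := I) hδ hδ1 htτ hrip
        (lowRankSphere_subset d k hY) (lowRankSphere_subset d k (hN _ hY')) (hZ _ huv) hD
        hbad hnear hF0 hF1 hFF' hconc
      rw [matInner_sum_left]
      simpa only [matInner_sub_left, matInner_smul_left] using this
    -- The 1/4-net loses a factor 2, turning δ/2 into δ.
    have hop := opNorm_le_of_net hV hVcov hnet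
    linarith

/-! ### Random corruption -/

/-- The joint law of (f, g) is a product of two product measures; the measure-preserving
rearrangement (𝒳 × 𝒴)^ι ≅ 𝒳^ι × 𝒴^ι makes it a product over ι. -/
theorem iIndepFun_prodMk_of_indepFun {Ω ι 𝒳 𝒴 : Type*} [Fintype ι] [MeasurableSpace Ω]
    [MeasurableSpace 𝒳] [MeasurableSpace 𝒴] {μ : Measure Ω} [IsProbabilityMeasure μ]
    {f : ι → Ω → 𝒳} {g : ι → Ω → 𝒴} (hf : ∀ i, Measurable (f i)) (hg : ∀ i, Measurable (g i))
    (hfi : iIndepFun f μ) (hgi : iIndepFun g μ)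
    (hfg : IndepFun (fun ω i => f i ω) (fun ω i => g i ω) μ) :
    iIndepFun (fun i ω => (f i ω, g i ω)) μ := by
  have hf' : ∀ i, IsProbabilityMeasure (μ.map (f i)) := fun i =>
    Measure.isProbabilityMeasure_map (hf i).aemeasurable
  have hg' : ∀ i, IsProbabilityMeasure (μ.map (g i)) := fun i =>
    Measure.isProbabilityMeasure_map (hg i).aemeasurable
  rw [iIndepFun_iff_map_fun_eq_pi_map fun i => ((hf i).prodMk (hg i)).aemeasurable]
  have h1 : ∀ i, μ.map (fun ω => (f i ω, g i ω)) = (μ.map (f i)).prod (μ.map (g i)) := fun i =>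
    IndepFun.map_prod_eq_prod_map_map (hf i).aemeasurable (hg i).aemeasurable
      (hfg.comp (measurable_pi_apply i) (measurable_pi_apply i))
  have h2 := IndepFun.map_prod_eq_prod_map_map (measurable_pi_lambda _ hf).aemeasurable
    (measurable_pi_lambda _ hg).aemeasurable hfg
  rw [(iIndepFun_iff_map_fun_eq_pi_map fun i => (hf i).aemeasurable).1 hfi,
    (iIndepFun_iff_map_fun_eq_pi_map fun i => (hg i).aemeasurable).1 hgi] at h2
  have h3 := (measurePreserving_arrowProdEquivProdArrow 𝒳 𝒴 ι (fun i => μ.map (f i))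
    (fun i => μ.map (g i))).symm.map_eq
  rw [← h2, Measure.map_map (MeasurableEquiv.measurable _)
    ((measurable_pi_lambda _ hf).prodMk (measurable_pi_lambda _ hg))] at h3
  simp only [h1]
  exact h3

namespace RCModel

variable {Ω : Type*} [MeasurableSpace Ω] {μ : Measure Ω} [IsProbabilityMeasure μ] {d m : ℕ}
  {A : Fin m → Ω → Matrix (Fin d) (Fin d) ℝ} {s : Fin m → Ω → ℝ} {p : ℝ}

theorem isGOEPairSample (h : RCModel A s p μ) (hA : IsGOESample A μ) : IsGOEPairSample A s μ where
  goe := hA.goe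
  measurable := h.measurable
  indep := iIndepFun_prodMk_of_indepFun (fun i => (hA.goe i).measurable) h.measurable hA.indep
    h.indep h.indep_sensing
  indep_offset i := h.indep_sensing.comp (measurable_pi_apply i) (measurable_pi_apply i)

/-- On {s_i = 0}, of probability 1 − p, the integrand is 1; so the stated scaling is the
unconditional mean produced by the Gaussian computation. -/
theorem mixture_eq_integral (h : RCModel A s p μ) (hp : 0 < p) (i : Fin m) (r : ℝ) :
    1 - p + p * ∫ ω, Real.exp (-(s i ω) ^ 2 / (2 * r ^ 2)) ∂(μ[|{ω' | s i ω' ≠ 0}]) =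
      ∫ ω, Real.exp (-(s i ω) ^ 2 / (2 * r ^ 2)) ∂μ := by
  set S : Set Ω := {ω' | s i ω' ≠ 0} with hS
  have hSm : MeasurableSet S := h.measurable i (measurableSet_singleton 0).compl
  have hSp : μ.real S = p := by
    rw [measureReal_def, h.prob_ne_zero i, ENNReal.toReal_ofReal hp.le]
  have hint : Integrable (fun ω => Real.exp (-(s i ω) ^ 2 / (2 * r ^ 2))) μ := by
    have := h.measurable i
    refine (integrable_const (1 : ℝ)).mono' (by fun_prop) (Filter.Eventually.of_forall fun ω => ?_)
    rw [Real.norm_of_nonneg (Real.exp_pos _).le]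
    refine Real.exp_le_one_iff.2 (div_nonpos_of_nonpos_of_nonneg ?_ (by positivity))
    nlinarith [sq_nonneg (s i ω)]
  rw [← integral_add_compl hSm hint]
  have h1 : ∫ ω in Sᶜ, Real.exp (-(s i ω) ^ 2 / (2 * r ^ 2)) ∂μ = 1 - p := by
    rw [← hSp, ← probReal_compl_eq_one_sub hSm]
    have : ∀ ω ∈ Sᶜ, Real.exp (-(s i ω) ^ 2 / (2 * r ^ 2)) = 1 := by
      intro ω hω
      have h0 : s i ω = 0 := by simpa [hS] using hω
      simp [h0]
    rw [setIntegral_congr_fun hSm.compl this]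
    simp
  rw [h1, ProbabilityTheory.cond, integral_smul_measure, ENNReal.toReal_inv, ← measureReal_def,
    hSp, smul_eq_mul, mul_inv_cancel_left₀ hp.ne']
  ring

theorem holdsWithProb (h : RCModel A s p μ) (hA : IsGOESample A μ) (hp : 0 < p) {k : ℕ} {δ : ℝ}
    (hd : 1 ≤ d) (hk : 1 ≤ k) (hm1 : 1 ≤ m) (hδ : 0 < δ) (hδ1 : δ ≤ 1)
    (hm : 2 ^ 40 * ((d : ℝ) * k * max (Real.log (1 / δ)) 1 / δ ^ 4) ≤ m) :
    HoldsWithProb μ (1 - Real.exp (-(m * δ ^ 4 / 2 ^ 32)))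
      (fun ω => RDPP (fun i => A i ω) (fun i => s i ω) k δ (psiRC s p μ)) := by
  have hs := h.isGOEPairSample hA
  obtain ⟨W, hW, hWp, hWX⟩ := hs.exists_uniform_event Finset.univ hd hk hδ hδ1 hm
  have hΦ : Measurable fun ω i => (A i ω, s i ω) := measurable_pi_lambda _ hs.measurable_pair
  refine ⟨((fun ω i => (A i ω, s i ω)) ⁻¹' W)ᶜ, (hΦ hW).compl, ?_, ?_⟩
  · intro ω hω X hX hX0 hXr
    have hm0 : (0 : ℝ) < m := by exact_mod_cast hm1
    have hb := hWX _ hω X hX hX0 hXr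
    have he : subgrad (fun i => A i ω) (fun i => s i ω) X -
        psiRC s p μ X • ((frobNorm X)⁻¹ • X) =
        (1 / (m : ℝ)) • ∑ i ∈ Finset.univ, (sgn (matInner (A i ω) X - s i ω) • A i ω -
          (Real.sqrt (2 / Real.pi) *
            ∫ ω, Real.exp (-(s i ω) ^ 2 / (2 * frobNorm X ^ 2)) ∂μ) •
              ((frobNorm X)⁻¹ • X)) := by
      rw [subgrad, psiRC, Finset.sum_sub_distrib, smul_sub, mul_smul, ← Finset.sum_smul]
      simp only [h.mixture_eq_integral hp]
    rw [he, opNorm_smul, abs_of_pos (by positivity), one_div, inv_mul_le_iff₀ hm0]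
    exact hb.trans_eq (mul_comm _ _)
  · rw [probReal_compl_eq_one_sub (hΦ hW)]
    linarith

end RCModel

/-! ### Arbitrary corruption -/

/-- Worst-case signs: no relation between σ and a is assumed, so only the absolute measurements and
the trivial bound on the mean are used. -/
theorem opNorm_sum_sgn_smul_sub_le {d m : ℕ} {V : Finset (EuclideanSpace ℝ (Fin d))}
    (hV : ∀ u ∈ V, ‖u‖ ≤ 1) {ε b κ κ' : ℝ}
    (hVcov : ∀ u : EuclideanSpace ℝ (Fin d), ‖u‖ ≤ 1 → ∃ v ∈ V, ‖u - v‖ ≤ ε)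
    (hκ : 0 ≤ κ) (hκκ : κ ≤ κ')
    {a : Fin m → Matrix (Fin d) (Fin d) ℝ} {T : Finset (Fin m)} {σ : Fin m → ℝ}
    {Y : Matrix (Fin d) (Fin d) ℝ} (hY : frobNorm Y = 1)
    (hfr : ∀ u ∈ V, ∀ v ∈ V, frobNorm (Matrix.vecMulVec u v) ≤ 1)
    (hb : ∀ u ∈ V, ∀ v ∈ V, ∑ i ∈ T, |matInner (a i) (Matrix.vecMulVec u v)| < b)
    (hσ : ∀ i, |σ i| = 1) :
    (1 - 2 * ε) * opNorm (∑ i ∈ T, (σ i • a i - κ • Y)) ≤ b + T.card * κ' := by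
  refine opNorm_le_of_net hV hVcov fun u hu v hv => ?_
  have hR := hb u hu v hv
  have hYle := (abs_matInner_le Y (Matrix.vecMulVec u v)).trans_eq (by rw [hY, one_mul])
  have hYle := hYle.trans (hfr u hu v hv)
  generalize Matrix.vecMulVec u v = Z at *
  have key : ∀ i, matInner (σ i • a i - κ • Y) Z ≤ |matInner (a i) Z| + κ' := by
    intro i
    rw [matInner_sub_left, matInner_smul_left, matInner_smul_left]
    have e1 : σ i * matInner (a i) Z ≤ |matInner (a i) Z| := by
      refine (le_abs_self _).trans ?_
      rw [abs_mul, hσ, one_mul]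
    have e2 : -(κ * matInner Y Z) ≤ κ' := by
      refine (neg_le_abs _).trans ?_
      rw [abs_mul, abs_of_nonneg hκ]
      exact (mul_le_of_le_one_right hκ hYle).trans hκκ
    linarith
  rw [matInner_sum_left]
  refine (Finset.sum_le_sum fun i _ => key i).trans ?_
  rw [Finset.sum_add_distrib, Finset.sum_const, nsmul_eq_mul]
  linarith

theorem subgrad_sub_eq {d m : ℕ} (hm : 1 ≤ m) {a : Fin m → Matrix (Fin d) (Fin d) ℝ}
    {T : Finset (Fin m)} {s : Fin m → ℝ} (hs : corrSupport s = T)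
    {X Y : Matrix (Fin d) (Fin d) ℝ} {κ : ℝ} :
    subgrad a s X - κ • Y = (1 / (m : ℝ)) •
      (∑ i ∈ Tᶜ, (sgn (matInner (a i) X) • a i - κ • Y) +
        ∑ i ∈ T, (sgn (matInner (a i) X - s i) • a i - κ • Y)) := by
  have hm0 : (m : ℝ) ≠ 0 := by exact_mod_cast (by omega : m ≠ 0)
  have e1 : ∑ i ∈ Tᶜ, (sgn (matInner (a i) X) • a i - κ • Y) =
      ∑ i ∈ Tᶜ, (sgn (matInner (a i) X - s i) • a i - κ • Y) := by
    refine Finset.sum_congr rfl fun i hi => ?_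
    have h0 : s i = 0 := by
      by_contra h
      exact (Finset.mem_compl.1 hi) (by rw [← hs]; simp [corrSupport, h])
    rw [h0, sub_zero]
  rw [e1, add_comm, Finset.sum_add_sum_compl, Finset.sum_sub_distrib, smul_sub, subgrad,
    Finset.sum_const, Finset.card_univ, Fintype.card_fin, ← Nat.cast_smul_eq_nsmul ℝ,
    smul_smul (1 / (m : ℝ)), one_div, inv_mul_cancel₀ hm0, one_smul]

namespace IsGOESample

variable {Ω : Type*} [MeasurableSpace Ω] {μ : Measure Ω} [IsProbabilityMeasure μ] {d m : ℕ}
  {A : Fin m → Ω → Matrix (Fin d) (Fin d) ℝ}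

theorem isGOEPairSample_zero (hA : IsGOESample A μ) : IsGOEPairSample A (fun _ _ => 0) μ where
  goe := hA.goe
  measurable _ := measurable_const
  indep := hA.indep.comp (fun _ a => (a, (0 : ℝ))) fun _ => measurable_id.prodMk measurable_const
  indep_offset _ := indepFun_const_right _ 0

theorem measureReal_sum_abs_le (hA : IsGOESample A μ) (T : Finset (Fin m))
    {Z : Matrix (Fin d) (Fin d) ℝ} (hZ : frobNorm Z ≤ 1) (b : ℝ) :
    μ.real {ω | b ≤ ∑ i ∈ T, |matInner (A i ω) Z|} ≤
      Real.exp (T.card * (Real.log 2 + (9 / 5) ^ 2 / 2) - 9 / 5 * b) := by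
  have hmeas : ∀ i, Measurable fun ω => matInner (A i ω) Z := fun i =>
    (hA.goe i).measurable_matInner Z
  have hind : iIndepFun (fun i ω => |matInner (A i ω) Z|) μ :=
    hA.indep.comp (fun _ a => |matInner a Z|) fun _ => (measurable_matInner_right Z).abs
  have hmg : ∀ i, Integrable (fun ω => Real.exp (9 / 5 * |matInner (A i ω) Z|)) μ ∧
      mgf (fun ω => |matInner (A i ω) Z|) μ (9 / 5) ≤
        Real.exp (Real.log 2 + (9 / 5) ^ 2 / 2) := by
    intro i
    obtain ⟨v, hv, hl⟩ := hA.isGOEPairSample_zero.map_matInner_le_one i hZ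
    exact mgf_abs_le_of_gaussian (hmeas i) hv hl _
  exact measureReal_le_exp_of_mgf_le hind (fun i => (hmeas i).abs) T (by norm_num)
    (fun i _ => (hmg i).1) (fun i _ => (hmg i).2)

/-- The exceptional set depends on T but not on the corruption values, so these may be chosen after
seeing the matrices. The clean part is allotted δ/2; the corrupted part contributes less than 3p
plus a multiple of d/m absorbed by the other δ/2. -/
theorem exists_event_of_support (hA : IsGOESample A μ) (T : Finset (Fin m)) {k : ℕ} {δ p : ℝ}
    (hd : 1 ≤ d) (hk : 1 ≤ k) (hm1 : 1 ≤ m) (hδ : 0 < δ) (hδ1 : δ ≤ 1)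
    (hm : 2 ^ 45 * ((d : ℝ) * k * max (Real.log (1 / δ)) 1 / δ ^ 4) ≤ m)
    (hT : (T.card : ℝ) ≤ p * m) :
    ∃ W : Set (Fin m → Matrix (Fin d) (Fin d) ℝ), MeasurableSet W ∧
      μ.real ((fun ω i => A i ω) ⁻¹' W) ≤
        Real.exp (-(p * m + d)) + Real.exp (-(1 / 2 ^ 36 * m * δ ^ 4)) ∧
      ∀ a ∉ W, ∀ s : Fin m → ℝ, corrSupport s = T →
        RDPP a s k (δ + 3 * Real.sqrt (d * p / m) + 3 * p) (fun _ => Real.sqrt (2 / Real.pi)) := by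
  have hm0 : (0 : ℝ) < m := by exact_mod_cast hm1
  have hd0 : (1 : ℝ) ≤ d := by exact_mod_cast hd
  have hk0 : (1 : ℝ) ≤ k := by exact_mod_cast hk
  have hL1 : 1 ≤ max (Real.log (1 / δ)) 1 := le_max_right _ _
  -- Halving δ costs 2⁴ from the fourth power and at most 2 from the logarithm, hence 2⁴⁵.
  have hm' : 2 ^ 40 * ((d : ℝ) * k * max (Real.log (1 / (δ / 2))) 1 / (δ / 2) ^ 4) ≤ m := by
    refine le_trans ?_ hm
    have h1 : max (Real.log (1 / (δ / 2))) 1 ≤ 2 * max (Real.log (1 / δ)) 1 := by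
      refine max_le ?_ (by linarith)
      have : 1 / (δ / 2) = 2 * (1 / δ) := by field_simp
      rw [this, Real.log_mul two_ne_zero (by positivity)]
      have := le_max_left (Real.log (1 / δ)) 1
      have := Real.log_two_lt_d9
      linarith
    calc _ ≤ 2 ^ 40 * ((d : ℝ) * k * (2 * max (Real.log (1 / δ)) 1) / (δ / 2) ^ 4) := by gcongr
      _ = _ := by field_simp
  have hdm : 10 * (d : ℝ) ≤ δ / 2 * m := by
    have h1 : (d : ℝ) ≤ d * k * max (Real.log (1 / δ)) 1 := by
      rw [mul_assoc]
      exact le_mul_of_one_le_right (by linarith) (one_le_mul_of_one_le_of_one_le hk0 hL1)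
    have h2 : 2 ^ 45 * (d * k * max (Real.log (1 / δ)) 1) ≤ m * δ ^ 4 := by
      rwa [← mul_div_assoc, div_le_iff₀ (by positivity)] at hm
    have h3 : δ ^ 4 ≤ δ := by
      have : δ ^ 3 ≤ 1 := pow_le_one₀ hδ.le hδ1
      nlinarith
    have h4 : m * δ ^ 4 ≤ m * δ := mul_le_mul_of_nonneg_left h3 hm0.le
    linarith
  obtain ⟨W₀, hW₀, hW₀p, hW₀X⟩ := hA.isGOEPairSample_zero.exists_uniform_event Tᶜ hd hk
    (half_pos hδ) (by linarith) hm'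
  obtain ⟨V, hV, hVc, hVcov⟩ := exists_net_unitBall (EuclideanSpace ℝ (Fin d)) (ε := 1 / 32)
    (by norm_num) (by norm_num)
  rw [finrank_euclideanSpace_fin] at hVc
  have hi : Measurable fun (a : Fin m → Matrix (Fin d) (Fin d) ℝ) i => (a i, (0 : ℝ)) :=
    measurable_pi_lambda _ fun i => (measurable_pi_apply i).prodMk measurable_const
  have hΦ : Measurable fun ω i => A i ω := measurable_pi_lambda _ fun i => (hA.goe i).measurable
  -- At Chernoff parameter 9/5, (9/5)(37/20) = 2.33 + 1, where 2.33 bounds log 2 + (9/5)²/2; and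
  -- (9/5)·9 = 16.2 exceeds the cost 14 of pairs from the net by more than 1. The parameter nearly
  -- minimizes (log 2 + t²/2 + 1)/t.
  set b : ℝ := 37 / 20 * (p * m) + 9 * d with hb
  let R : EuclideanSpace ℝ (Fin d) × EuclideanSpace ℝ (Fin d) →
      Set (Fin m → Matrix (Fin d) (Fin d) ℝ) :=
    fun w => {a | b ≤ ∑ i ∈ T, |matInner (a i) (Matrix.vecMulVec w.1 w.2)|}
  have hRm : ∀ w, MeasurableSet (R w) := by
    intro w
    refine measurableSet_le measurable_const (Finset.measurable_sum _ fun i _ => ?_)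
    exact ((measurable_matInner_right _).comp (measurable_pi_apply i)).abs
  have hRU : MeasurableSet (⋃ w ∈ V ×ˢ V, R w) := Finset.measurableSet_biUnion _ fun w _ => hRm w
  have hfr : ∀ w ∈ V ×ˢ V, frobNorm (Matrix.vecMulVec w.1 w.2) ≤ 1 := fun w hw =>
    frobNorm_le_one_of_mem_lowRankBall (vecMulVec_mem_lowRankBall hk
      (hV _ (Finset.mem_product.1 hw).1) (hV _ (Finset.mem_product.1 hw).2))
  refine ⟨(fun a i => (a i, (0 : ℝ))) ⁻¹' W₀ ∪ ⋃ w ∈ V ×ˢ V, R w, (hi hW₀).union hRU, ?_, ?_⟩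
  · rw [Set.preimage_union]
    refine (measureReal_union_le _ _).trans ?_
    rw [add_comm]
    refine add_le_add ?_ ?_
    · rw [← map_measureReal_apply hΦ hRU]
      have hR := measureReal_biUnion_le_card_mul (ν := μ.map fun ω i => A i ω) (V ×ˢ V) R
        fun w hw => by
          rw [map_measureReal_apply hΦ (hRm w)]
          exact hA.measureReal_sum_abs_le T (hfr w hw) b
      refine hR.trans ?_
      have hV7 : (V.card : ℝ) ≤ Real.exp (7 * d) := by
        refine hVc.trans ?_
        have h2 : (2 : ℝ) ≤ Real.exp 1 := by linarith [Real.add_one_le_exp (1 : ℝ)]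
        have h96 : (3 / (1 / 32) : ℝ) ≤ Real.exp 7 := by
          have h3 := pow_le_pow_left₀ zero_le_two h2 7
          rw [Real.exp_one_pow] at h3
          norm_num at h3 ⊢
          linarith
        calc _ ≤ Real.exp 7 ^ d := pow_le_pow_left₀ (by norm_num) h96 _
          _ = _ := by rw [← Real.exp_nat_mul]; ring_nf
      rw [Finset.card_product, Nat.cast_mul]
      calc _ ≤ Real.exp (7 * d) * Real.exp (7 * d) *
            Real.exp (T.card * (Real.log 2 + (9 / 5) ^ 2 / 2) - 9 / 5 * b) := by gcongr
        _ = Real.exp (14 * d + (T.card * (Real.log 2 + (9 / 5) ^ 2 / 2) - 9 / 5 * b)) := by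
            rw [← Real.exp_add, ← Real.exp_add]; ring_nf
        _ ≤ _ := by
            refine Real.exp_le_exp.2 ?_
            have hlog : Real.log 2 + (9 / 5) ^ 2 / 2 ≤ 233 / 100 := by
              have := Real.log_two_lt_d9; linarith
            have h1 : T.card * (Real.log 2 + (9 / 5) ^ 2 / 2) ≤ p * m * (233 / 100) :=
              (mul_le_mul_of_nonneg_left hlog (Nat.cast_nonneg _)).trans
                (mul_le_mul_of_nonneg_right hT (by norm_num))
            rw [hb]
            linarith
    · refine hW₀p.trans (le_of_eq ?_)
      congr 1
      ring
  · intro a ha s hs X hX hX0 hXr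
    simp only [Set.mem_union, Set.mem_iUnion, not_or, not_exists] at ha
    obtain ⟨ha₁, ha₂⟩ := ha
    have h₁ := hW₀X _ ha₁ X hX hX0 hXr
    simp only [sub_zero, ne_eq, OfNat.ofNat_ne_zero, not_false_eq_true, zero_pow, neg_zero,
      zero_div, Real.exp_zero, integral_const, probReal_univ, one_smul, mul_one] at h₁
    set κ := Real.sqrt (2 / Real.pi) with hκ
    have hκ8 : κ ≤ 4 / 5 := by
      rw [hκ, Real.sqrt_le_left (by norm_num), div_le_iff₀ Real.pi_pos]
      linarith [Real.pi_gt_d2]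
    have hY := inv_frobNorm_smul_mem_lowRankSphere hX hX0 hXr
    set Y := (frobNorm X)⁻¹ • X with hYdef
    have hp0 : 0 ≤ p * m := (Nat.cast_nonneg _).trans hT
    have h₂ := opNorm_sum_sgn_smul_sub_le hV hVcov (Real.sqrt_nonneg _) hκ8 hY.2.2
      (b := b) (a := a) (T := T) (fun u hu v hv => hfr (u, v) (Finset.mem_product.2 ⟨hu, hv⟩))
      (fun u hu v hv => not_le.1 (ha₂ (u, v) (Finset.mem_product.2 ⟨hu, hv⟩)))
      (fun i => abs_sgn (matInner (a i) X - s i))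
    rw [subgrad_sub_eq hm1 hs, opNorm_smul, abs_of_pos (by positivity), one_div,
      inv_mul_le_iff₀ hm0]
    refine (opNorm_add_le _ _).trans ?_
    -- The square-root term is pure slack. The 1/32-net gives at most (16/15)((37/20 + 4/5)pm + 9d)
    -- ≤ 3pm + 10d, and 10d ≤ δm/2.
    have hsq : 0 ≤ m * (3 * Real.sqrt (d * p / m)) := by positivity
    rw [mul_add, mul_add]
    linarith

end IsGOESample

/-- For each admissible support T the good event for the matrices is independent of {support = T}.
These events are disjoint, each of probability 1/binom(m, ⌊pm⌋), so summing over T recovers the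
conditional bound without loss. -/
theorem ACModel.holdsWithProb {Ω : Type*} [MeasurableSpace Ω] {μ : Measure Ω}
    [IsProbabilityMeasure μ] {d m : ℕ} {A : Fin m → Ω → Matrix (Fin d) (Fin d) ℝ}
    {s : Fin m → Ω → ℝ} {p : ℝ} (h : ACModel A s p μ) (hA : IsGOESample A μ)
    (hp : 0 ≤ p) (hp1 : p ≤ 1) {k : ℕ} {δ : ℝ}
    (hd : 1 ≤ d) (hk : 1 ≤ k) (hm1 : 1 ≤ m) (hδ : 0 < δ) (hδ1 : δ ≤ 1)
    (hm : 2 ^ 45 * ((d : ℝ) * k * max (Real.log (1 / δ)) 1 / δ ^ 4) ≤ m) :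
    HoldsWithProb μ
      (1 - Real.exp (-(p * m + d)) - Real.exp (-(1 / 2 ^ 36 * m * δ ^ 4)))
      (fun ω => RDPP (fun i => A i ω) (fun i => s i ω) k
        (δ + 3 * Real.sqrt (d * p / m) + 3 * p) (fun _ => Real.sqrt (2 / Real.pi))) := by
  set N := ⌊p * m⌋₊ with hN
  have hNp : (N : ℝ) ≤ p * m := Nat.floor_le (by positivity)
  have hNm : N ≤ m := by
    have : (N : ℝ) ≤ m := hNp.trans (mul_le_of_le_one_left (Nat.cast_nonneg _) hp1)
    exact_mod_cast this
  set F : Finset (Finset (Fin m)) := Finset.powersetCard N Finset.univ with hF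
  have hFc : F.card = m.choose N := by simp [hF, Finset.card_powersetCard]
  have hch : (0 : ℝ) < m.choose N := by exact_mod_cast Nat.choose_pos hNm
  choose! W hW hWp hWR using fun (T : Finset (Fin m)) (hT : T ∈ F) =>
    hA.exists_event_of_support T (p := p) hd hk hm1 hδ hδ1 hm
      (by rwa [(Finset.mem_powersetCard.1 hT).2])
  have hΦ : Measurable fun ω i => A i ω := measurable_pi_lambda _ fun i => (hA.goe i).measurable
  set G : Finset (Fin m) → Set Ω := fun T => (fun ω i => A i ω) ⁻¹' (W T)ᶜ with hG
  set S : Finset (Fin m) → Set Ω := fun T => {ω | corrSupport (fun i => s i ω) = T} with hS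
  have hGm : ∀ T ∈ F, MeasurableSet (G T) := fun T hT => hΦ (hW T hT).compl
  have hprob : ∀ T ∈ F, (1 - Real.exp (-(p * m + d)) - Real.exp (-(1 / 2 ^ 36 * m * δ ^ 4))) *
      ((m.choose N : ℝ))⁻¹ ≤ μ.real (G T ∩ S T) := by
    intro T hT
    have hi : μ (G T ∩ S T) = μ (G T) * μ (S T) :=
      (Indep_iff _ _ μ).1 h.indep _ _ ⟨_, (hW T hT).compl, rfl⟩ ⟨{T}, trivial, rfl⟩
    have hST : μ (S T) = ((m.choose N : ℕ) : ENNReal)⁻¹ :=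
      h.uniform T (Finset.mem_powersetCard.1 hT).2
    rw [measureReal_def, hi, hST, ENNReal.toReal_mul, ENNReal.toReal_inv, ENNReal.toReal_natCast,
      ← measureReal_def]
    refine mul_le_mul_of_nonneg_right ?_ (by positivity)
    have hc : G T = ((fun ω i => A i ω) ⁻¹' W T)ᶜ := rfl
    rw [hc, probReal_compl_eq_one_sub (hΦ (hW T hT))]
    linarith [hWp T hT]
  refine ⟨⋃ T ∈ F, G T ∩ S T,
    Finset.measurableSet_biUnion _ fun T hT => (hGm T hT).inter (h.measurable T), ?_, ?_⟩
  · intro ω hω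
    obtain ⟨T, hT, hω₁, hω₂⟩ := by simpa only [Set.mem_iUnion, exists_prop] using hω
    exact hWR T hT _ hω₁ _ hω₂
  · rw [measureReal_biUnion_finset _ fun T hT => (hGm T hT).inter (h.measurable T)]
    · refine le_trans (le_of_eq ?_) (Finset.sum_le_sum hprob)
      rw [Finset.sum_const, hFc, nsmul_eq_mul, mul_left_comm, mul_inv_cancel₀ hch.ne', mul_one]
    · intro T _ T' _ hTT'
      refine Set.disjoint_left.2 fun ω hω hω' => hTT' ?_
      have h1 : corrSupport (fun i => s i ω) = T := hω.2
      have h2 : corrSupport (fun i => s i ω) = T' := hω'.2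
      exact h1.symm.trans h2

theorem mainTheorem3 :
    ∃ C₀ c c' C : ℝ, 0 < C₀ ∧ 0 < c ∧ 0 < c' ∧ 0 < C ∧
      ∀ (d k m : ℕ) (δ : ℝ), 1 ≤ d → 1 ≤ k → 0 < δ → δ ≤ 1 →
        C₀ * ((d : ℝ) * k * max (Real.log (1 / δ)) 1 / δ ^ 4) ≤ m →
        ∀ (Ω : Type*) [MeasurableSpace Ω] (μ : Measure Ω) [IsProbabilityMeasure μ]
          (A : Fin m → Ω → Matrix (Fin d) (Fin d) ℝ), IsGOESample A μ →
          (∀ (p : ℝ) (s : Fin m → Ω → ℝ), 0 ≤ p → p ≤ 1 → ACModel A s p μ →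
            HoldsWithProb μ
              (1 - Real.exp (-(p * m + d)) - Real.exp (-(c' * m * δ ^ 4)))
              (fun ω => RDPP (fun i => A i ω) (fun i => s i ω) k
                (δ + 3 * Real.sqrt (d * p / m) + 3 * p)
                (fun _ => Real.sqrt (2 / Real.pi)))) ∧
          (∀ (p : ℝ) (s : Fin m → Ω → ℝ), 0 < p → p < 1 → RCModel A s p μ →
            HoldsWithProb μ
              (1 - C * Real.exp (-(c * m * δ ^ 4)))
              (fun ω => RDPP (fun i => A i ω) (fun i => s i ω) k δ (psiRC s p μ))) := by
  refine ⟨2 ^ 45, 1 / 2 ^ 32, 1 / 2 ^ 36, 1, by positivity, by positivity, by positivity,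
    one_pos, ?_⟩
  intro d k m δ hd hk hδ hδ1 hm Ω _ μ _ A hA
  have h0 : 0 < (d : ℝ) * k * max (Real.log (1 / δ)) 1 / δ ^ 4 := by
    have h1 : 0 < max (Real.log (1 / δ)) 1 := lt_max_of_lt_right one_pos
    have h2 : (0 : ℝ) < d := by exact_mod_cast hd
    have h3 : (0 : ℝ) < k := by exact_mod_cast hk
    positivity
  have hm1 : 1 ≤ m := by
    have hm0 : (0 : ℝ) < m := by linarith
    exact_mod_cast hm0
  refine ⟨fun p s hp hp1 h => h.holdsWithProb hA hp hp1 hd hk hm1 hδ hδ1 hm,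
    fun p s hp _ h => ?_⟩
  have hR := h.holdsWithProb hA hp hd hk hm1 hδ hδ1 (by linarith)
  have e : 1 - 1 * Real.exp (-(1 / 2 ^ 32 * m * δ ^ 4)) =
      1 - Real.exp (-(m * δ ^ 4 / 2 ^ 32)) := by ring_nf
  rwa [e]
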